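/- Let $k$ be a field. A finite category over $k$ is a $k$-linear category that is $k$-linearly equivalent to the category of finite-dimensional right modules over a finite-dimensional $k$-algebra; a finite monoidal category over $k$ is a monoidal category which is a finite category over $k$ and whose tensor product is $k$-bilinear and right exact in each variable; rigid means that every object has a left and a right dual. A multi-tensor category is a rigid finite monoidal category. Let $\mathcal C$ be a braided multi-tensor category over $k$. Let $\mathcal M$ be a rigid monoidal right $\mathcal C$-module, i.e. a rigid finite monoidal category with a $k$-linear right exact braided monoidal functor $\phi_{\mathcal M}:\mathcal C\to\mathfrak Z(\mathcal M)$ to the Drinfeld center, and let $\mathcal N$ be a rigid monoidal left $\mathcal C$-module, i.e. a rigid finite monoidal category with a $k$-linear right exact braided monoidal functor $\phi_{\mathcal N}:\mathcal C^{\mathrm{rev}}\to\mathfrak Z(\mathcal N)$, where $\mathcal C^{\mathrm{rev}}$ is $\mathcal C$ with $a\otimes^{\mathrm{rev}}b=b\otimes a$ and braiding $\beta_{a,b}^{-1}$. Forgetting structure, $\mathcal M$ is a right and $\mathcal N$ a left $\mathcal C$-module by $x\odot c=x\otimes\phi_{\mathcal M}(c)$ and $c\odot y=y\otimes\phi_{\mathcal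 N}(c)$. Let $\boxtimes_{\mathcal C}:\mathcal M\times\mathcal N\to\mathcal M\boxtimes_{\mathcal C}\mathcal N$ be the tensor product over $\mathcal C$: the universal functor to a category with finite colimits that preserves finite colimits in each variable and is $\mathcal C$-balanced. Give $\mathcal M\boxtimes_{\mathcal C}\mathcal N$ its $k$-linear structure, for which $\boxtimes_{\mathcal C}$ is $k$-linear in each variable, and its canonical monoidal structure, or indeed any monoidal structure whose tensor product is right exact in each variable and for which $\boxtimes_{\mathcal C}$ is a monoidal functor. Then $\mathcal M\boxtimes_{\mathcal C}\mathcal N$ is a finite monoidal category over $k$, and it is an r-category: all internal homs $[x,y]$, defined by $\mathrm{Hom}(a,[x,y])\simeq\mathrm{Hom}(a\otimes x,y)$, exist in it, and the functor $[-,\mathbf 1]:\mathcal M\boxtimes_{\mathcal C}\mathcal N\to(\mathcal M\boxtimes_{\mathcal C}\mathcal N)^{\mathrm{op}}$ is an equivalence. Moreover, the following conditions are equivalent: 1. The monoidal category $\mathcal M\boxtimes_{\mathcal C}\mathcal N$ is rigid. 2. The tensor product of $\mathcal M\boxtimes_{\mathcal C}\mathcal N$ is left exact separately in each variable. 3. For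 all $a,b\in\mathcal M\boxtimes_{\mathcal C}\mathcal N$ one has $\mathrm{length}(a\otimes b)=\mathrm{length}(s(a)\otimes s(b))$, where $s(a)$ is the direct sum of the simple subquotients of a composition series of $a$. 4. The equality in (3) holds for $a=a'\boxtimes_{\mathcal C}a''$ and $b=b'\boxtimes_{\mathcal C}b''$ whenever $a',b'\in\mathcal M$ and $a'',b''\in\mathcal N$ are simple. In particular, if $x\boxtimes_{\mathcal C}y$ is semisimple for all simple objects $x\in\mathcal M$ and $y\in\mathcal N$, then $\mathcal M\boxtimes_{\mathcal C}\mathcal N$ is rigid. -/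

import Mathlib

open CategoryTheory CategoryTheory.Limits CategoryTheory.MonoidalCategory
open scoped Prod

universe u v w

namespace RigidityCriterion

noncomputable section

/-! ### Finite categories and finite monoidal categories over a field -/

section Finite

variable (k : Type u) [Field k] (C : Type w) [Category.{v} C] [Preadditive C] [Linear k C]

/-- A `k`-linear category is a *finite category* over `k` if it is `k`-linearly equivalent to the
category of finite-dimensional right modules over some finite-dimensional `k`-algebra `A`.
Right `A`-modules are modules over `Aᵐᵒᵖ`; over a finite-dimensional algebra the finitely
generated modules are the finite-dimensional ones. -/
def IsFiniteCategory : Prop :=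
  ∃ (A : Type u) (_ : Ring A) (_ : Algebra k A) (_ : Module.Finite k A)
    (e : C ≌ FGModuleCat.{u} Aᵐᵒᵖ), e.functor.Additive ∧ e.functor.Linear k

/-- A *finite monoidal category* over `k`: a finite category over `k` with a monoidal structure
whose tensor product is `k`-bilinear and right exact separately in each variable. -/
class IsFiniteMonoidal [MonoidalCategory C] : Prop
    extends MonoidalPreadditive C, MonoidalLinear k C where
  isFinite : IsFiniteCategory k C
  rightExact_tensorLeft (X : C) : PreservesFiniteColimits (tensorLeft X)
  rightExact_tensorRight (X : C) : PreservesFiniteColimits (tensorRight X)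

end Finite

/-- A monoidal category is *rigid* if every object has both a left dual and a right dual. -/
def IsRigid (C : Type w) [Category.{v} C] [MonoidalCategory C] : Prop :=
  ∀ X : C, Nonempty (HasLeftDual X) ∧ Nonempty (HasRightDual X)

/-- The tensor product is left exact separately in each variable. -/
def TensorIsLeftExact (C : Type w) [Category.{v} C] [MonoidalCategory C] : Prop :=
  ∀ X : C, PreservesFiniteLimits (tensorLeft X) ∧ PreservesFiniteLimits (tensorRight X)

/-- An *r-category*: a monoidal category `C` which is enriched in itself, i.e. for all `x y` the
internal hom `[x, y]` with `Hom(a, [x, y]) ≃ Hom(a ⊗ x, y)` exists, and such that the functor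
`D = [-, 𝟙] : C ⥤ Cᵒᵖ` is an equivalence. The functor `[-, 𝟙]` is determined, uniquely up to
unique isomorphism, by the bijections `Hom(a ⊗ x, 𝟙) ≃ Hom(a, D x)` natural in `a` and `x`. -/
structure IsRCategory (C : Type w) [Category.{v} C] [MonoidalCategory C] : Prop where
  enriched (x y : C) : ((tensorRight x).op ⋙ yoneda.obj y).IsRepresentable
  dual_equivalence : ∃ (D : C ⥤ Cᵒᵖ)
    (e : ∀ a x : C, (a ⊗ x ⟶ 𝟙_ C) ≃ (a ⟶ (D.obj x).unop)),
    (∀ {a a' : C} (g : a' ⟶ a) (x : C) (f : a ⊗ x ⟶ 𝟙_ C),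
      e a' x (g ▷ x ≫ f) = g ≫ e a x f) ∧
    (∀ (a : C) {x x' : C} (h : x' ⟶ x) (f : a ⊗ x ⟶ 𝟙_ C),
      e a x' (a ◁ h ≫ f) = e a x f ≫ (D.map h).unop) ∧
    D.IsEquivalence

/-! ### Length and semisimplification -/

section Length

variable {T : Type w} [Category.{v} T] [Preadditive T]

/-- `HasCompositionFactors a [q₁, …, qₙ]`: there is a composition series
`0 = a₀ ⊆ a₁ ⊆ ⋯ ⊆ aₙ = a` whose successive quotients are simple, and equal (starting from
the top) to `q₁, …, qₙ`. -/
inductive HasCompositionFactors : T → List T → Prop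
  | nil {a : T} (ha : IsZero a) : HasCompositionFactors a []
  | cons {S : ShortComplex T} {l : List T} (hS : S.ShortExact) (hs : Simple S.X₃)
      (h : HasCompositionFactors S.X₁ l) : HasCompositionFactors S.X₂ (S.X₃ :: l)

/-- The *length* of an object: the number of terms of a composition series (independent of
the series in an abelian category), and `⊤` if there is none. -/
def length (a : T) : ℕ∞ :=
  ⨅ (l : List T) (_ : HasCompositionFactors a l), (l.length : ℕ∞)

variable [HasFiniteColimits T]

/-- `s` is (a model of) `s(a)`, the direct sum of the simple subquotients in a composition series
of `a`. -/
def IsSemisimplification (a s : T) : Prop :=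
  ∃ l : List T, HasCompositionFactors a l ∧ Nonempty (s ≅ ∐ l.get)

/-- An object is *semisimple* if it is a finite direct sum of simple objects. -/
def IsSemisimpleObject (a : T) : Prop :=
  ∃ l : List T, (∀ q ∈ l, Simple q) ∧ Nonempty (a ≅ ∐ l.get)

/-- The equality `length (a ⊗ b) = length (s(a) ⊗ s(b))`. -/
def LengthEquality [MonoidalCategory T] (a b : T) : Prop :=
  ∀ sa sb : T, IsSemisimplification a sa → IsSemisimplification b sb →
    length (a ⊗ b) = length (sa ⊗ sb)

end Length

/-! ### Balanced functors and the tensor product of module categories -/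

section Balanced

open MonoidalLeftAction MonoidalRightAction

variable {C M N : Type w} [Category.{v} C] [Category.{v} M] [Category.{v} N]
  [MonoidalCategory C] (ρ : MonoidalRightAction C M) (σ : MonoidalLeftAction C N)

/-- A *balanced `C`-module functor* `F : M × N ⥤ D`, for a right `C`-module `M`
(with action `ρ`) and a left `C`-module `N` (with action `σ`). -/
structure BalancedFunctor (D : Type*) [Category* D] where
  functor : M × N ⥤ D
  rightExact_left (y : N) : PreservesFiniteColimits (Prod.sectL M y ⋙ functor)
  rightExact_right (x : M) : PreservesFiniteColimits (Prod.sectR x N ⋙ functor)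
  /-- The isomorphism `F(x ⊙ c, y) ≅ F(x, c ⊙ y)`. -/
  balance (x : M) (c : C) (y : N) : functor.obj (x ⊙ᵣ c, y) ≅ functor.obj (x, c ⊙ₗ y)
  balance_naturality {x x' : M} {c c' : C} {y y' : N} (f : x ⟶ x') (g : c ⟶ c') (h : y ⟶ y') :
    functor.map ((f ⊙ᵣₘ g) ×ₘ h) ≫ (balance x' c' y').hom =
      (balance x c y).hom ≫ functor.map (f ×ₘ (g ⊙ₗₘ h))
  balance_unit (x : M) (y : N) :
    (balance x (𝟙_ C) y).hom ≫ functor.map (𝟙 x ×ₘ (λₗ y).hom) =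
      functor.map ((ρᵣ x).hom ×ₘ 𝟙 y)
  balance_tensor (x : M) (a b : C) (y : N) :
    functor.map ((αᵣ x a b).hom ×ₘ 𝟙 y) ≫ (balance (x ⊙ᵣ a) b y).hom ≫
        (balance x a (b ⊙ₗ y)).hom =
      (balance x (a ⊗ b) y).hom ≫ functor.map (𝟙 x ×ₘ (αₗ a b y).hom)

namespace BalancedFunctor

variable {ρ σ}
variable {D : Type*} [Category* D]

/-- Morphisms of balanced functors: natural transformations compatible with the balancing
isomorphisms. -/
@[ext]
structure Hom (F G : BalancedFunctor ρ σ D) where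
  natTrans : F.functor ⟶ G.functor
  comm (x : M) (c : C) (y : N) :
    natTrans.app (x ⊙ᵣ c, y) ≫ (G.balance x c y).hom =
      (F.balance x c y).hom ≫ natTrans.app (x, c ⊙ₗ y)

/-- The category of balanced functors. -/
instance : Category (BalancedFunctor ρ σ D) where
  Hom F G := Hom F G
  id F := { natTrans := 𝟙 F.functor, comm := by simp }
  comp f g :=
    { natTrans := f.natTrans ≫ g.natTrans
      comm := fun x c y => by
        simp only [NatTrans.comp_app, Category.assoc, g.comm]
        rw [← Category.assoc, f.comm, Category.assoc] }
  id_comp f := Hom.ext (Category.id_comp f.natTrans)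
  comp_id f := Hom.ext (Category.comp_id f.natTrans)
  assoc f g h := Hom.ext (Category.assoc f.natTrans g.natTrans h.natTrans)

variable {T : Type*} [Category* T]

/-- The balanced functor `G ∘ B` for a balanced functor `B` and a functor `G` which preserves
finite colimits. -/
def postcomp (B : BalancedFunctor ρ σ T) (G : T ⥤ᵣ D) : BalancedFunctor ρ σ D where
  functor := B.functor ⋙ G.obj
  rightExact_left y := by
    have := B.rightExact_left y
    have : PreservesFiniteColimits G.obj := G.property
    exact inferInstanceAs (PreservesFiniteColimits ((Prod.sectL M y ⋙ B.functor) ⋙ G.obj))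
  rightExact_right x := by
    have := B.rightExact_right x
    have : PreservesFiniteColimits G.obj := G.property
    exact inferInstanceAs (PreservesFiniteColimits ((Prod.sectR x N ⋙ B.functor) ⋙ G.obj))
  balance x c y := G.obj.mapIso (B.balance x c y)
  balance_naturality f g h := by
    simp only [Functor.comp_map, Functor.mapIso_hom, ← Functor.map_comp, B.balance_naturality]
  balance_unit x y := by
    simp only [Functor.comp_map, Functor.mapIso_hom, ← Functor.map_comp, B.balance_unit]
  balance_tensor x a b y := by
    simp only [Functor.comp_map, Functor.mapIso_hom, ← Functor.map_comp, B.balance_tensor]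

/-- Composition with `B`, as a functor from the category of functors `T ⥤ D` preserving finite
colimits to the category of balanced functors with values in `D`. -/
def compFunctor (B : BalancedFunctor ρ σ T) (D : Type*) [Category* D] :
    (T ⥤ᵣ D) ⥤ BalancedFunctor ρ σ D where
  obj G := B.postcomp G
  map α :=
    { natTrans := Functor.whiskerLeft B.functor α.hom
      comm := fun x c y => (α.hom.naturality (B.balance x c y).hom).symm }
  map_id _ := Hom.ext rfl
  map_comp _ _ := Hom.ext rfl

/-- Let `T` have finite colimits. `B : M × N ⥤ T` exhibits `T` as the *tensor product* `M ⊠_C N`: for every category `D` with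
finite colimits, composition with `B` is an equivalence from the category of functors `T ⥤ D`
preserving finite colimits to the category of balanced functors `M × N ⥤ D`. -/
def IsTensorProduct {T : Type w} [Category.{v} T] [HasFiniteColimits T]
    (B : BalancedFunctor ρ σ T) : Prop :=
  ∀ (D : Type (max w v)) [Category.{v} D] [HasFiniteColimits D],
    (B.compFunctor D).IsEquivalence

end BalancedFunctor

end Balanced

/-! ### Monoidal modules over a braided monoidal category -/

section MonoidalModules

/-- A monoidal functor `F : C ⥤ M` makes `M` a right `C`-module by `x ⊙ c = x ⊗ F c`. -/
@[reducible]
def rightActionOfMonoidalFunctor {C : Type*} {M : Type*} [Category* C] [Category* M]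
    [MonoidalCategory C] [MonoidalCategory M] (F : C ⥤ M) [F.Monoidal] :
    MonoidalRightAction C M where
  actionObj x c := x ⊗ F.obj c
  actionHomRight x _ _ g := x ◁ F.map g
  actionHomLeft f c := f ▷ F.obj c
  actionHom f g := f ⊗ₘ F.map g
  actionAssocIso x a b :=
    whiskerLeftIso x (Functor.Monoidal.μIso F a b).symm ≪≫ (α_ x (F.obj a) (F.obj b)).symm
  actionUnitIso x := whiskerLeftIso x (Functor.Monoidal.εIso F).symm ≪≫ ρ_ x
  actionHom_def f g := by simp [MonoidalCategory.tensorHom_def]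
  actionAssocIso_hom_naturality {x x' a a' b b'} f g h := by
    have e : F.map (g ⊗ₘ h) ≫ Functor.OplaxMonoidal.δ F a' b' =
        Functor.OplaxMonoidal.δ F a b ≫ (F.map g ⊗ₘ F.map h) := by simp
    simp only [Iso.trans_hom, Iso.symm_hom, whiskerLeftIso_hom, Functor.Monoidal.μIso_inv,
      Category.assoc, ← associator_inv_naturality]
    rw [← id_tensorHom, ← id_tensorHom, tensorHom_comp_tensorHom_assoc,
      tensorHom_comp_tensorHom_assoc, e, Category.comp_id, Category.id_comp]
  actionUnitIso_hom_naturality {x x'} f := by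
    simp only [Iso.trans_hom, Iso.symm_hom, whiskerLeftIso_hom, Functor.Monoidal.εIso_inv,
      Category.assoc]
    rw [← whisker_exchange_assoc, rightUnitor_naturality]
  actionHomRight_whiskerRight f c x := by
    rw [Functor.Monoidal.map_whiskerRight]
    simp only [MonoidalCategory.whiskerLeft_comp, Iso.trans_hom, Iso.trans_inv, Iso.symm_hom,
      Iso.symm_inv, whiskerLeftIso_hom, whiskerLeftIso_inv, Functor.Monoidal.μIso_inv,
      Functor.Monoidal.μIso_hom, Category.assoc, whisker_assoc, Iso.inv_hom_id_assoc]
  whiskerRight_actionHomLeft c _ _ f x := by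
    rw [Functor.Monoidal.map_whiskerLeft]
    simp only [MonoidalCategory.whiskerLeft_comp, Iso.trans_hom, Iso.trans_inv, Iso.symm_hom,
      Iso.symm_inv, whiskerLeftIso_hom, whiskerLeftIso_inv, Functor.Monoidal.μIso_inv,
      Functor.Monoidal.μIso_hom, Category.assoc, tensor_whiskerLeft, Iso.inv_hom_id_assoc]
  actionHom_associator a b c x := by
    have h := congrArg (fun t => x ◁ t) (Functor.OplaxMonoidal.associativity F a b c)
    simp only [MonoidalCategory.whiskerLeft_comp] at h
    simp [← reassoc_of% h]
  actionHom_leftUnitor c x := by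
    rw [Functor.Monoidal.map_leftUnitor]
    simp only [MonoidalCategory.whiskerLeft_comp, Iso.trans_hom, Iso.symm_hom,
      whiskerLeftIso_hom, Functor.Monoidal.μIso_inv, Functor.Monoidal.εIso_inv,
      Category.assoc, comp_whiskerRight, whisker_assoc, Iso.inv_hom_id_assoc]
    rw [triangle_assoc_comp_right]
  actionHom_rightUnitor c x := by
    rw [Functor.Monoidal.map_rightUnitor]
    simp only [MonoidalCategory.whiskerLeft_comp, Iso.trans_hom, Iso.symm_hom,
      whiskerLeftIso_hom, Functor.Monoidal.μIso_inv, Functor.Monoidal.εIso_inv,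
      Category.assoc, tensor_whiskerLeft, Iso.inv_hom_id_assoc, whiskerLeft_rightUnitor]

variable (k : Type u) [Field k] (C M : Type w) [Category.{v} C] [Category.{v} M]
  [Preadditive C] [Linear k C] [MonoidalCategory C] [BraidedCategory C]
  [Preadditive M] [Linear k M] [MonoidalCategory M]

/-- A structure of *monoidal right `C`-module* on the finite monoidal category `M`, for a braided
finite monoidal category `C`: a `k`-linear braided monoidal functor `φ` from `C` to the Drinfeld
center of `M`. The linear structure and the finite colimits of the center are computed in `M`,
so `k`-linearity of `φ` (which includes right exactness) is expressed by its composition with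
the forgetful functor. -/
structure MonoidalRightModule where
  φ : C ⥤ Center M
  braided : φ.Braided
  linear : (φ ⋙ Center.forget M).Linear k
  rightExact : PreservesFiniteColimits (φ ⋙ Center.forget M)

/-- A structure of *monoidal left `C`-module* on the finite monoidal category `M`: a `k`-linear
braided monoidal functor `φ` from `C^rev` to the Drinfeld center of `M`. Here `C^rev` is `C` with
tensor product `a ⊗^rev b = b ⊗ a` and braiding `(β_{a,b})⁻¹ : b ⊗ a ⟶ a ⊗ b`. -/
structure MonoidalLeftModule where
  φ : Cᴹᵒᵖ ⥤ Center M
  monoidal : φ.Monoidal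
  braided (a b : C) :
    Functor.LaxMonoidal.μ φ (.mop a) (.mop b) ≫ φ.map ((β_ a b).inv.mop) =
      (β_ (φ.obj (.mop a)) (φ.obj (.mop b))).hom ≫ Functor.LaxMonoidal.μ φ (.mop b) (.mop a)
  linear : (mopFunctor C ⋙ φ ⋙ Center.forget M).Linear k
  rightExact : PreservesFiniteColimits (mopFunctor C ⋙ φ ⋙ Center.forget M)

variable {k C M}

/-- The right `C`-module underlying a monoidal right `C`-module: `x ⊙ c = x ⊗ φ(c)`. -/
@[reducible]
def MonoidalRightModule.action (R : MonoidalRightModule k C M) : MonoidalRightAction C M :=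
  letI := R.braided
  rightActionOfMonoidalFunctor (R.φ ⋙ Center.forget M)

/-- The left `C`-module underlying a monoidal left `C`-module: the right `C^rev`-module
`x ⊙ c = x ⊗ φ(c)` viewed as a left `C`-module, i.e. `c ⊙ x = x ⊗ φ(c)`. -/
@[reducible]
def MonoidalLeftModule.action (L : MonoidalLeftModule k C M) : MonoidalLeftAction C M :=
  letI := L.monoidal
  letI := rightActionOfMonoidalFunctor (L.φ ⋙ Center.forget M)
  MonoidalLeftAction.leftActionOfMonoidalOppositeRightAction C M

end MonoidalModules

end

end RigidityCriterion

/-! Write T for the tensor product of M and N over C. The crux is that every object of T is a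
quotient of a projective object of the form `x ⊠ y` and also a subobject of some `x ⊠ y`. As M and N
are rigid and `⊠` is monoidal, all `x ⊠ y` have duals on both sides, so T has enough rigid objects
although it need not be rigid itself.

Covers. Let n be a projective generator of N. The functor c ↦ c ⊙ n is right exact on a finite
category, so it has a right adjoint [n, -] : N → C. This is right exact because c ⊙ n = n ⊗ φ(c) is
projective for every c, and it commutes with the action because C is rigid (`isIso_strength`). Hence
(x, y) ↦ x ⊙ [n, y] is balanced and induces a right exact functor G : T → M, which is right adjoint
to - ⊠ n (`boxAdjunction`). It follows that P ⊠ n is a progenerator of T whenever P is one of M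
(`isProgenerator_box`). Therefore T is finite, and its free objects are again of the form x ⊠ n.

Embeddings. Being right exact, [n, -] has in turn a right adjoint, and rigidity of C forces it to be
c ↦ c ⊙ n₁ for some n₁. Its units y → [n, y] ⊙ n₁ induce maps t → G t ⊠ n₁ that G turns into split
monomorphisms (`exists_mono_map`). As the objects x ⊠ n cover T, such maps are themselves
monomorphisms.

The r-category property. Internal homs are right adjoints of right exact functors on a finite
category. The functor D = [-, 𝟙] and its counterpart D' on the other side form a contravariant
adjunction whose units are invertible on rigid objects. Using the embeddings, D of a rigid
projective object is injective; comparison with a rigid overobject and a rigid projective cover then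
makes the units invertible everywhere (`DualityPair.isIso_unit`).

The criterion. Right exactness bounds length (a ⊗ b) by the sum of the lengths of the tensor
products of composition factors, and equality for all a, b amounts to exactness of the tensor
product. Equality passes to quotients (`eq_and_mono_of_length_eq`), so it suffices to have it for
objects x ⊠ y. There both sides are additive in each of the four arguments, which reduces to simple
ones. Finally, if the tensor product is exact, the cokernel of a map between objects with right
duals has a right dual, namely the kernel of the mate; the equivalence D supplies the left duals. -/

namespace RigidityCriterion

noncomputable section

/-! ### Consequences of the universal property -/

namespace BalancedFunctor

open MonoidalLeftAction MonoidalRightAction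

section Universal

variable {C M N : Type w} [Category.{v} C] [Category.{v} M] [Category.{v} N]
  [MonoidalCategory C] {ρ : MonoidalRightAction C M} {σ : MonoidalLeftAction C N}
  {T : Type w} [Category.{v} T] [HasFiniteColimits T] {B : BalancedFunctor ρ σ T}
  {D : Type w} [Category.{v} D] [HasFiniteColimits D]

attribute [local instance] CategoryTheory.uliftCategory

/-- The universal property is tested on categories with objects in `Type (max w v)`, so a target in
`Type w` has to be lifted before it applies. -/
theorem hasFiniteColimits_uLift (D : Type w) [Category.{v} D] [HasFiniteColimits D] :
    HasFiniteColimits (ULift.{v} D) where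
  out _ _ _ := Adjunction.hasColimitsOfShape_of_equivalence (ULift.equivalence (C := D)).inverse

/-- A balanced functor extends along the universal one. -/
theorem IsTensorProduct.exists_extension (hB : B.IsTensorProduct) (F : BalancedFunctor ρ σ D) :
    ∃ (G : T ⥤ D) (_ : PreservesFiniteColimits G) (e : B.functor ⋙ G ≅ F.functor),
      ∀ x c y, e.hom.app (x ⊙ᵣ c, y) ≫ (F.balance x c y).hom =
        G.map (B.balance x c y).hom ≫ e.hom.app (x, c ⊙ₗ y) := by
  have := hasFiniteColimits_uLift D
  have := hB (ULift.{v} D)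
  let U := ULift.equivalence.{v} (C := D)
  let F' := F.postcomp (⟨U.functor, inferInstanceAs (PreservesFiniteColimits U.functor)⟩ :
    D ⥤ᵣ ULift.{v} D)
  let G' := (B.compFunctor (ULift.{v} D)).objPreimage F'
  let e := (B.compFunctor (ULift.{v} D)).objObjPreimageIso F'
  have hG' : PreservesFiniteColimits G'.obj := G'.property
  refine ⟨G'.obj ⋙ U.inverse, inferInstance,
    NatIso.ofComponents (fun p => U.inverse.mapIso
      { hom := e.hom.natTrans.app p
        inv := e.inv.natTrans.app p
        hom_inv_id := congrArg (fun t => Hom.natTrans t |>.app p) e.hom_inv_id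
        inv_hom_id := congrArg (fun t => Hom.natTrans t |>.app p) e.inv_hom_id }) ?_, ?_⟩
  · intro p q f
    exact congrArg U.inverse.map (e.hom.natTrans.naturality f)
  · intro x c y
    exact congrArg U.inverse.map (e.hom.comm x c y)

/-- Balanced natural transformations extend along the universal balanced functor. -/
theorem IsTensorProduct.exists_natTrans (hB : B.IsTensorProduct) (G H : T ⥤ D)
    [PreservesFiniteColimits G] [PreservesFiniteColimits H]
    (α : B.functor ⋙ G ⟶ B.functor ⋙ H)
    (hα : ∀ x c y, α.app (x ⊙ᵣ c, y) ≫ H.map (B.balance x c y).hom =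
        G.map (B.balance x c y).hom ≫ α.app (x, c ⊙ₗ y)) :
    ∃ β : G ⟶ H, ∀ p, β.app (B.functor.obj p) = α.app p := by
  have := hasFiniteColimits_uLift D
  have := hB (ULift.{v} D)
  let U := ULift.equivalence.{v} (C := D)
  let G' : T ⥤ᵣ ULift.{v} D := ⟨G ⋙ U.functor, inferInstanceAs (PreservesFiniteColimits _)⟩
  let H' : T ⥤ᵣ ULift.{v} D := ⟨H ⋙ U.functor, inferInstanceAs (PreservesFiniteColimits _)⟩
  let α' : (B.compFunctor (ULift.{v} D)).obj G' ⟶ (B.compFunctor (ULift.{v} D)).obj H' :=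
    { natTrans :=
        { app p := U.functor.map (α.app p)
          naturality p q f := congrArg U.functor.map (α.naturality f) }
      comm x c y := congrArg U.functor.map (hα x c y) }
  let β' := (B.compFunctor (ULift.{v} D)).preimage α'
  have hβ' : (B.compFunctor (ULift.{v} D)).map β' = α' := Functor.map_preimage _ _
  refine ⟨{ app t := U.inverse.map (β'.hom.app t), naturality s t f := ?_ }, fun p => ?_⟩
  · exact congrArg U.inverse.map (β'.hom.naturality f)
  · exact congrArg U.inverse.map (congrArg (fun t => Hom.natTrans t |>.app p) hβ')

/-- Faithfulness of restriction along `B`. Identities between transformations, such as triangle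
identities, are thereby checked on objects `x ⊠ y` only. -/
theorem IsTensorProduct.natTrans_ext (hB : B.IsTensorProduct) {G H : T ⥤ D}
    [PreservesFiniteColimits G] [PreservesFiniteColimits H] {α β : G ⟶ H}
    (h : ∀ p, α.app (B.functor.obj p) = β.app (B.functor.obj p)) : α = β := by
  have := hasFiniteColimits_uLift D
  have := hB (ULift.{v} D)
  let U := ULift.equivalence.{v} (C := D)
  let G' : T ⥤ᵣ ULift.{v} D := ⟨G ⋙ U.functor, inferInstanceAs (PreservesFiniteColimits _)⟩
  let H' : T ⥤ᵣ ULift.{v} D := ⟨H ⋙ U.functor, inferInstanceAs (PreservesFiniteColimits _)⟩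
  let α' : G' ⟶ H' := ObjectProperty.homMk (Functor.whiskerRight α U.functor)
  let β' : G' ⟶ H' := ObjectProperty.homMk (Functor.whiskerRight β U.functor)
  have key : α' = β' := (B.compFunctor (ULift.{v} D)).map_injective
    (Hom.ext (NatTrans.ext (funext fun p => congrArg U.functor.map (h p))))
  ext t
  have key' : α'.hom.app t = β'.hom.app t := by rw [key]
  exact congrArg (fun f => U.inverse.map f) key'

/-- Every object of the tensor product is a finite colimit of objects `x ⊠ y`. -/
theorem IsTensorProduct.induction (hB : B.IsTensorProduct) (P : ObjectProperty T)
    [P.IsClosedUnderIsomorphisms] [P.IsClosedUnderFiniteCoproducts]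
    [P.IsClosedUnderColimitsOfShape WalkingParallelPair]
    (h : ∀ p, P (B.functor.obj p)) (t : T) : P t := by
  have : HasFiniteCoproducts P.FullSubcategory := ⟨fun _ => inferInstance⟩
  have : HasCoequalizers P.FullSubcategory := inferInstance
  have : HasFiniteColimits P.FullSubcategory :=
    hasFiniteColimits_of_hasCoequalizers_and_finite_coproducts
  have : PreservesFiniteCoproducts P.ι := ⟨fun _ => inferInstance⟩
  have hι : PreservesFiniteColimits P.ι :=
    preservesFiniteColimits_of_preservesCoequalizers_and_finiteCoproducts _
  have reflects : ReflectsFiniteColimits P.ι := inferInstance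
  -- The full subcategory on `P` has finite colimits, so `B` corestricts to it and yields a functor
  -- `G` from `T` to the subcategory. By uniqueness `G` followed by the inclusion is isomorphic to
  -- the identity, so each `t` is isomorphic to an object satisfying `P`.
  let B' : BalancedFunctor ρ σ P.FullSubcategory :=
    { functor := P.lift B.functor h
      rightExact_left y := by
        have := B.rightExact_left y
        have : PreservesFiniteColimits ((Prod.sectL M y ⋙ P.lift B.functor h) ⋙ P.ι) := this
        exact ⟨fun J _ _ => preservesColimitsOfShape_of_reflects_of_preserves _ P.ι⟩
      rightExact_right x := by
        have := B.rightExact_right x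
        have : PreservesFiniteColimits ((Prod.sectR x N ⋙ P.lift B.functor h) ⋙ P.ι) := this
        exact ⟨fun J _ _ => preservesColimitsOfShape_of_reflects_of_preserves _ P.ι⟩
      balance x c y := P.fullyFaithfulι.preimageIso (B.balance x c y)
      balance_naturality f g k := P.hom_ext (B.balance_naturality f g k)
      balance_unit x y := P.hom_ext (B.balance_unit x y)
      balance_tensor x a b y := P.hom_ext (B.balance_tensor x a b y) }
  obtain ⟨G, hG, e, he⟩ := hB.exists_extension B'
  obtain ⟨β, hβ⟩ := hB.exists_natTrans (𝟭 T) (G ⋙ P.ι)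
    { app p := P.ι.map (e.inv.app p)
      naturality p q f := congrArg P.ι.map (e.inv.naturality f) } (fun x c y => by
        have h2 : e.inv.app (x ⊙ᵣ c, y) ≫ G.map (B.balance x c y).hom =
            (B'.balance x c y).hom ≫ e.inv.app (x, c ⊙ₗ y) := by
          refine (Iso.inv_comp_eq (e.app _)).2 ?_
          rw [← Category.assoc]
          refine (Iso.eq_comp_inv (e.app _)).2 (he x c y).symm
        exact congrArg P.ι.map h2)
  obtain ⟨γ, hγ⟩ := hB.exists_natTrans (G ⋙ P.ι) (𝟭 T)
    { app p := P.ι.map (e.hom.app p)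
      naturality p q f := congrArg P.ι.map (e.hom.naturality f) } (fun x c y =>
        congrArg P.ι.map (he x c y))
  have h1 : β ≫ γ = 𝟙 _ := hB.natTrans_ext fun p => by
    refine (congrArg₂ (· ≫ ·) (hβ p) (hγ p)).trans ?_
    exact congrArg P.ι.map (e.inv_hom_id_app p)
  have h2 : γ ≫ β = 𝟙 _ := hB.natTrans_ext fun p => by
    refine (congrArg₂ (· ≫ ·) (hγ p) (hβ p)).trans ?_
    exact congrArg P.ι.map (e.hom_inv_id_app p)
  exact P.prop_of_iso (Iso.mk (γ.app t) (β.app t) (congrArg (fun f => f.app t) h2)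
    (congrArg (fun f => f.app t) h1)) (G.obj t).property

end Universal

end BalancedFunctor

/-! ### Internal homs of a module category -/

namespace ModuleHom

open MonoidalLeftAction

variable {C N : Type*} [Category* C] [Category* N] [MonoidalCategory C]
  [MonoidalLeftAction C N]

variable (C) in
/-- The functor `c ↦ c ⊙ n`. -/
def actOn (n : N) : C ⥤ N where
  obj c := c ⊙ₗ n
  map f := f ⊵ₗ n

variable (C) in
/-- `E` is the internal hom functor `[n, -]`, with evaluation `ev : E y ⊙ n ⟶ y`. -/
structure InternalHom (n : N) (E : N ⥤ C) where
  /-- The evaluation. -/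
  ev (y : N) : E.obj y ⊙ₗ n ⟶ y
  ev_naturality {y y' : N} (h : y ⟶ y') : E.map h ⊵ₗ n ≫ ev y' = ev y ≫ h
  /-- The map `c ⟶ E y` corresponding to `c ⊙ n ⟶ y`. -/
  lift {c : C} {y : N} (f : c ⊙ₗ n ⟶ y) : c ⟶ E.obj y
  lift_ev {c : C} {y : N} (f : c ⊙ₗ n ⟶ y) : lift f ⊵ₗ n ≫ ev y = f
  hom_ext {c : C} {y : N} {f g : c ⟶ E.obj y} (h : f ⊵ₗ n ≫ ev y = g ⊵ₗ n ≫ ev y) : f = g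

/-- A right adjoint of `c ↦ c ⊙ n` is an internal hom functor. -/
def InternalHom.ofAdjunction {n : N} {E : N ⥤ C} (adj : actOn C n ⊣ E) : InternalHom C n E where
  ev y := adj.counit.app y
  ev_naturality h := adj.counit.naturality h
  lift f := adj.homEquiv _ _ f
  lift_ev f := (adj.homEquiv_counit _ _ _).symm.trans ((adj.homEquiv _ _).symm_apply_apply f)
  hom_ext {c y _ _} h := (adj.homEquiv c y).symm.injective
    ((adj.homEquiv_counit _ _ _).trans (h.trans (adj.homEquiv_counit _ _ _).symm))

variable {n : N} {E : N ⥤ C} (H : InternalHom C n E)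

/-- The canonical map `c ⊗ E y ⟶ E (c ⊙ y)` for the internal hom functor `E`. -/
def strength (c : C) (y : N) : c ⊗ E.obj y ⟶ E.obj (c ⊙ₗ y) :=
  H.lift ((αₗ c (E.obj y) n).hom ≫ c ⊴ₗ H.ev y)

theorem strength_ev (c : C) (y : N) :
    strength H c y ⊵ₗ n ≫ H.ev (c ⊙ₗ y) = (αₗ c (E.obj y) n).hom ≫ c ⊴ₗ H.ev y :=
  H.lift_ev _

theorem strength_naturality_right (c : C) {y y' : N} (h : y ⟶ y') :
    c ◁ E.map h ≫ strength H c y' = strength H c y ≫ E.map (c ⊴ₗ h) := by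
  apply H.hom_ext
  rw [comp_actionHomLeft, comp_actionHomLeft, Category.assoc, Category.assoc, strength_ev,
    H.ev_naturality, reassoc_of% strength_ev, whiskerLeft_actionHomLeft]
  simp only [Category.assoc, Iso.inv_hom_id_assoc, ← actionHomRight_comp, H.ev_naturality]

theorem strength_naturality_left {c c' : C} (f : c ⟶ c') (y : N) :
    f ▷ E.obj y ≫ strength H c' y = strength H c y ≫ E.map (f ⊵ₗ y) := by
  apply H.hom_ext
  rw [comp_actionHomLeft, comp_actionHomLeft, Category.assoc, Category.assoc, strength_ev,
    H.ev_naturality, reassoc_of% strength_ev, whiskerRight_actionHomLeft]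
  simp only [Category.assoc, Iso.inv_hom_id_assoc, action_exchange]

theorem strength_unit (y : N) :
    strength H (𝟙_ C) y ≫ E.map (λₗ y).hom = (λ_ (E.obj y)).hom := by
  apply H.hom_ext
  rw [comp_actionHomLeft, Category.assoc, H.ev_naturality,
    reassoc_of% strength_ev, ← actionUnitIso_hom_naturality,
    leftUnitor_actionHom, Category.assoc]

theorem strength_tensor (a b : C) (y : N) :
    strength H (a ⊗ b) y ≫ E.map (αₗ a b y).hom =
      (α_ a b (E.obj y)).hom ≫ a ◁ strength H b y ≫ strength H a (b ⊙ₗ y) := by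
  apply H.hom_ext
  simp only [comp_actionHomLeft, Category.assoc, H.ev_naturality, strength_ev, reassoc_of% strength_ev]
  rw [whiskerLeft_actionHomLeft]
  simp only [Category.assoc, Iso.inv_hom_id_assoc, ← actionHomRight_comp, strength_ev]
  simp only [actionHomRight_comp, tensor_actionHomRight, Category.assoc, Iso.inv_hom_id,
    Category.comp_id]
  rw [associator_actionHom_assoc]

theorem strength_tensor_inv (a b : C) (y : N) :
    a ◁ strength H b y ≫ strength H a (b ⊙ₗ y) =
      (α_ a b (E.obj y)).inv ≫ strength H (a ⊗ b) y ≫ E.map (αₗ a b y).hom := by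
  rw [strength_tensor, Iso.inv_hom_id_assoc]

/-- The zigzag identity for the action of a dual pair. -/
theorem action_zigzag (c c' : C) [ExactPairing c c'] (y : N) :
    (λₗ (c ⊙ₗ y)).inv ≫ (η_ c c') ⊵ₗ (c ⊙ₗ y) ≫ (αₗ c c' (c ⊙ₗ y)).hom ≫
      c ⊴ₗ ((αₗ c' c y).inv ≫ (ε_ c c') ⊵ₗ y ≫ (λₗ y).hom) = 𝟙 _ := by
  have h := congrArg (fun t => t ⊵ₗ y ≫ (ρ_ c).hom ⊵ₗ y)
    (ExactPairing.evaluation_coevaluation c c')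
  have a1 : (αₗ c c' (c ⊙ₗ y)).hom ≫ c ⊴ₗ (αₗ c' c y).inv =
      (αₗ (c ⊗ c') c y).inv ≫ (α_ c c' c).hom ⊵ₗ y ≫ (αₗ c (c' ⊗ c) y).hom := by
    rw [Iso.eq_inv_comp, ← associator_actionHom_assoc, actionHomRight_hom_inv, Category.comp_id]
  have a2 : η_ c c' ⊵ₗ (c ⊙ₗ y) ≫ (αₗ (c ⊗ c') c y).inv =
      (αₗ (𝟙_ C) c y).inv ≫ (η_ c c' ▷ c) ⊵ₗ y := by
    rw [whiskerRight_actionHomLeft, Iso.inv_hom_id_assoc]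
  have a3 : (αₗ c (c' ⊗ c) y).hom ≫ c ⊴ₗ (ε_ c c') ⊵ₗ y =
      (c ◁ ε_ c c') ⊵ₗ y ≫ (αₗ c (𝟙_ C) y).hom := by
    rw [whiskerLeft_actionHomLeft]; simp only [Category.assoc, Iso.inv_hom_id, Category.comp_id]
  have a4 : (λₗ (c ⊙ₗ y)).hom = (αₗ (𝟙_ C) c y).inv ≫ (λ_ c).hom ⊵ₗ y := by
    rw [leftUnitor_actionHom, Iso.inv_hom_id_assoc]
  rw [Iso.inv_comp_eq, Category.comp_id, actionHomRight_comp, actionHomRight_comp,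
    reassoc_of% a1, reassoc_of% a3, reassoc_of% a2, ← rightUnitor_actionHom, a4]
  congr 1
  simp only [comp_actionHomLeft, Category.assoc] at h
  rw [h, inv_hom_actionHomLeft, Category.comp_id]

/-- A lax module functor over a rigid category is strong. The inverse is the transpose, along the
duality of `c` and `c'`, of the strength for `c'` followed by the evaluation `c' ⊙ (c ⊙ y) ⟶ y`. -/
theorem isIso_strength (c c' : C) [ExactPairing c c'] (y : N) : IsIso (strength H c y) := by
  let w := (αₗ c' c y).inv ≫ (ε_ c c') ⊵ₗ y ≫ (λₗ y).hom
  let r : E.obj (c ⊙ₗ y) ⟶ c ⊗ E.obj y :=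
    tensorLeftHomEquiv _ c c' _ (strength H c' (c ⊙ₗ y) ≫ E.map w)
  refine ⟨r, ?_, ?_⟩
  · apply (tensorLeftHomEquiv _ c c' _).symm.injective
    rw [tensorLeftHomEquiv_symm_naturality, Equiv.symm_apply_apply, ← Category.assoc,
      strength_tensor_inv]
    simp only [w, Category.assoc, Functor.map_comp, Iso.map_hom_inv_id_assoc]
    rw [← reassoc_of% (strength_naturality_left H (ε_ c c') y), strength_unit]
    simp [tensorLeftHomEquiv]
  · have hr : r = (λ_ _).inv ≫ η_ c c' ▷ _ ≫ (α_ _ _ _).hom ≫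
        c ◁ (strength H c' (c ⊙ₗ y) ≫ E.map w) := rfl
    rw [hr]
    simp only [MonoidalCategory.whiskerLeft_comp, Category.assoc, strength_naturality_right]
    rw [reassoc_of% (strength_tensor_inv H c c' (c ⊙ₗ y)), Iso.hom_inv_id_assoc,
      reassoc_of% (strength_naturality_left H (η_ c c') (c ⊙ₗ y)), Iso.inv_comp_eq,
      ← strength_unit, Category.comp_id]
    congr 1
    simp only [← Functor.map_comp]
    congr 1
    rw [← Iso.inv_comp_eq_id]
    exact action_zigzag c c' y

section RightAdjoint

variable {n₁ : N} (e : E.obj n₁ ⟶ 𝟙_ C)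

/-- The canonical map `E (c ⊙ n₁) ⟶ c` induced by `e : E n₁ ⟶ 𝟙`. -/
def costrength [∀ c y, IsIso (strength H c y)] (c : C) : E.obj (c ⊙ₗ n₁) ⟶ c :=
  inv (strength H c n₁) ≫ c ◁ e ≫ (ρ_ c).hom

variable [∀ c y, IsIso (strength H c y)]

theorem strength_costrength (c : C) :
    strength H c n₁ ≫ costrength H e c = c ◁ e ≫ (ρ_ c).hom := by
  simp [costrength]

theorem costrength_naturality {c c' : C} (f : c ⟶ c') :
    E.map (f ⊵ₗ n₁) ≫ costrength H e c' = costrength H e c ≫ f := by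
  rw [← cancel_epi (strength H c n₁), ← reassoc_of% (strength_naturality_left H f n₁),
    strength_costrength, reassoc_of% strength_costrength, ← whisker_exchange_assoc]
  simp

theorem map_assoc_costrength (a b : C) :
    E.map (αₗ a b n₁).inv ≫ costrength H e (a ⊗ b) =
      inv (strength H a (b ⊙ₗ n₁)) ≫ a ◁ costrength H e b := by
  rw [← cancel_epi (strength H a (b ⊙ₗ n₁)), IsIso.hom_inv_id_assoc,
    ← cancel_epi (a ◁ strength H b n₁), reassoc_of% (strength_tensor_inv H a b n₁),
    Iso.map_hom_inv_id_assoc, strength_costrength, ← MonoidalCategory.whiskerLeft_comp,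
    strength_costrength]
  simp

/-- This and `costrength_surjective` say that `E` is left adjoint to `c ↦ c ⊙ n₁` with counit
`costrength`, once `n₁` represents `Hom(E -, 𝟙)`. The case of general `c` reduces to `c = 𝟙` because
`c ⊙ -` is right adjoint to `c' ⊙ -`. -/
theorem costrength_ext (he : ∀ y (f g : y ⟶ n₁), E.map f ≫ e = E.map g ≫ e → f = g)
    {c c' : C} [ExactPairing c c'] {y : N} {f g : y ⟶ c ⊙ₗ n₁}
    (h : E.map f ≫ costrength H e c = E.map g ≫ costrength H e c) : f = g := by
  let w := (αₗ c' c n₁).inv ≫ (ε_ c c') ⊵ₗ n₁ ≫ (λₗ n₁).hom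
  have recover (f : y ⟶ c ⊙ₗ n₁) : f = (λₗ y).inv ≫ (η_ c c') ⊵ₗ y ≫ (αₗ c c' y).hom ≫
      c ⊴ₗ (c' ⊴ₗ f ≫ w) := by
    have := f ≫= action_zigzag c c' n₁
    rw [Category.comp_id] at this
    refine this.symm.trans ?_
    rw [← actionUnitIso_inv_naturality_assoc, action_exchange_assoc,
      tensor_actionHomRight]
    simp [w]
  -- Transposing `f` to `c' ⊙ y ⟶ n₁` and then applying `E` and `e` agrees, up to the strength, with
  -- transposing `E f ≫ costrength`. So the hypothesis on `f` and `g` passes to their transposes.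
  have key (f : y ⟶ c ⊙ₗ n₁) : strength H c' y ≫ E.map (c' ⊴ₗ f ≫ w) ≫ e =
      c' ◁ (E.map f ≫ costrength H e c) ≫ ε_ c c' := by
    have h1 : strength H c' (c ⊙ₗ n₁) ≫ E.map w ≫ e = c' ◁ costrength H e c ≫ ε_ c c' := by
      rw [← cancel_epi (c' ◁ strength H c n₁), reassoc_of% (strength_tensor_inv H c' c n₁),
        ← MonoidalCategory.whiskerLeft_comp_assoc, strength_costrength]
      simp only [w, Functor.map_comp, Category.assoc, Iso.map_hom_inv_id_assoc]
      rw [← reassoc_of% (strength_naturality_left H (ε_ c c') n₁),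
        reassoc_of% (strength_unit H n₁), ← leftUnitor_naturality, ← whisker_exchange_assoc]
      simp [unitors_equal]
    rw [Functor.map_comp, Category.assoc, ← reassoc_of% (strength_naturality_right H c' f), h1,
      MonoidalCategory.whiskerLeft_comp, Category.assoc]
  rw [recover f, recover g, he _ (c' ⊴ₗ f ≫ w) (c' ⊴ₗ g ≫ w)]
  rw [← cancel_epi (strength H c' y), key, key, h]

theorem costrength_surjective (he : ∀ y (k : E.obj y ⟶ 𝟙_ C), ∃ f : y ⟶ n₁, E.map f ≫ e = k)
    {c c' : C} [ExactPairing c c'] {y : N} (h : E.obj y ⟶ c) :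
    ∃ f : y ⟶ c ⊙ₗ n₁, E.map f ≫ costrength H e c = h := by
  obtain ⟨k, hk⟩ := he (c' ⊙ₗ y) (inv (strength H c' y) ≫ c' ◁ h ≫ ε_ c c')
  -- The witness is the transpose of `k : c' ⊙ y ⟶ n₁`, which represents the transpose of `h`.
  refine ⟨(λₗ y).inv ≫ (η_ c c') ⊵ₗ y ≫ (αₗ c c' y).hom ≫ c ⊴ₗ k, ?_⟩
  have h1 : E.map (c ⊴ₗ k) ≫ costrength H e c =
      inv (strength H c (c' ⊙ₗ y)) ≫ c ◁ (E.map k ≫ e) ≫ (ρ_ c).hom := by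
    rw [IsIso.eq_inv_comp, ← reassoc_of% (strength_naturality_right H c k), strength_costrength,
      MonoidalCategory.whiskerLeft_comp, Category.assoc]
  simp only [Functor.map_comp, Category.assoc, h1, hk]
  rw [← cancel_epi (λ_ (E.obj y)).hom, ← strength_unit H, Category.assoc, Iso.map_hom_inv_id_assoc,
    ← reassoc_of% (strength_naturality_left H (η_ c c') y),
    reassoc_of% (strength_tensor H c c' y), IsIso.hom_inv_id_assoc,
    ← MonoidalCategory.whiskerLeft_comp_assoc, IsIso.hom_inv_id_assoc, strength_unit]
  have h2 := ExactPairing.evaluation_coevaluation c c' =≫ (ρ_ c).hom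
  simp only [Category.assoc, Iso.inv_hom_id, Category.comp_id] at h2
  rw [← leftUnitor_naturality, ← h2, MonoidalCategory.whiskerLeft_comp_assoc,
    ← reassoc_of% (associator_naturality_right c c' h), whisker_exchange_assoc]

end RightAdjoint

end ModuleHom

/-! ### The functor on the tensor product induced by `x ⊙ [n, y]` -/

namespace BalancedFunctor

open scoped MonoidalLeftAction MonoidalRightAction
open MonoidalRightAction ModuleHom

variable {C M N T : Type w} [Category.{v} C] [Category.{v} M] [Category.{v} N]
  [MonoidalCategory C] {ρ : MonoidalRightAction C M} {σ : MonoidalLeftAction C N}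
  [Category.{v} T] (B : BalancedFunctor ρ σ T)

/-- The object `x ⊠ y`. -/
abbrev box (x : M) (y : N) : T := B.functor.obj (x, y)

/-- The map `f ⊠ y`. -/
def mapL {x x' : M} (f : x ⟶ x') (y : N) : B.box x y ⟶ B.box x' y := B.functor.map (f ×ₘ 𝟙 y)

/-- The map `x ⊠ g`. -/
def mapR (x : M) {y y' : N} (g : y ⟶ y') : B.box x y ⟶ B.box x y' := B.functor.map (𝟙 x ×ₘ g)

theorem mapL_comp {x x' x'' : M} (f : x ⟶ x') (g : x' ⟶ x'') (y : N) :
    B.mapL (f ≫ g) y = B.mapL f y ≫ B.mapL g y := by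
  rw [mapL, mapL, mapL, ← Functor.map_comp, prod_comp]
  simp only [Category.comp_id]

theorem mapR_comp (x : M) {y y' y'' : N} (f : y ⟶ y') (g : y' ⟶ y'') :
    B.mapR x (f ≫ g) = B.mapR x f ≫ B.mapR x g := by
  rw [mapR, mapR, mapR, ← Functor.map_comp, prod_comp]
  simp only [Category.comp_id]

@[simp]
theorem mapL_id (x : M) (y : N) : B.mapL (𝟙 x) y = 𝟙 _ := B.functor.map_id _

@[simp]
theorem mapR_id (x : M) (y : N) : B.mapR x (𝟙 y) = 𝟙 _ := B.functor.map_id _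

theorem map_eq {p q : M × N} (f : p ⟶ q) :
    B.functor.map f = B.mapL f.1 p.2 ≫ B.mapR q.1 f.2 := by
  simp only [mapL, mapR, ← Functor.map_comp]
  congr 1
  ext <;> simp

theorem mapL_mapR {x x' : M} (f : x ⟶ x') {y y' : N} (g : y ⟶ y') :
    B.mapL f y ≫ B.mapR x' g = B.mapR x g ≫ B.mapL f y' := by
  simp [mapL, mapR, ← Functor.map_comp]

theorem mapL_balance {x x' : M} (f : x ⟶ x') (c : C) (y : N) :
    B.mapL (f ⊵ᵣ c) y ≫ (B.balance x' c y).hom = (B.balance x c y).hom ≫ B.mapL f (c ⊙ₗ y) := by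
  simpa [mapL] using B.balance_naturality f (𝟙 c) (𝟙 y)

theorem mapM_balance (x : M) {c c' : C} (g : c ⟶ c') (y : N) :
    B.mapL (x ⊴ᵣ g) y ≫ (B.balance x c' y).hom = (B.balance x c y).hom ≫ B.mapR x (g ⊵ₗ y) := by
  simpa [mapL, mapR] using B.balance_naturality (𝟙 x) g (𝟙 y)

theorem mapR_balance (x : M) (c : C) {y y' : N} (h : y ⟶ y') :
    B.mapR (x ⊙ᵣ c) h ≫ (B.balance x c y').hom =
      (B.balance x c y).hom ≫ B.mapR x (c ⊴ₗ h) := by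
  simpa [mapL, mapR] using B.balance_naturality (𝟙 x) (𝟙 c) h

theorem balance_unit' (x : M) (y : N) :
    (B.balance x (𝟙_ C) y).hom ≫ B.mapR x (λₗ y).hom = B.mapL (ρᵣ x).hom y :=
  B.balance_unit x y

theorem balance_tensor' (x : M) (a b : C) (y : N) :
    (B.balance (x ⊙ᵣ a) b y).hom ≫ (B.balance x a (b ⊙ₗ y)).hom =
      B.mapL (αᵣ x a b).inv y ≫ (B.balance x (a ⊗ b) y).hom ≫ B.mapR x (αₗ a b y).hom := by
  have := B.balance_tensor x a b y
  rw [mapR, ← this, mapL, ← Functor.map_comp_assoc]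
  simp

variable {B}

section ActionFunctor

variable (ρ) in
/-- The functor `x ↦ x ⊙ c`. -/
def actRight (c : C) : M ⥤ M where
  obj x := x ⊙ᵣ c
  map f := f ⊵ᵣ c

variable (ρ) in
/-- The functor `c ↦ x ⊙ c`. -/
def actLeft (x : M) : C ⥤ M where
  obj c := x ⊙ᵣ c
  map f := x ⊴ᵣ f

end ActionFunctor

variable {n : N} {E : N ⥤ C} (H : InternalHom C n E)

variable (ρ E) in
/-- The functor `(x, y) ↦ x ⊙ E y`. -/
def actFunctor : M × N ⥤ M where
  obj p := p.1 ⊙ᵣ E.obj p.2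
  map f := f.1 ⊙ᵣₘ E.map f.2

section HomBalance

variable [∀ c y, IsIso (strength H c y)]

/-- The isomorphism `(x ⊙ c) ⊙ [n, y] ≅ x ⊙ [n, c ⊙ y]`. -/
@[simps]
def homBalance (x : M) (c : C) (y : N) : (x ⊙ᵣ c) ⊙ᵣ E.obj y ≅ x ⊙ᵣ E.obj (c ⊙ₗ y) where
  hom := (αᵣ x c (E.obj y)).inv ≫ x ⊴ᵣ strength H c y
  inv := x ⊴ᵣ inv (strength H c y) ≫ (αᵣ x c (E.obj y)).hom
  hom_inv_id := by
    rw [Category.assoc, actionHomRight_hom_inv'_assoc, Iso.inv_hom_id]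
  inv_hom_id := by
    rw [Category.assoc, Iso.hom_inv_id_assoc, actionHomRight_inv_hom']

theorem homBalance_naturality {x x' : M} {c c' : C} {y y' : N} (f : x ⟶ x') (g : c ⟶ c')
    (h : y ⟶ y') :
    ((f ⊙ᵣₘ g) ⊙ᵣₘ E.map h) ≫ (homBalance H x' c' y').hom =
      (homBalance H x c y).hom ≫ (f ⊙ᵣₘ E.map (g ⊙ₗₘ h)) := by
  have h1 := strength_naturality_right H c h
  have h2 := strength_naturality_left H g y'
  simp only [homBalance_hom, Category.assoc]
  rw [actionAssocIso_inv_naturality_assoc]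
  congr 1
  rw [← id_actionHom, ← id_actionHom, ← actionHom_comp, ← actionHom_comp, Category.comp_id,
    Category.id_comp]
  congr 1
  rw [MonoidalLeftAction.actionHom_def', Functor.map_comp, ← reassoc_of% h1, ← h2,
    tensorHom_def', Category.assoc]

theorem homBalance_unit (x : M) (y : N) :
    (homBalance H x (𝟙_ C) y).hom ≫ x ⊴ᵣ E.map (λₗ y).hom = (ρᵣ x).hom ⊵ᵣ E.obj y := by
  rw [homBalance_hom, Category.assoc, ← actionHomRight_comp, strength_unit, actionHom_leftUnitor,
    Iso.inv_hom_id_assoc]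

theorem homBalance_tensor (x : M) (a b : C) (y : N) :
    (αᵣ x a b).hom ⊵ᵣ E.obj y ≫ (homBalance H (x ⊙ᵣ a) b y).hom ≫
        (homBalance H x a (b ⊙ₗ y)).hom =
      (homBalance H x (a ⊗ b) y).hom ≫ x ⊴ᵣ E.map (αₗ a b y).hom := by
  have h2 := actionHom_associator a b (E.obj y) x
  simp only [homBalance_hom, Category.assoc]
  rw [← actionHomRight_comp, strength_tensor, ← cancel_epi (αᵣ x (a ⊗ b) (E.obj y)).hom,
    ← reassoc_of% h2, Iso.hom_inv_id_assoc, Iso.hom_inv_id_assoc, actionHomRight_comp,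
    actionHomRight_comp, whiskerRight_actionHomLeft]
  simp only [Category.assoc]

end HomBalance

/-- The balanced functor `(x, y) ↦ x ⊙ [n, y]`. -/
def ofInternalHom [PreservesFiniteColimits E] [∀ c y, IsIso (strength H c y)]
    (h₁ : ∀ c : C, PreservesFiniteColimits (actRight ρ c))
    (h₂ : ∀ x : M, PreservesFiniteColimits (actLeft ρ x)) : BalancedFunctor ρ σ M where
  functor := actFunctor ρ E
  rightExact_left y := by
    have := h₁ (E.obj y)
    exact preservesFiniteColimits_of_natIso (NatIso.ofComponents (fun x => Iso.refl _)
      (fun f => (Category.comp_id _).trans (Eq.trans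
        (((congrArg (fun t => f ⊙ᵣₘ t) (E.map_id y)).trans (actionHom_id f _)).symm)
        (Category.id_comp _).symm)) : actRight ρ (E.obj y) ≅ Prod.sectL M y ⋙ actFunctor ρ E)
  rightExact_right x := by
    have := h₂ x
    exact preservesFiniteColimits_of_natIso (NatIso.ofComponents (fun x => Iso.refl _)
      (fun f => (Category.comp_id _).trans (Eq.trans (id_actionHom x (E.map f)).symm
        (Category.id_comp _).symm)) : E ⋙ actLeft ρ x ≅ Prod.sectR x N ⋙ actFunctor ρ E)
  balance := homBalance H
  balance_naturality := homBalance_naturality H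
  balance_unit x y := by
    refine Eq.trans ?_ ((homBalance_unit H x y).trans ?_)
    · exact congrArg (fun t => (homBalance H x (𝟙_ C) y).hom ≫ t) (id_actionHom x _)
    · exact ((congrArg (fun t => (ρᵣ x).hom ⊙ᵣₘ t) (E.map_id y)).trans (actionHom_id _ _)).symm
  balance_tensor x a b y := by
    refine Eq.trans ?_ ((homBalance_tensor H x a b y).trans ?_)
    · exact congrArg (fun t => t ≫ (homBalance H (x ⊙ᵣ a) b y).hom ≫
        (homBalance H x a (b ⊙ₗ y)).hom)
        ((congrArg (fun t => (αᵣ x a b).hom ⊙ᵣₘ t) (E.map_id y)).trans (actionHom_id _ _))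
    · exact (congrArg (fun t => (homBalance H x (a ⊗ b) y).hom ≫ t) (id_actionHom x _)).symm

variable [HasFiniteColimits T] [HasFiniteColimits M]

/-- A functor `T ⥤ M` representing the balanced functor `(x, y) ↦ x ⊙ [n, y]`. -/
structure HomFunctor (B : BalancedFunctor ρ σ T) (H : InternalHom C n E) where
  functor : T ⥤ M
  preservesFiniteColimits : PreservesFiniteColimits functor
  iso (x : M) (y : N) : functor.obj (B.box x y) ≅ x ⊙ᵣ E.obj y
  iso_left {x x' : M} (f : x ⟶ x') (y : N) :
    functor.map (B.mapL f y) ≫ (iso x' y).hom = (iso x y).hom ≫ f ⊵ᵣ E.obj y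
  iso_right (x : M) {y y' : N} (g : y ⟶ y') :
    functor.map (B.mapR x g) ≫ (iso x y').hom = (iso x y).hom ≫ x ⊴ᵣ E.map g
  iso_balance (x : M) (c : C) (y : N) :
    functor.map (B.balance x c y).hom ≫ (iso x (c ⊙ₗ y)).hom =
      (iso (x ⊙ᵣ c) y).hom ≫ (αᵣ x c (E.obj y)).inv ≫ x ⊴ᵣ strength H c y

/-- The universal property applied to `ofInternalHom`. Splitting naturality into the two variables
keeps morphisms of the product category out of the later computations. -/
theorem IsTensorProduct.nonempty_homFunctor (hB : B.IsTensorProduct) (H : InternalHom C n E)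
    [PreservesFiniteColimits E] [∀ c y, IsIso (strength H c y)]
    (h₁ : ∀ c : C, PreservesFiniteColimits (actRight ρ c))
    (h₂ : ∀ x : M, PreservesFiniteColimits (actLeft ρ x)) : Nonempty (HomFunctor B H) := by
  obtain ⟨G, hG, e, he⟩ := hB.exists_extension (ofInternalHom (σ := σ) H h₁ h₂)
  exact ⟨{
    functor := G
    preservesFiniteColimits := hG
    iso x y := e.app (x, y)
    iso_left {x x'} f y := by
      refine (e.hom.naturality (f ×ₘ 𝟙 y)).trans ?_
      exact congrArg (fun t => e.hom.app (x, y) ≫ t)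
        ((congrArg (fun t => f ⊙ᵣₘ t) (E.map_id y)).trans (actionHom_id _ _))
    iso_right x {y y'} g := by
      refine (e.hom.naturality (𝟙 x ×ₘ g)).trans ?_
      exact congrArg (fun t => e.hom.app (x, y) ≫ t) (id_actionHom _ _)
    iso_balance x c y := (he x c y).symm }⟩

end BalancedFunctor

/-! ### The right adjoint of `- ⊠ n`, and embeddings into objects `x ⊠ n₁` -/

namespace BalancedFunctor

open scoped MonoidalLeftAction MonoidalRightAction
open MonoidalRightAction ModuleHom

variable {C M N T : Type w} [Category.{v} C] [Category.{v} M] [Category.{v} N]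
  [MonoidalCategory C] {ρ : MonoidalRightAction C M} {σ : MonoidalLeftAction C N}
  [Category.{v} T] {B : BalancedFunctor ρ σ T}

variable (B) in
/-- The functor `x ↦ x ⊠ y`. -/
def boxL (y : N) : M ⥤ T where
  obj x := B.box x y
  map f := B.mapL f y
  map_comp f g := B.mapL_comp f g y

instance (y : N) : PreservesFiniteColimits (B.boxL y) := B.rightExact_left y

variable {n : N} {E : N ⥤ C} {H : InternalHom C n E}
variable [HasFiniteColimits T] [HasFiniteColimits M]

omit [HasFiniteColimits M] in
/-- A balanced natural transformation, given on the objects `x ⊠ y`, extends. -/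
theorem IsTensorProduct.exists_natTrans' {D : Type w} [Category.{v} D] [HasFiniteColimits D]
    (hB : B.IsTensorProduct) (G G' : T ⥤ D) [PreservesFiniteColimits G]
    [PreservesFiniteColimits G'] (α : ∀ x y, G.obj (B.box x y) ⟶ G'.obj (B.box x y))
    (hL : ∀ {x x' : M} (f : x ⟶ x') (y : N),
      G.map (B.mapL f y) ≫ α x' y = α x y ≫ G'.map (B.mapL f y))
    (hR : ∀ (x : M) {y y' : N} (g : y ⟶ y'),
      G.map (B.mapR x g) ≫ α x y' = α x y ≫ G'.map (B.mapR x g))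
    (hα : ∀ x c y, α (x ⊙ᵣ c) y ≫ G'.map (B.balance x c y).hom =
      G.map (B.balance x c y).hom ≫ α x (c ⊙ₗ y)) :
    ∃ β : G ⟶ G', ∀ x y, β.app (B.box x y) = α x y := by
  have nat {p q : M × N} (f : p ⟶ q) : G.map (B.functor.map f) ≫ α q.1 q.2 =
      α p.1 p.2 ≫ G'.map (B.functor.map f) := by
    rw [map_eq, Functor.map_comp, Functor.map_comp, Category.assoc, hR, reassoc_of% hL]
  obtain ⟨β, hβ⟩ := hB.exists_natTrans G G'
    { app p := α p.1 p.2, naturality p q f := nat f } hα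
  exact ⟨β, fun x y => hβ (x, y)⟩

omit [HasFiniteColimits M] in
-- On `x ⊠ y` the counit moves `[n, y]` across the balancing and evaluates: `(x ⊙ [n, y]) ⊠ n ≅ x ⊠
-- ([n, y] ⊙ n) ⟶ x ⊠ y`. It is itself balanced because the strength is characterised by
-- `strength_ev`.
theorem exists_counit (hB : B.IsTensorProduct) (F : HomFunctor B H) :
    ∃ κ : F.functor ⋙ B.boxL n ⟶ 𝟭 T, ∀ x y, κ.app (B.box x y) =
      B.mapL (F.iso x y).hom n ≫ (B.balance x (E.obj y) n).hom ≫ B.mapR x (H.ev y) := by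
  have := F.preservesFiniteColimits
  have nL {x x' : M} (f : x ⟶ x') (y : N) :
      B.mapL (F.functor.map (B.mapL f y)) n ≫ B.mapL (F.iso x' y).hom n ≫
        (B.balance x' (E.obj y) n).hom ≫ B.mapR x' (H.ev y) =
      (B.mapL (F.iso x y).hom n ≫ (B.balance x (E.obj y) n).hom ≫ B.mapR x (H.ev y)) ≫
        B.mapL f y := by
    rw [← reassoc_of% mapL_comp, F.iso_left, reassoc_of% mapL_comp, reassoc_of% mapL_balance, mapL_mapR]
    simp only [Category.assoc]
  have nR (x : M) {y y' : N} (g : y ⟶ y') :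
      B.mapL (F.functor.map (B.mapR x g)) n ≫ B.mapL (F.iso x y').hom n ≫
        (B.balance x (E.obj y') n).hom ≫ B.mapR x (H.ev y') =
      (B.mapL (F.iso x y).hom n ≫ (B.balance x (E.obj y) n).hom ≫ B.mapR x (H.ev y)) ≫
        B.mapR x g := by
    rw [← reassoc_of% mapL_comp, F.iso_right, reassoc_of% mapL_comp, reassoc_of% mapM_balance, ← mapR_comp,
      H.ev_naturality, mapR_comp]
    simp only [Category.assoc]
  have cB (x : M) (c : C) (y : N) :
      (B.mapL (F.iso (x ⊙ᵣ c) y).hom n ≫ (B.balance (x ⊙ᵣ c) (E.obj y) n).hom ≫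
        B.mapR (x ⊙ᵣ c) (H.ev y)) ≫ (B.balance x c y).hom =
      B.mapL (F.functor.map (B.balance x c y).hom) n ≫ B.mapL (F.iso x (c ⊙ₗ y)).hom n ≫
        (B.balance x (E.obj (c ⊙ₗ y)) n).hom ≫ B.mapR x (H.ev (c ⊙ₗ y)) := by
    rw [← reassoc_of% mapL_comp, F.iso_balance, reassoc_of% mapL_comp, reassoc_of% mapL_comp, reassoc_of% mapM_balance,
      ← mapR_comp, strength_ev, mapR_comp]
    simp only [Category.assoc]
    rw [mapR_balance, reassoc_of% balance_tensor']
  exact hB.exists_natTrans' (F.functor ⋙ B.boxL n) (𝟭 T) _ nL nR cB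

section Adjunction

variable (hB : B.IsTensorProduct) (F : HomFunctor B H)

/-- The counit of the adjunction between `- ⊠ n` and the functor representing `x ⊙ [n, y]`. -/
def counit : F.functor ⋙ B.boxL n ⟶ 𝟭 T := (exists_counit hB F).choose

/-- The components of the counit. -/
def counitMap (t : T) : B.box (F.functor.obj t) n ⟶ t := (counit hB F).app t

theorem counitMap_naturality {s t : T} (f : s ⟶ t) :
    B.mapL (F.functor.map f) n ≫ counitMap hB F t = counitMap hB F s ≫ f :=
  (counit hB F).naturality f

theorem counitMap_box (x : M) (y : N) : counitMap hB F (B.box x y) =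
    B.mapL (F.iso x y).hom n ≫ (B.balance x (E.obj y) n).hom ≫ B.mapR x (H.ev y) :=
  (exists_counit hB F).choose_spec x y

/-- The unit of the adjunction between `- ⊠ n` and the functor representing `x ⊙ [n, y]`. -/
def unitMap (x : M) : x ⟶ F.functor.obj (B.box x n) :=
  (ρᵣ x).inv ≫ x ⊴ᵣ H.lift (λₗ n).hom ≫ (F.iso x n).inv

omit [HasFiniteColimits T] [HasFiniteColimits M] in
theorem unitMap_naturality {x x' : M} (f : x ⟶ x') :
    f ≫ unitMap F x' = unitMap F x ≫ F.functor.map (B.mapL f n) := by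
  have h : F.functor.map (B.mapL f n) = (F.iso x n).hom ≫ f ⊵ᵣ E.obj n ≫ (F.iso x' n).inv := by
    rw [← reassoc_of% F.iso_left, Iso.hom_inv_id, Category.comp_id]
  simp only [unitMap, h, Category.assoc, Iso.inv_hom_id_assoc]
  rw [action_exchange_assoc, actionUnitIso_inv_naturality_assoc]

theorem boxL_unitMap_counit (x : M) :
    B.mapL (unitMap F x) n ≫ counitMap hB F (B.box x n) = 𝟙 _ := by
  rw [counitMap_box, unitMap, mapL_comp, mapL_comp]
  simp only [Category.assoc]
  rw [← reassoc_of% (mapL_comp B (F.iso x n).inv), Iso.inv_hom_id, mapL_id, Category.id_comp,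
    reassoc_of% mapM_balance, ← mapR_comp, H.lift_ev, balance_unit', ← mapL_comp, Iso.inv_hom_id,
    mapL_id]

/-- A triangle identity for `- ⊙ n ⊣ [n, -]`: the first three maps compose to the unit at `E y`,
rewritten through the strength as it occurs in `unitMap_map_counit`. -/
theorem lift_strength_ev (y : N) :
    (ρ_ (E.obj y)).inv ≫ E.obj y ◁ H.lift (λₗ n).hom ≫ strength H (E.obj y) n ≫
      E.map (H.ev y) = 𝟙 _ := by
  apply H.hom_ext
  simp only [MonoidalLeftAction.comp_actionHomLeft, Category.assoc, H.ev_naturality,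
    reassoc_of% strength_ev, MonoidalLeftAction.id_actionHomLeft, Category.id_comp]
  rw [MonoidalLeftAction.whiskerLeft_actionHomLeft]
  simp only [Category.assoc, Iso.inv_hom_id_assoc]
  rw [← MonoidalLeftAction.actionHomRight_comp_assoc, H.lift_ev,
    ← MonoidalLeftAction.rightUnitor_actionHom_assoc,
    MonoidalLeftAction.inv_hom_actionHomLeft_assoc]

/-- Both sides are natural in `t`, so it suffices to take `t = x ⊠ y`; there the identity is `x ⊙ -`
applied to `lift_strength_ev`. -/
theorem unitMap_map_counit (t : T) :
    unitMap F (F.functor.obj t) ≫ F.functor.map (counitMap hB F t) = 𝟙 _ := by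
  have := F.preservesFiniteColimits
  let α : F.functor ⟶ F.functor :=
    { app t := unitMap F (F.functor.obj t) ≫ F.functor.map (counitMap hB F t)
      naturality s t f := by
        rw [Category.assoc, ← Functor.map_comp, ← counitMap_naturality, Functor.map_comp,
          reassoc_of% unitMap_naturality] }
  have key : α = 𝟙 _ := hB.natTrans_ext fun p => by
    obtain ⟨x, y⟩ := p
    change unitMap F (F.functor.obj (B.box x y)) ≫
      F.functor.map (counitMap hB F (B.box x y)) = 𝟙 _
    rw [counitMap_box, Functor.map_comp, ← reassoc_of% (unitMap_naturality F (F.iso x y).hom),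
      ← cancel_mono (F.iso x y).hom, Functor.map_comp]
    simp only [Category.assoc, Category.id_comp]
    rw [F.iso_right, reassoc_of% F.iso_balance, unitMap]
    simp only [Category.assoc, Iso.inv_hom_id_assoc]
    rw [action_actionHomRight]
    simp only [Category.assoc, Iso.hom_inv_id_assoc]
    have h2 := actionHom_rightUnitor (E.obj y) x
    have h3 : (ρᵣ (x ⊙ᵣ E.obj y)).inv ≫ (αᵣ x (E.obj y) (𝟙_ C)).inv =
        x ⊴ᵣ (ρ_ (E.obj y)).inv := by
      rw [← cancel_mono (x ⊴ᵣ (ρ_ (E.obj y)).hom), actionHomRight_inv_hom, h2]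
      simp
    rw [reassoc_of% h3, ← actionHomRight_comp, ← actionHomRight_comp, ← actionHomRight_comp,
      lift_strength_ev, actionHomRight_id, Category.comp_id]
  exact congrArg (fun f => f.app t) key

/-- The functor `- ⊠ n` is left adjoint to the functor representing `x ⊙ [n, y]`. -/
def boxAdjunction : B.boxL n ⊣ F.functor where
  unit :=
    { app := unitMap F
      naturality _ _ f := unitMap_naturality F f }
  counit := counit hB F
  left_triangle_components := boxL_unitMap_counit hB F
  right_triangle_components := unitMap_map_counit hB F

end Adjunction

section Embedding

variable [∀ c y, IsIso (strength H c y)]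

/-- If `E = [n, -]` is left adjoint to `- ⊙ n₁`, then the functor `T ⥤ M` is left adjoint
to `- ⊠ n₁`; its unit has the following split monomorphisms as images. -/
theorem exists_mono_map (hB : B.IsTensorProduct) (F : HomFunctor B H)
    {n₁ : N} (e : E.obj n₁ ⟶ 𝟙_ C)
    (he : ∀ (c : C) (y : N) (f g : y ⟶ c ⊙ₗ n₁),
      E.map f ≫ costrength H e c = E.map g ≫ costrength H e c → f = g)
    (he' : ∀ (y : N), ∃ f : y ⟶ E.obj y ⊙ₗ n₁, E.map f ≫ costrength H e (E.obj y) = 𝟙 _)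
    (t : T) : ∃ η : t ⟶ B.box (F.functor.obj t) n₁, Mono (F.functor.map η) := by
  have := F.preservesFiniteColimits
  -- `ν` is the unit of `E ⊣ (- ⊙ n₁)`; the uniqueness `he` makes it natural and compatible with the
  -- action.
  choose ν hν using he'
  have ν_nat {y y' : N} (g : y ⟶ y') : g ≫ ν y' = ν y ≫ E.map g ⊵ₗ n₁ := by
    apply he
    rw [Functor.map_comp, Functor.map_comp, Category.assoc, Category.assoc, hν,
      costrength_naturality, reassoc_of% (hν y), Category.comp_id]
  have ν_act (c : C) (y : N) : ν (c ⊙ₗ y) =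
      c ⊴ₗ ν y ≫ (αₗ c (E.obj y) n₁).inv ≫ strength H c y ⊵ₗ n₁ := by
    apply he
    simp only [Functor.map_comp, Category.assoc]
    rw [hν, costrength_naturality, reassoc_of% map_assoc_costrength, ← cancel_epi (strength H c y),
      ← reassoc_of% (strength_naturality_right H c (ν y)), IsIso.hom_inv_id_assoc,
      ← MonoidalCategory.whiskerLeft_comp_assoc, hν]
    simp
  have balL {x x' : M} (f : x ⟶ x') (c : C) (y : N) : B.mapL f (c ⊙ₗ y) ≫
      (B.balance x' c y).inv = (B.balance x c y).inv ≫ B.mapL (f ⊵ᵣ c) y := by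
    rw [← cancel_epi (B.balance x c y).hom, ← reassoc_of% mapL_balance]
    simp
  have balM (x : M) {c c' : C} (g : c ⟶ c') (y : N) : B.mapR x (g ⊵ₗ y) ≫
      (B.balance x c' y).inv = (B.balance x c y).inv ≫ B.mapL (x ⊴ᵣ g) y := by
    rw [← cancel_epi (B.balance x c y).hom, ← reassoc_of% mapM_balance]
    simp
  have isoL {x x' : M} (f : x ⟶ x') (y : N) : f ⊵ᵣ E.obj y ≫ (F.iso x' y).inv =
      (F.iso x y).inv ≫ F.functor.map (B.mapL f y) := by
    rw [← cancel_epi (F.iso x y).hom, ← reassoc_of% F.iso_left]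
    simp
  have isoR (x : M) {y y' : N} (g : y ⟶ y') : x ⊴ᵣ E.map g ≫ (F.iso x y').inv =
      (F.iso x y).inv ≫ F.functor.map (B.mapR x g) := by
    rw [← cancel_epi (F.iso x y).hom, ← reassoc_of% F.iso_right]
    simp
  have isoB (x : M) (c : C) (y : N) : (αᵣ x c (E.obj y)).inv ≫ x ⊴ᵣ strength H c y ≫
      (F.iso x (c ⊙ₗ y)).inv =
      (F.iso (x ⊙ᵣ c) y).inv ≫ F.functor.map (B.balance x c y).hom := by
    rw [← cancel_epi (F.iso (x ⊙ᵣ c) y).hom]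
    have := F.iso_balance x c y
    rw [← reassoc_of% this]
    simp
  -- The map `x ⊠ y ⟶ x ⊠ ([n, y] ⊙ n₁) ≅ (x ⊙ [n, y]) ⊠ n₁` is natural and balanced, so it extends
  -- to a transformation on all of `T`.
  let ζ (x : M) (y : N) : B.box x y ⟶ B.box (F.functor.obj (B.box x y)) n₁ :=
    B.mapR x (ν y) ≫ (B.balance x (E.obj y) n₁).inv ≫ B.mapL (F.iso x y).inv n₁
  have ζL {x x' : M} (f : x ⟶ x') (y : N) :
      B.mapL f y ≫ ζ x' y = ζ x y ≫ B.mapL (F.functor.map (B.mapL f y)) n₁ := by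
    simp only [ζ, Category.assoc]
    rw [reassoc_of% mapL_mapR, reassoc_of% (balL f (E.obj y) n₁), ← mapL_comp, isoL, mapL_comp]
  have ζR (x : M) {y y' : N} (g : y ⟶ y') :
      B.mapR x g ≫ ζ x y' = ζ x y ≫ B.mapL (F.functor.map (B.mapR x g)) n₁ := by
    simp only [ζ, Category.assoc]
    rw [← reassoc_of% mapR_comp, ν_nat, reassoc_of% mapR_comp, reassoc_of% (balM x (E.map g) n₁),
      ← mapL_comp, isoR, mapL_comp]
  have ζB (x : M) (c : C) (y : N) :
      ζ (x ⊙ᵣ c) y ≫ B.mapL (F.functor.map (B.balance x c y).hom) n₁ =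
        (B.balance x c y).hom ≫ ζ x (c ⊙ₗ y) := by
    simp only [ζ, Category.assoc]
    rw [← mapL_comp, ← isoB, mapL_comp, mapL_comp, ν_act, reassoc_of% mapR_comp, reassoc_of% mapR_comp,
      reassoc_of% (balM x (strength H c y) n₁), ← reassoc_of% mapR_balance]
    have h := balance_tensor' B x c (E.obj y) n₁
    have h' : (B.balance (x ⊙ᵣ c) (E.obj y) n₁).inv ≫ B.mapL (αᵣ x c (E.obj y)).inv n₁ =
        (B.balance x c (E.obj y ⊙ₗ n₁)).hom ≫ B.mapR x (αₗ c (E.obj y) n₁).inv ≫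
          (B.balance x (c ⊗ E.obj y) n₁).inv := by
      rw [← cancel_epi (B.balance (x ⊙ᵣ c) (E.obj y) n₁).hom, reassoc_of% h, ← reassoc_of% mapR_comp,
        Iso.hom_inv_id, mapR_id]
      simp
    rw [reassoc_of% h']
  obtain ⟨η, hη⟩ := hB.exists_natTrans' (𝟭 T) (F.functor ⋙ B.boxL n₁) ζ ζL ζR ζB
  -- `θ` is the retraction `m ⊙ [n, n₁] ⟶ m` induced by `e`. That it splits the image of the unit is
  -- checked on `x ⊠ y`, where it becomes `hν`.
  let θ (m : M) : F.functor.obj (B.box m n₁) ⟶ m :=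
    (F.iso m n₁).hom ≫ m ⊴ᵣ e ≫ (ρᵣ m).hom
  have θ_nat {m m' : M} (f : m ⟶ m') : F.functor.map (B.mapL f n₁) ≫ θ m' = θ m ≫ f := by
    simp only [θ, reassoc_of% F.iso_left, Category.assoc]
    rw [← action_exchange_assoc, actionUnitIso_hom_naturality]
  let ηm (s : T) : s ⟶ B.box (F.functor.obj s) n₁ := η.app s
  have ηm_nat {s s' : T} (f : s ⟶ s') : f ≫ ηm s' = ηm s ≫ B.mapL (F.functor.map f) n₁ :=
    η.naturality f
  have hη' (s : T) : F.functor.map (ηm s) ≫ θ (F.functor.obj s) = 𝟙 (F.functor.obj s) := by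
    let α : F.functor ⟶ F.functor :=
      { app t := F.functor.map (ηm t) ≫ θ (F.functor.obj t)
        naturality s t f := by
          rw [← Functor.map_comp_assoc, ηm_nat, Functor.map_comp_assoc, θ_nat]
          exact (Category.assoc _ _ _).symm }
    have key : α = 𝟙 _ := hB.natTrans_ext fun p => by
      obtain ⟨x, y⟩ := p
      change F.functor.map (ηm (B.box x y)) ≫ θ (F.functor.obj (B.box x y)) = 𝟙 _
      have h1 : ηm (B.box x y) = ζ x y := hη x y
      rw [h1]
      simp only [ζ, Functor.map_comp, Category.assoc]
      rw [θ_nat]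
      have h2 : F.functor.map (B.balance x (E.obj y) n₁).inv ≫
          (F.iso (x ⊙ᵣ E.obj y) n₁).hom = (F.iso x (E.obj y ⊙ₗ n₁)).hom ≫
            x ⊴ᵣ inv (strength H (E.obj y) n₁) ≫ (αᵣ x (E.obj y) (E.obj n₁)).hom := by
        rw [← cancel_epi (F.functor.map (B.balance x (E.obj y) n₁).hom), Iso.map_hom_inv_id_assoc,
          reassoc_of% F.iso_balance, ← actionHomRight_comp_assoc, IsIso.hom_inv_id]
        simp
      have h3 : (αᵣ x (E.obj y) (E.obj n₁)).hom ≫ (x ⊙ᵣ E.obj y) ⊴ᵣ e ≫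
          (ρᵣ (x ⊙ᵣ E.obj y)).hom = x ⊴ᵣ (E.obj y ◁ e ≫ (ρ_ (E.obj y)).hom) := by
        rw [action_actionHomRight, actionHomRight_comp, actionHom_rightUnitor]
        simp
      simp only [θ, Category.assoc]
      rw [reassoc_of% h2, reassoc_of% h3, reassoc_of% F.iso_right, ← actionHomRight_comp_assoc,
        ← actionHomRight_comp_assoc, Category.assoc]
      have h4 : E.map (ν y) ≫ inv (strength H (E.obj y) n₁) ≫ E.obj y ◁ e ≫
          (ρ_ (E.obj y)).hom = 𝟙 _ := hν y
      rw [h4]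
      simp
    exact congrArg (fun f => f.app s) key
  have : Mono (F.functor.map (ηm t) ≫ θ (F.functor.obj t)) := by
    rw [hη']; infer_instance
  exact ⟨ηm t, mono_of_mono (F.functor.map (ηm t)) (θ (F.functor.obj t))⟩

end Embedding

end BalancedFunctor

/-! ### Presentations by a progenerator -/

section Progenerator

variable {C : Type*} [Category* C] [Preadditive C]

section Cokernel

variable {X Y Z : C} {f : X ⟶ Y} {π : Y ⟶ Z} {w : f ≫ π = 0}

theorem epi_of_isCokernel (h : IsColimit (CokernelCofork.ofπ π w)) : Epi π :=
  epi_of_isColimit_cofork h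

theorem exists_desc_of_isCokernel (h : IsColimit (CokernelCofork.ofπ π w)) {W : C} (g : Y ⟶ W)
    (hg : f ≫ g = 0) : ∃ l : Z ⟶ W, π ≫ l = g :=
  ⟨_, (CokernelCofork.IsColimit.desc' h g hg).2⟩

variable (f π w) in
theorem nonempty_isCokernel [Epi π]
    (h : ∀ {W : C} (g : Y ⟶ W), f ≫ g = 0 → ∃ l : Z ⟶ W, π ≫ l = g) :
    Nonempty (IsColimit (CokernelCofork.ofπ π w)) :=
  ⟨CokernelCofork.IsColimit.ofπ _ _ (fun g hg => (h g hg).choose)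
    (fun g hg => (h g hg).choose_spec)
    (fun g hg m hm => by rw [← cancel_epi π, hm, (h g hg).choose_spec])⟩

end Cokernel

/-- The objects built from `P` by finite direct sums. -/
inductive IsFree [HasBinaryBiproducts C] (P : C) : C → Prop
  | zero {A : C} (hA : IsZero A) : IsFree P A
  | self : IsFree P P
  | biprod {A A' : C} (hA : IsFree P A) (hA' : IsFree P A') : IsFree P (A ⊞ A')

/-- `X` has a presentation by objects built from `P` by finite direct sums. -/
def IsFinitelyPresented [HasBinaryBiproducts C] (P X : C) : Prop :=
  ∃ (A A' : C) (f : A ⟶ A') (π : A' ⟶ X) (w : f ≫ π = 0), IsFree P A ∧ IsFree P A' ∧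
    Nonempty (IsColimit (CokernelCofork.ofπ π w))

/-- The functor `Hom(P, -)` preserves cokernels. -/
structure IsCokernelProjective (P : C) : Prop where
  lift {X Y Z : C} {f : X ⟶ Y} {π : Y ⟶ Z} {w : f ≫ π = 0}
    (h : IsColimit (CokernelCofork.ofπ π w)) (g : P ⟶ Z) : ∃ l : P ⟶ Y, l ≫ π = g
  exact {X Y Z : C} {f : X ⟶ Y} {π : Y ⟶ Z} {w : f ≫ π = 0}
    (h : IsColimit (CokernelCofork.ofπ π w)) (g : P ⟶ Y) (hg : g ≫ π = 0) :
    ∃ l : P ⟶ X, l ≫ f = g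

/-- A progenerator of a `k`-linear category with finite-dimensional spaces of morphisms from
`P`. -/
structure IsProgenerator (k : Type u) [Field k] [Linear k C] [HasBinaryBiproducts C] (P : C) :
    Prop where
  projective : IsCokernelProjective P
  presented (X : C) : IsFinitelyPresented P X
  finite (X : C) : Module.Finite k (P ⟶ X)

/-- Projectivity and presentations are expressed by cokernels alone because they are applied to the
tensor product before it is known to be abelian. -/
theorem IsCokernelProjective.of_isFree [HasBinaryBiproducts C] {P A : C}
    (hP : IsCokernelProjective P) (hA : IsFree P A) : IsCokernelProjective A := by
  induction hA with
  | zero hA => exact ⟨fun _ g => ⟨0, hA.eq_of_src _ _⟩, fun _ g _ => ⟨0, hA.eq_of_src _ _⟩⟩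
  | self => exact hP
  | @biprod A A' _ _ h h' =>
    refine ⟨fun c g => ?_, fun c g hg => ?_⟩
    · obtain ⟨l, hl⟩ := h.lift c (biprod.inl ≫ g)
      obtain ⟨l', hl'⟩ := h'.lift c (biprod.inr ≫ g)
      exact ⟨biprod.desc l l', by ext <;> simp [hl, hl']⟩
    · obtain ⟨l, hl⟩ := h.exact c (biprod.inl ≫ g) (by simp [hg])
      obtain ⟨l', hl'⟩ := h'.exact c (biprod.inr ≫ g) (by simp [hg])
      exact ⟨biprod.desc l l', by ext <;> simp [hl, hl']⟩

section Presented

variable [HasBinaryBiproducts C] {P : C}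

theorem IsFinitelyPresented.of_isFree {A : C} (hA : IsFree P A) (Z : C) (hZ : IsZero Z) :
    IsFinitelyPresented P A :=
  ⟨Z, A, 0, 𝟙 A, zero_comp, .zero hZ, hA,
    ⟨CokernelCofork.IsColimit.ofId 0 rfl⟩⟩

theorem IsFinitelyPresented.of_iso {X Y : C} (hX : IsFinitelyPresented P X) (e : X ≅ Y) :
    IsFinitelyPresented P Y := by
  obtain ⟨A, A', f, π, w, hA, hA', ⟨h⟩⟩ := hX
  refine ⟨A, A', f, π ≫ e.hom, by simp [reassoc_of% w], hA, hA',
    ⟨h.ofIsoColimit (Cofork.ext e rfl)⟩⟩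

theorem IsFinitelyPresented.biprod {X Y : C} (hX : IsFinitelyPresented P X)
    (hY : IsFinitelyPresented P Y) : IsFinitelyPresented P (X ⊞ Y) := by
  obtain ⟨A, A', f, π, w, hA, hA', ⟨h⟩⟩ := hX
  obtain ⟨B, B', g, τ, w', hB, hB', ⟨h'⟩⟩ := hY
  have := epi_of_isCokernel h
  have := epi_of_isCokernel h'
  have : Epi (biprod.map π τ) := ⟨fun g g' hg => by
    ext
    · rw [← cancel_epi π]
      simpa using biprod.inl ≫= hg
    · rw [← cancel_epi τ]
      simpa using biprod.inr ≫= hg⟩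
  refine ⟨A ⊞ B, A' ⊞ B', biprod.map f g, biprod.map π τ, by ext <;> simp [w, w'],
    .biprod hA hB, .biprod hA' hB', nonempty_isCokernel _ _ _ fun {W} k hk => ?_⟩
  obtain ⟨l, hl⟩ := exists_desc_of_isCokernel h (biprod.inl ≫ k) (by simpa using biprod.inl ≫= hk)
  obtain ⟨l', hl'⟩ := exists_desc_of_isCokernel h' (biprod.inr ≫ k)
    (by simpa using biprod.inr ≫= hk)
  exact ⟨biprod.desc l l', by ext <;> simp [hl, hl']⟩

/-- Projectivity lifts `f` on the generators `A` of `X` to the generators `B'` of `Y`. Then `Z` has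
generators `B'`, and its relations are those of `Y` together with the image of `A`. -/
theorem IsFinitelyPresented.cokernel (hP : IsCokernelProjective P) {X Y Z : C} {f : X ⟶ Y}
    {π : Y ⟶ Z} {w : f ≫ π = 0} (h : IsColimit (CokernelCofork.ofπ π w))
    (hX : IsFinitelyPresented P X) (hY : IsFinitelyPresented P Y) :
    IsFinitelyPresented P Z := by
  obtain ⟨_, A, _, p, _, _, hA, ⟨hp⟩⟩ := hX
  obtain ⟨B, B', g, q, wq, hB, hB', ⟨hq⟩⟩ := hY
  obtain ⟨l, hl⟩ := (hP.of_isFree hA).lift hq (p ≫ f)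
  have := epi_of_isCokernel hp
  have := epi_of_isCokernel hq
  have := epi_of_isCokernel h
  refine ⟨A ⊞ B, B', biprod.desc l g, q ≫ π, ?_, .biprod hA hB, hB',
    nonempty_isCokernel _ _ _ fun {W} k hk => ?_⟩
  · ext
    · simp [reassoc_of% hl, w]
    · simp [reassoc_of% wq]
  · obtain ⟨m, hm⟩ := exists_desc_of_isCokernel hq k (by simpa using biprod.inr ≫= hk)
    obtain ⟨n, hn⟩ := exists_desc_of_isCokernel h m (by
      rw [← cancel_epi p, ← reassoc_of% hl, hm, comp_zero]
      simpa using biprod.inl ≫= hk)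
    exact ⟨n, by rw [Category.assoc, hn, hm]⟩

end Presented

section Functor

variable {D : Type*} [Category* D] [Preadditive D] (G : C ⥤ D)
  [G.Additive]

/-- The functor `G` preserves cokernels. -/
def PreservesCokernels : Prop :=
  ∀ ⦃X Y Z : C⦄ ⦃f : X ⟶ Y⦄ ⦃π : Y ⟶ Z⦄ (w : f ≫ π = 0), IsColimit (CokernelCofork.ofπ π w) →
    Nonempty (IsColimit (CokernelCofork.ofπ (f := G.map f) (G.map π)
      (by rw [← G.map_comp, w, G.map_zero])))

theorem preservesCokernels [PreservesFiniteColimits G] : PreservesCokernels G :=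
  fun _ _ _ _ _ _ h => ⟨CokernelCofork.mapIsColimit _ h G⟩

variable [HasBinaryBiproducts C]

theorem map_biprod_hom_ext {A A' : C} {Z : D} {f g : G.obj (A ⊞ A') ⟶ Z}
    (h : G.map biprod.inl ≫ f = G.map biprod.inl ≫ g)
    (h' : G.map biprod.inr ≫ f = G.map biprod.inr ≫ g) : f = g := by
  rw [← Category.id_comp f, ← Category.id_comp g, ← G.map_id, ← biprod.total, G.map_add,
    G.map_comp, G.map_comp, Preadditive.add_comp, Preadditive.add_comp]
  simp only [Category.assoc, h, h']

/-- A property of objects which is closed under finite direct sums and cokernels propagates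
from the image of `P` under a right exact functor. -/
theorem IsFinitelyPresented.induction [HasBinaryBiproducts D] (hG : PreservesCokernels G)
    {P X : C}
    (hX : IsFinitelyPresented P X) (Q : D → Prop) (iso : ∀ {A B : D}, (A ≅ B) → Q A → Q B)
    (zero : ∀ {A : D}, IsZero A → Q A) (biprod : ∀ {A B : D}, Q A → Q B → Q (A ⊞ B))
    (cokernel : ∀ {A A' B : D} (f : A ⟶ A') (π : A' ⟶ B) (w : f ≫ π = 0),
      IsColimit (CokernelCofork.ofπ π w) → Q A → Q A' → Q B) (hP : Q (G.obj P)) :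
    Q (G.obj X) := by
  have free {A : C} (hA : IsFree P A) : Q (G.obj A) := by
    induction hA with
    | zero hA => exact zero (G.map_isZero hA)
    | self => exact hP
    | biprod _ _ h h' =>
      have := preservesBinaryBiproducts_of_preservesBiproducts G
      exact iso (G.mapBiprod _ _).symm (biprod h h')
  obtain ⟨A, A', f, π, w, hA, hA', ⟨h⟩⟩ := hX
  obtain ⟨h'⟩ := hG w h
  exact cokernel _ _ _ h' (free hA) (free hA')

/-- A natural transformation from `Hom(-, R)` to `Hom(G -, Z)` is bijective if it is
on a generator. -/
theorem existsUnique_of_isFinitelyPresented (hG : PreservesCokernels G) {P R : C} {Z : D} (v : G.obj R ⟶ Z)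
    (h : ∀ φ : G.obj P ⟶ Z, ∃! f : P ⟶ R, G.map f ≫ v = φ) {X : C}
    (hX : IsFinitelyPresented P X) (φ : G.obj X ⟶ Z) : ∃! f : X ⟶ R, G.map f ≫ v = φ := by
  have free {A : C} (hA : IsFree P A) (φ : G.obj A ⟶ Z) : ∃! f : A ⟶ R, G.map f ≫ v = φ := by
    induction hA with
    | zero hA => exact ⟨0, (G.map_isZero hA).eq_of_src _ _, fun _ _ => hA.eq_of_src _ _⟩
    | self => exact h φ
    | biprod _ _ h h' =>
      obtain ⟨f, hf, hf'⟩ := h (G.map biprod.inl ≫ φ)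
      obtain ⟨g, hg, hg'⟩ := h' (G.map biprod.inr ≫ φ)
      refine ⟨biprod.desc f g, map_biprod_hom_ext G ?_ ?_, fun l hl => ?_⟩
      · rw [← G.map_comp_assoc, biprod.inl_desc, hf]
      · rw [← G.map_comp_assoc, biprod.inr_desc, hg]
      · ext
        · rw [biprod.inl_desc]
          exact hf' _ (by simp only [Functor.map_comp, Category.assoc, hl])
        · rw [biprod.inr_desc]
          exact hg' _ (by simp only [Functor.map_comp, Category.assoc, hl])
  obtain ⟨A, A', a, π, w, hA, hA', ⟨hπ⟩⟩ := hX
  have := epi_of_isCokernel hπ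
  obtain ⟨hπ'⟩ := hG w hπ
  have := epi_of_isCokernel hπ'
  obtain ⟨f, hf, hf'⟩ := free hA' (G.map π ≫ φ)
  -- Uniqueness on the relations `A` gives `a ≫ f = 0`, so `f` descends to `X`.
  obtain ⟨l, hl⟩ := exists_desc_of_isCokernel hπ f ((free hA 0).unique
    (by rw [Functor.map_comp, Category.assoc, hf, ← G.map_comp_assoc, w]; simp) (by simp))
  refine ⟨l, ?_, fun m hm => ?_⟩
  · change G.map l ≫ v = φ
    rw [← cancel_epi (G.map π), ← G.map_comp_assoc, hl, hf]
  · rw [← cancel_epi π, hl]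
    refine hf' _ ?_
    change G.map m ≫ v = φ at hm
    rw [G.map_comp, Category.assoc, hm]

end Functor

section Linear

variable (k : Type u) [Field k] [Linear k C] [HasBinaryBiproducts C]
  {D : Type*} [Category* D] [Preadditive D] [Linear k D]

variable {k} in
/-- A finitely generated space of morphisms `G P ⟶ Z` is covered by a single morphism `G A ⟶ Z`
with `A` free. -/
theorem exists_isFree_cover (G : C ⥤ D) [G.Additive] [G.Linear k] {P : C} {Z : D}
    {D' : Type*} [Category* D'] [Preadditive D'] (G' : D ⥤ D') [G'.Additive]
    {W : D'} (w : G'.obj Z ⟶ W) (K : Submodule k (G.obj P ⟶ Z)) (hK : K.FG) :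
    (∀ s ∈ K, G'.map s ≫ w = 0) → ∃ (A : C) (_ : IsFree P A) (a : G.obj A ⟶ Z),
      (∀ s ∈ K, ∃ l : P ⟶ A, G.map l ≫ a = s) ∧ G'.map a ≫ w = 0 := by
  induction K, hK using Submodule.fg_induction with
  | singleton x =>
    intro h
    refine ⟨P, .self, x, fun s hs => ?_, h x (Submodule.mem_span_singleton_self x)⟩
    obtain ⟨c, rfl⟩ := Submodule.mem_span_singleton.1 hs
    exact ⟨c • 𝟙 P, by simp [Functor.map_smul]⟩
  | sup K₁ K₂ _ _ h₁ h₂ =>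
    intro h
    obtain ⟨A₁, hA₁, a₁, ha₁, hw₁⟩ := h₁ fun s hs => h s (Submodule.mem_sup_left hs)
    obtain ⟨A₂, hA₂, a₂, ha₂, hw₂⟩ := h₂ fun s hs => h s (Submodule.mem_sup_right hs)
    refine ⟨A₁ ⊞ A₂, .biprod hA₁ hA₂, G.map biprod.fst ≫ a₁ + G.map biprod.snd ≫ a₂,
      fun s hs => ?_, by simp [hw₁, hw₂]⟩
    obtain ⟨s₁, hs₁, s₂, hs₂, rfl⟩ := Submodule.mem_sup.1 hs
    obtain ⟨l₁, rfl⟩ := ha₁ s₁ hs₁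
    obtain ⟨l₂, rfl⟩ := ha₂ s₂ hs₂
    refine ⟨biprod.lift l₁ l₂, ?_⟩
    rw [Preadditive.comp_add, ← G.map_comp_assoc, ← G.map_comp_assoc, biprod.lift_fst,
      biprod.lift_snd]

variable {k}

theorem IsProgenerator.exists_epi {P : C} (hP : IsProgenerator k P) (X : C) :
    ∃ (A : C) (_ : IsFree P A) (a : A ⟶ X), Epi a := by
  obtain ⟨_, A, _, a, _, _, hA, ⟨h⟩⟩ := hP.presented X
  exact ⟨A, hA, a, epi_of_isCokernel h⟩

/-- A right exact `k`-linear functor on a category with a progenerator has a right adjoint as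
soon as the spaces `Hom(G P, Z)` are finite-dimensional. -/
theorem IsProgenerator.exists_universal [HasCokernels C] {P : C} (hP : IsProgenerator k P)
    (G : C ⥤ D) [G.Additive] [G.Linear k] (hG : PreservesCokernels G) (Z : D)
    [Module.Finite k (G.obj P ⟶ Z)] :
    ∃ (R : C) (v : G.obj R ⟶ Z), ∀ (X : C) (φ : G.obj X ⟶ Z), ∃! f : X ⟶ R, G.map f ≫ v = φ := by
  -- Generators: every `G P ⟶ Z` factors through `a` by the image of a map `P ⟶ A`. No vanishing
  -- condition is wanted here, so the auxiliary map is zero.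
  obtain ⟨A, hA, a, ha, -⟩ := exists_isFree_cover (k := k) G (𝟭 D) (P := P) (0 : Z ⟶ Z) ⊤
    Module.Finite.fg_top (by simp)
  have := hP.finite A
  let K : Submodule k (P ⟶ A) :=
    { carrier := {f | G.map f ≫ a = 0}
      add_mem' {f g} hf hg := by
        simp only [Set.mem_ofPred_eq] at hf hg ⊢
        rw [G.map_add, Preadditive.add_comp, hf, hg, add_zero]
      zero_mem' := by simp
      smul_mem' c f hf := by
        simp only [Set.mem_ofPred_eq] at hf ⊢
        rw [G.map_smul, Linear.smul_comp, hf, smul_zero] }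
  -- Relations: `b` covers the maps `P ⟶ A` that become zero after applying `G` and composing with
  -- `a`. The representing object is the cokernel of `b`.
  obtain ⟨A', hA', b, hb, hba⟩ := exists_isFree_cover (k := k) (𝟭 C) G (P := P) a K
    (IsNoetherian.noetherian K) (fun s hs => hs)
  replace hba : G.map b ≫ a = 0 := hba
  let b' : A' ⟶ A := b
  have hc := cokernelIsCokernel b'
  obtain ⟨hc'⟩ := hG (cokernel.condition b') hc
  obtain ⟨v, hv⟩ := exists_desc_of_isCokernel hc' a hba
  refine ⟨cokernel b', v, fun X => existsUnique_of_isFinitelyPresented G hG v (fun φ => ?_)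
    (hP.presented X)⟩
  obtain ⟨l, hl⟩ := ha φ trivial
  refine ⟨l ≫ cokernel.π b', by simp only [Functor.map_comp, Category.assoc, hv, hl],
    fun m hm => ?_⟩
  obtain ⟨m, rfl⟩ := hP.projective.lift (w := cokernel.condition b') hc m
  obtain ⟨l', hl'⟩ := hb (m - l) (show _ = _ by
    rw [Functor.map_comp, Category.assoc, hv] at hm
    rw [G.map_sub, Preadditive.sub_comp, hm, hl, sub_self])
  have h : l' ≫ b' = m - l := hl'
  rw [← sub_eq_zero, ← Preadditive.sub_comp, ← h, Category.assoc, cokernel.condition, comp_zero]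

end Linear

end Progenerator

/-! ### Finite categories are abelian with a progenerator -/

section FiniteModules

variable (k : Type u) [Field k] {R : Type u} [Ring R] [Algebra k R] [Module.Finite k R]

open scoped ModuleCat in
theorem finite_hom_fgModuleCat (V W : FGModuleCat.{u} R) : Module.Finite k (V ⟶ W) := by
  have : Module.Finite k V.obj := Module.Finite.trans R V.obj
  have : Module.Finite k W.obj := Module.Finite.trans R W.obj
  let φ : (V ⟶ W) →ₗ[k] (V.obj →ₗ[k] W.obj) :=
    { toFun f := f.hom.hom.restrictScalars k
      map_add' _ _ := rfl
      map_smul' _ _ := rfl }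
  refine Module.Finite.of_injective φ fun f g h => ?_
  ext x
  exact DFunLike.congr_fun h x

theorem fgModuleCat_surjective [IsNoetherianRing R] {V W : FGModuleCat.{u} R} (f : V ⟶ W)
    [Epi f] : Function.Surjective f.hom.hom :=
  (ModuleCat.epi_iff_surjective ((forget₂ (FGModuleCat R) (ModuleCat R)).map f)).1 inferInstance

theorem projective_fgModuleCat_of_self [IsNoetherianRing R] :
    Projective (FGModuleCat.of R R) where
  factors {V W} f e _ := by
    obtain ⟨x, hx⟩ := fgModuleCat_surjective e (f.hom.hom (1 : R))
    refine ⟨FGModuleCat.ofHom (V := R) (W := V) (LinearMap.toSpanSingleton R V x), ?_⟩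
    ext
    change e.hom.hom (LinearMap.toSpanSingleton R V x (1 : R)) = _
    simpa using hx

theorem isSeparator_fgModuleCat_of_self : IsSeparator (FGModuleCat.of R R) := by
  rw [isSeparator_def]
  intro V W f g h
  ext x
  have := congrArg (fun t => t.hom.hom (1 : R))
    (h (FGModuleCat.ofHom (V := R) (W := V) (LinearMap.toSpanSingleton R V x)))
  change f.hom.hom (LinearMap.toSpanSingleton R V x (1 : R)) =
    g.hom.hom (LinearMap.toSpanSingleton R V x (1 : R)) at this
  simpa using this

end FiniteModules

section FiniteCategory

variable (k : Type u) [Field k] {C : Type w} [Category.{v} C]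

/-- The equation of preadditive structures allows the given one to be replaced by the abelian one,
so that no second additive structure appears. -/
theorem IsFiniteCategory.exists_abelian [P : Preadditive C] [Linear k C]
    (h : IsFiniteCategory k C) : ∃ A : Abelian C, A.toPreadditive = P := by
  obtain ⟨A, _, _, _, e, _, _⟩ := h
  have : IsNoetherianRing Aᵐᵒᵖ := IsNoetherianRing.of_finite k _
  have : HasFiniteProducts C :=
    ⟨fun _ => Adjunction.hasLimitsOfShape_of_equivalence e.functor⟩
  exact ⟨abelianOfEquivalence e.functor, rfl⟩

variable {k}

/-- A free object through which all maps `P ⟶ X` factor has epimorphic map to `X`: its cokernel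
projection is killed by all maps from the separator. Covering the kernel in the same way gives the
relations. -/
theorem IsProgenerator.of_isSeparator [Abelian C] [Linear k C] {P : C} [Projective P]
    (hP : IsSeparator P) (h : ∀ X : C, Module.Finite k (P ⟶ X)) : IsProgenerator k P := by
  have epi (X : C) : ∃ (A : C) (_ : IsFree P A) (a : A ⟶ X), Epi a := by
    obtain ⟨A, hA, a, ha, -⟩ := exists_isFree_cover (k := k) (𝟭 C) (𝟭 C) (P := P) (0 : X ⟶ X) ⊤
      (h X).fg_top (by simp)
    let a' : A ⟶ X := a
    refine ⟨A, hA, a', Preadditive.epi_of_cokernel_zero ?_⟩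
    rw [isSeparator_def] at hP
    refine hP _ _ fun t => ?_
    obtain ⟨l, hl⟩ := ha t trivial
    have hl : l ≫ a' = t := hl
    rw [← hl, Category.assoc, cokernel.condition]
    simp
  refine ⟨⟨fun {X Y Z f π w} c g => ?_, fun {X Y Z f π w} c g hg => ?_⟩, fun X => ?_, h⟩
  · have := epi_of_isCokernel c
    exact ⟨Projective.factorThru g π, by simp⟩
  · have : (ShortComplex.mk f π w).Exact := ShortComplex.exact_of_g_is_cokernel _ c
    exact ⟨this.liftFromProjective g hg, this.liftFromProjective_comp g hg⟩
  · obtain ⟨A', hA', a', _⟩ := epi X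
    obtain ⟨A, hA, a, _⟩ := epi (kernel a')
    refine ⟨A, A', a ≫ kernel.ι a', a', by simp, hA, hA', nonempty_isCokernel _ _ _ ?_⟩
    intro W g hg
    rw [Category.assoc, ← comp_zero (f := a), cancel_epi] at hg
    exact ⟨_, (CokernelCofork.IsColimit.desc' (Abelian.epiIsCokernelOfKernel _
      (kernelIsKernel a')) g hg).2⟩

theorem IsFiniteCategory.exists_isProgenerator [Abelian C] [Linear k C]
    (h : IsFiniteCategory k C) : ∃ P : C, IsProgenerator k P ∧ Projective P ∧ IsSeparator P := by
  obtain ⟨A, _, _, _, e, _, _⟩ := h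
  have : IsNoetherianRing Aᵐᵒᵖ := IsNoetherianRing.of_finite k _
  let Q := FGModuleCat.of Aᵐᵒᵖ Aᵐᵒᵖ
  have hQ : IsSeparator (e.inverse.obj Q) := isSeparator_fgModuleCat_of_self.of_equivalence e.symm
  have : Projective (e.inverse.obj Q) :=
    (e.symm.map_projective_iff _).2 projective_fgModuleCat_of_self
  refine ⟨e.inverse.obj Q, .of_isSeparator hQ fun X => ?_, this, hQ⟩
  have := finite_hom_fgModuleCat k (e.functor.obj (e.inverse.obj Q)) (e.functor.obj X)
  exact Module.Finite.of_injective (e.functor.mapLinearMap k) e.functor.map_injective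

end FiniteCategory

/-! ### The functor `Hom(P, -)` to modules over `End P` -/

section HomFunctor

variable {k : Type u} [Field k] {C : Type w} [Category.{v} C] [Preadditive C] [Linear k C]
  {P : C}

attribute [local instance] moduleEndLeft

/-- Morphism spaces live in `Type v`, whereas a finite category requires an algebra in `Type u`.
Finite-dimensional spaces are quotients of `kⁿ` and can be moved there. -/
theorem small_of_finite (k : Type u) [Field k] (V : Type v) [AddCommGroup V] [Module k V]
    [Module.Finite k V] : Small.{u} V := by
  obtain ⟨n, f, hf⟩ := Module.Finite.exists_fin' k V
  exact small_of_surjective hf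

variable [Small.{u} (End P)]

/-- The action of (a small model of) the endomorphism ring of `P` on `Hom(P, X)`. -/
@[reducible]
def homModule (X : C) : Module (Shrink.{u} (End P))ᵐᵒᵖ (P ⟶ X) :=
  Module.compHom (P ⟶ X) (RingEquiv.op (Shrink.ringEquiv (End P))).toRingHom

attribute [local instance] homModule

theorem homModule_smul (X : C) (r : (Shrink.{u} (End P))ᵐᵒᵖ) (f : P ⟶ X) :
    r • f = (show P ⟶ P from Shrink.ringEquiv (End P) r.unop) ≫ f := rfl

instance (X : C) : IsScalarTower k (Shrink.{u} (End P))ᵐᵒᵖ (P ⟶ X) where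
  smul_assoc c r f := by
    rw [homModule_smul, homModule_smul, MulOpposite.unop_smul]
    have h : Shrink.ringEquiv (End P) (c • r.unop) = c • Shrink.ringEquiv (End P) r.unop :=
      map_smul (Shrink.algEquiv k (End P)) c r.unop
    rw [h]
    exact Linear.smul_comp ..

include k in
theorem finite_homModule (X : C) [Module.Finite k (P ⟶ X)] :
    Module.Finite (Shrink.{u} (End P))ᵐᵒᵖ (P ⟶ X) :=
  Module.Finite.of_restrictScalars_finite k _ _

/-- Postcomposition, as a linear map over the endomorphism ring. -/
@[simps]
def postcompLinearMap {X Y : C} (f : X ⟶ Y) : (P ⟶ X) →ₗ[(Shrink.{u} (End P))ᵐᵒᵖ] (P ⟶ Y) where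
  toFun g := g ≫ f
  map_add' g g' := Preadditive.add_comp ..
  map_smul' r g := by simp [homModule_smul]

variable (k)
variable [∀ X : C, Small.{u} (P ⟶ X)] [∀ X : C, Module.Finite k (P ⟶ X)]

include k in
theorem finite_shrink_homModule (X : C) :
    Module.Finite (Shrink.{u} (End P))ᵐᵒᵖ (Shrink.{u} (P ⟶ X)) :=
  have := finite_homModule (k := k) (P := P) X
  Module.Finite.equiv (Shrink.linearEquiv (Shrink.{u} (End P))ᵐᵒᵖ (P ⟶ X)).symm

variable (P) in
/-- The functor `Hom(P, -)` with values in the modules over the endomorphism ring of `P`. -/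
def homFunctor : C ⥤ FGModuleCat.{u} (Shrink.{u} (End P))ᵐᵒᵖ where
  obj X := @FGModuleCat.of _ _ (Shrink.{u} (P ⟶ X)) _ _ (finite_shrink_homModule k X)
  map {X Y} f := ObjectProperty.homMk (ModuleCat.ofHom
    ((Shrink.linearEquiv (Shrink.{u} (End P))ᵐᵒᵖ (P ⟶ Y)).symm.toLinearMap ∘ₗ
      postcompLinearMap f ∘ₗ (Shrink.linearEquiv (Shrink.{u} (End P))ᵐᵒᵖ (P ⟶ X)).toLinearMap))
  map_id X := by ext; simp
  map_comp f g := by ext; simp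

/-- The identification of the module `homFunctor k P X` with `Hom(P, X)`. -/
def homFunctorEquiv (X : C) : (P ⟶ X) ≃ₗ[(Shrink.{u} (End P))ᵐᵒᵖ] ((homFunctor k P).obj X).obj :=
  (Shrink.linearEquiv (Shrink.{u} (End P))ᵐᵒᵖ (P ⟶ X)).symm

theorem homFunctor_map_apply {X Y : C} (f : X ⟶ Y) (g : P ⟶ X) :
    ((homFunctor k P).map f).hom.hom (homFunctorEquiv k X g) = homFunctorEquiv k Y (g ≫ f) := by
  change (Shrink.linearEquiv (Shrink.{u} (End P))ᵐᵒᵖ (P ⟶ Y)).symm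
    ((Shrink.linearEquiv (Shrink.{u} (End P))ᵐᵒᵖ (P ⟶ X))
      ((Shrink.linearEquiv (Shrink.{u} (End P))ᵐᵒᵖ (P ⟶ X)).symm g) ≫ f) = _
  rw [LinearEquiv.apply_symm_apply]
  rfl

theorem homFunctor_hom_ext {X : C} {V : FGModuleCat.{u} (Shrink.{u} (End P))ᵐᵒᵖ}
    {f g : (homFunctor k P).obj X ⟶ V}
    (h : ∀ t, f.hom.hom (homFunctorEquiv k X t) = g.hom.hom (homFunctorEquiv k X t)) : f = g := by
  ext x
  obtain ⟨t, rfl⟩ := (homFunctorEquiv k X).surjective x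
  exact h t

omit [∀ X : C, Small.{u} (P ⟶ X)] in
theorem smul_id_homModule (g : P ⟶ P) :
    MulOpposite.op ((Shrink.ringEquiv (End P)).symm g) • 𝟙 P = g := by
  rw [homModule_smul, MulOpposite.unop_op, RingEquiv.apply_symm_apply, Category.comp_id]

theorem homFunctor_hom_ext_self {V : FGModuleCat.{u} (Shrink.{u} (End P))ᵐᵒᵖ}
    {f g : (homFunctor k P).obj P ⟶ V}
    (h : f.hom.hom (homFunctorEquiv k P (𝟙 P)) = g.hom.hom (homFunctorEquiv k P (𝟙 P))) :
    f = g := by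
  refine homFunctor_hom_ext k fun t => ?_
  rw [← smul_id_homModule t, map_smul, map_smul, map_smul, h]

/-- `Hom(P, P)` is free of rank one on the identity, so maps out of it are elements of the target.
-/
theorem bijective_toSpanSingleton_id : Function.Bijective (LinearMap.toSpanSingleton
    (Shrink.{u} (End P))ᵐᵒᵖ ((homFunctor k P).obj P).obj (homFunctorEquiv k P (𝟙 P))) := by
  constructor
  · intro r s h
    rw [LinearMap.toSpanSingleton_apply, LinearMap.toSpanSingleton_apply, ← map_smul, ← map_smul,
      (homFunctorEquiv k P).injective.eq_iff, homModule_smul, homModule_smul, Category.comp_id,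
      Category.comp_id] at h
    exact MulOpposite.unop_injective ((Shrink.ringEquiv (End P)).injective h)
  · intro x
    obtain ⟨g, rfl⟩ := (homFunctorEquiv k P).surjective x
    exact ⟨_, by rw [LinearMap.toSpanSingleton_apply, ← map_smul, smul_id_homModule]⟩

theorem exists_homFunctor_hom {V : FGModuleCat.{u} (Shrink.{u} (End P))ᵐᵒᵖ} (x : V.obj) :
    ∃ f : (homFunctor k P).obj P ⟶ V, f.hom.hom (homFunctorEquiv k P (𝟙 P)) = x := by
  let b := LinearEquiv.ofBijective _ (bijective_toSpanSingleton_id (P := P) k)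
  refine ⟨ObjectProperty.homMk (ModuleCat.ofHom
    (LinearMap.toSpanSingleton _ V.obj x ∘ₗ b.symm.toLinearMap)), ?_⟩
  have h : b.symm (homFunctorEquiv k P (𝟙 P)) = 1 := by
    rw [LinearEquiv.symm_apply_eq]
    exact (one_smul (Shrink.{u} (End P))ᵐᵒᵖ _).symm
  change LinearMap.toSpanSingleton _ V.obj x (b.symm (homFunctorEquiv k P (𝟙 P))) = x
  rw [h, LinearMap.toSpanSingleton_apply, one_smul]

instance : (homFunctor k P).Additive where
  map_add {X Y f g} := homFunctor_hom_ext k fun t => by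
    rw [homFunctor_map_apply, Preadditive.comp_add, map_add, ← homFunctor_map_apply,
      ← homFunctor_map_apply]
    rfl

open scoped ModuleCat in
instance : (homFunctor k P).Linear k where
  map_smul {X Y} f c := homFunctor_hom_ext k fun t => by
    rw [homFunctor_map_apply, Linear.comp_smul]
    change _ = c • ((homFunctor k P).map f).hom.hom (homFunctorEquiv k X t)
    rw [homFunctor_map_apply, ← algebraMap_smul (Shrink.{u} (End P))ᵐᵒᵖ c (t ≫ f), map_smul]
    rfl

/-- Cokernel projectivity says that `Hom(P, π)` is surjective with kernel the image of `Hom(P, f)`,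
so its target is the quotient module. -/
theorem IsCokernelProjective.preservesCokernels_homFunctor
    (hP : IsCokernelProjective P) : PreservesCokernels (homFunctor k P) := by
  intro X Y Z f π w h
  have surj : Function.Surjective ((homFunctor k P).map π).hom.hom := fun z => by
    obtain ⟨z, rfl⟩ := (homFunctorEquiv k Z).surjective z
    obtain ⟨l, hl⟩ := hP.lift h z
    exact ⟨homFunctorEquiv k Y l, by rw [homFunctor_map_apply, hl]⟩
  have : Epi ((homFunctor k P).map π) := ⟨fun a b hab => by
    ext z
    obtain ⟨y, rfl⟩ := surj z
    exact congrArg (fun t => t.hom.hom y) hab⟩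
  refine nonempty_isCokernel _ _ _ fun {V} g hg => ?_
  have ker : LinearMap.ker ((homFunctor k P).map π).hom.hom ≤ LinearMap.ker g.hom.hom := by
    intro y hy
    obtain ⟨y, rfl⟩ := (homFunctorEquiv k Y).surjective y
    rw [LinearMap.mem_ker, homFunctor_map_apply, LinearEquiv.map_eq_zero_iff] at hy
    obtain ⟨l, rfl⟩ := hP.exact h y hy
    rw [LinearMap.mem_ker, ← homFunctor_map_apply]
    exact congrArg (fun t => t.hom.hom (homFunctorEquiv k X l)) hg
  let q := LinearMap.quotKerEquivOfSurjective _ surj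
  refine ⟨ObjectProperty.homMk (ModuleCat.ofHom
    (Submodule.liftQ _ _ ker ∘ₗ q.symm.toLinearMap)), ?_⟩
  ext y
  change Submodule.liftQ _ _ ker (q.symm (((homFunctor k P).map π).hom.hom y)) = _
  have : q.symm (((homFunctor k P).map π).hom.hom y) = Submodule.Quotient.mk y := by
    rw [LinearEquiv.symm_apply_eq]
    rfl
  rw [this, Submodule.liftQ_apply]

end HomFunctor

/-- A category with a progenerator is a finite category. -/
theorem IsProgenerator.isFiniteCategory {k : Type u} [Field k] {C : Type w} [Category.{v} C]
    [Preadditive C] [Linear k C] [HasBinaryBiproducts C] [HasCokernels C] {P : C}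
    (hP : IsProgenerator k P) : IsFiniteCategory k C := by
  have := hP.finite
  have (X : C) : Small.{u} (P ⟶ X) := small_of_finite k _
  have : Small.{u} (End P) := this P
  have : Module.Finite k (Shrink.{u} (End P)) :=
    have : Module.Finite k (End P) := hP.finite P
    Module.Finite.equiv (Shrink.linearEquiv k (End P)).symm
  have hc := hP.projective.preservesCokernels_homFunctor k
  -- Full faithfulness: presentations reduce the source to `P`, where a map out of `Hom(P, P)` is
  -- its value at the identity.
  have key (X Y : C) (φ : (homFunctor k P).obj X ⟶ (homFunctor k P).obj Y) :=
    existsUnique_of_isFinitelyPresented (homFunctor k P) hc (𝟙 ((homFunctor k P).obj Y))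
      (fun ψ => ⟨(homFunctorEquiv k Y).symm (ψ.hom.hom (homFunctorEquiv k P (𝟙 P))),
        homFunctor_hom_ext_self k (by
          rw [Category.comp_id, homFunctor_map_apply, Category.id_comp,
            LinearEquiv.apply_symm_apply]),
        fun f hf => by
          rw [← hf, Category.comp_id, homFunctor_map_apply, Category.id_comp,
            LinearEquiv.symm_apply_apply]⟩) (hP.presented X) φ
  have : (homFunctor k P).Full := ⟨fun {X Y} φ => by
    obtain ⟨f, hf, -⟩ := key X Y φ
    exact ⟨f, by simpa using hf⟩⟩
  have : (homFunctor k P).Faithful := ⟨fun {X Y f g} h =>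
    (key X Y ((homFunctor k P).map f)).unique (by simp) (by simp [h])⟩
  -- The universal arrow `Hom(P, R) ⟶ V` is bijective, since its universal property at `P` compares
  -- the elements of `Hom(P, R)` with those of `V`.
  have : (homFunctor k P).EssSurj := ⟨fun V => by
    have := finite_hom_fgModuleCat k ((homFunctor k P).obj P) V
    obtain ⟨R, v, hv⟩ := hP.exists_universal (homFunctor k P) hc V
    have bij : Function.Bijective v.hom.hom := by
      constructor
      · rw [← LinearMap.ker_eq_bot, LinearMap.ker_eq_bot']
        intro x hx
        obtain ⟨x, rfl⟩ := (homFunctorEquiv k R).surjective x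
        rw [LinearEquiv.map_eq_zero_iff]
        refine (hv P 0).unique (homFunctor_hom_ext_self k ?_) (by simp)
        change v.hom.hom (((homFunctor k P).map x).hom.hom _) = 0
        rw [homFunctor_map_apply, Category.id_comp, hx]
      · intro x
        obtain ⟨φ, rfl⟩ := exists_homFunctor_hom k x
        obtain ⟨f, rfl, -⟩ := hv P φ
        exact ⟨homFunctorEquiv k R f, by
          rw [← Category.id_comp f, ← homFunctor_map_apply, Category.id_comp]
          rfl⟩
    exact ⟨R, ⟨(LinearEquiv.ofBijective _ bij).toFGModuleCatIso⟩⟩⟩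
  have : (homFunctor k P).IsEquivalence := {}
  exact ⟨Shrink.{u} (End P), inferInstance, inferInstance, inferInstance,
    (homFunctor k P).asEquivalence, inferInstanceAs (homFunctor k P).Additive,
    inferInstanceAs ((homFunctor k P).Linear k)⟩

/-! ### Jordan–Hölder theory and length -/

section JordanHolder

variable {T : Type w} [Category.{v} T] [Abelian T]

theorem HasCompositionFactors.of_iso {a b : T} {l : List T} (h : HasCompositionFactors a l)
    (e : a ≅ b) : HasCompositionFactors b l := by
  cases h with
  | nil ha => exact .nil (ha.of_iso e.symm)
  | @cons S l hS hs h =>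
    let S' : ShortComplex T := ShortComplex.mk (S.f ≫ e.hom) (e.inv ≫ S.g) (by simp)
    let i : S ≅ S' := ShortComplex.isoMk (Iso.refl _) e (Iso.refl _)
    exact HasCompositionFactors.cons (S := S') (ShortComplex.shortExact_of_iso i hS) hs h

/-- The pullback of a short exact sequence along a quotient of its third term. -/
theorem shortExact_kernel_comp {S : ShortComplex T} (hS : S.ShortExact) {Z : T} (p : S.X₃ ⟶ Z)
    [Epi p] : ∃ (i : S.X₁ ⟶ kernel (S.g ≫ p)) (r : kernel (S.g ≫ p) ⟶ kernel p) (w : i ≫ r = 0),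
      (ShortComplex.mk i r w).ShortExact := by
  have := hS.mono_f
  have := hS.epi_g
  let i : S.X₁ ⟶ kernel (S.g ≫ p) := kernel.lift _ S.f (by simp)
  let r : kernel (S.g ≫ p) ⟶ kernel p := kernel.lift _ (kernel.ι _ ≫ S.g) (by simp)
  have hr : IsPullback r (kernel.ι (S.g ≫ p)) (kernel.ι p) S.g := by
    refine ⟨⟨by simp [r]⟩, ⟨PullbackCone.IsLimit.mk _
      (fun s => kernel.lift _ s.snd ?_) ?_ ?_ ?_⟩⟩
    · rw [← Category.assoc, ← s.condition]; simp
    · intro s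
      rw [← cancel_mono (kernel.ι p)]
      simp [r, s.condition]
    · intro s; simp
    · intro s m _ h
      rw [← cancel_mono (kernel.ι (S.g ≫ p))]
      simp [h]
  have : Epi r := by
    have := hr.isoPullback_hom_fst
    rw [← this]
    infer_instance
  have : Mono (i ≫ kernel.ι (S.g ≫ p)) := by simpa [i] using hS.mono_f
  have hi : Mono i := mono_of_mono i (kernel.ι (S.g ≫ p))
  have w : i ≫ r = 0 := by rw [← cancel_mono (kernel.ι p)]; simp [i, r]
  refine ⟨i, r, w, ⟨ShortComplex.exact_of_f_is_kernel _ (KernelFork.IsLimit.ofι _ _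
    (fun g hg => hS.exact.lift (g ≫ kernel.ι _) ?_) ?_ ?_)⟩⟩
  · simpa [r] using hg =≫ kernel.ι p
  · intro W g hg
    rw [← cancel_mono (kernel.ι (S.g ≫ p))]
    simp [i]
  · intro W g hg m hm
    rw [← cancel_mono i, hm, ← cancel_mono (kernel.ι (S.g ≫ p))]
    simp [i]

theorem shortExact_kernel {X Y : T} (p : X ⟶ Y) [Epi p] :
    (ShortComplex.mk (kernel.ι p) p (by simp)).ShortExact :=
  { exact := ShortComplex.exact_of_f_is_kernel _ (kernelIsKernel p) }

theorem shortExact_cokernel {X Y : T} (i : X ⟶ Y) [Mono i] :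
    (ShortComplex.mk i (cokernel.π i) (by simp)).ShortExact :=
  { exact := ShortComplex.exact_of_g_is_cokernel _ (cokernelIsCokernel i) }

theorem ShortExact.isoKernel {S : ShortComplex T} (hS : S.ShortExact) :
    Nonempty (S.X₁ ≅ kernel S.g) :=
  have := hS.mono_f
  ⟨IsLimit.conePointUniqueUpToIso (t := KernelFork.ofι (kernel.ι S.g) (kernel.condition _))
    hS.fIsKernel (kernelIsKernel S.g)⟩

/-- Induction on the series of the quotient. The kernel of the map onto its top factor is an
extension of the next term of that series by `S.X₁`; allowing `S.X₃` up to isomorphism lets the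
induction apply to it. -/
theorem HasCompositionFactors.append {c : T} {l₃ : List T} (h₃ : HasCompositionFactors c l₃) :
    ∀ {S : ShortComplex T} (_ : S.ShortExact) (_ : S.X₃ ≅ c) {l₁ : List T},
      HasCompositionFactors S.X₁ l₁ → HasCompositionFactors S.X₂ (l₃ ++ l₁) := by
  induction h₃ with
  | nil hc =>
    intro S hS e l₁ h₁
    have := hS.isIso_f_iff.2 (hc.of_iso e)
    exact h₁.of_iso (asIso S.f)
  | @cons S' l hS' hs h ih =>
    intro S hS e l₁ h₁
    have := hS'.epi_g
    obtain ⟨i, r, w, hr⟩ := shortExact_kernel_comp hS (e.hom ≫ S'.g)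
    obtain ⟨j⟩ := ShortExact.isoKernel hS'
    have h' := ih hr (kernelIsIsoComp e.hom S'.g ≪≫ j.symm) h₁
    have := hS.epi_g
    exact HasCompositionFactors.cons (S := ShortComplex.mk (kernel.ι (S.g ≫ e.hom ≫ S'.g))
      (S.g ≫ e.hom ≫ S'.g) (by simp)) (shortExact_kernel _) hs h'

/-- A property of being determined up to isomorphism. -/
def IsoInvariant {α : Type*} (φ : T → α) : Prop := ∀ ⦃a b : T⦄, (a ≅ b) → φ a = φ b

theorem HasCompositionFactors.exists_of_cons {a q : T} {l : List T}
    (h : HasCompositionFactors a (q :: l)) : ∃ (b : T) (f : b ⟶ a) (g : a ⟶ q) (w : f ≫ g = 0),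
      (ShortComplex.mk f g w).ShortExact ∧ Simple q ∧ HasCompositionFactors b l := by
  cases h with
  | @cons S _ hS hs h => exact ⟨S.X₁, S.f, S.g, S.zero, hS, hs, h⟩

theorem HasCompositionFactors.isZero {a : T} (h : HasCompositionFactors a []) : IsZero a := by
  cases h with
  | nil ha => exact ha

theorem HasCompositionFactors.eq_nil {a : T} {l : List T} (h : HasCompositionFactors a l)
    (ha : IsZero a) : l = [] := by
  cases h with
  | nil => rfl
  | cons hS hs h =>
    have := hS.epi_g
    exact (Simple.not_isZero _ (IsZero.of_epi (ShortComplex.g _) ha)).elim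

/-- The Jordan–Hölder theorem, for a category in which all objects have finite length. -/
theorem HasCompositionFactors.sum_eq (hT : ∀ a : T, ∃ l, HasCompositionFactors a l) (n : ℕ) :
    ∀ {a : T} {l l' : List T}, HasCompositionFactors a l → HasCompositionFactors a l' →
      l.length = n → ∀ φ : T → ℕ∞, IsoInvariant φ → (l.map φ).sum = (l'.map φ).sum := by
  induction n with
  | zero =>
    intro a l l' h h' hl φ hφ
    obtain rfl := List.length_eq_zero_iff.1 hl
    rw [h'.eq_nil h.isZero]
  | succ n ih =>
    intro a l l' h h' hl φ hφ
    obtain _ | ⟨Y₃, m⟩ := l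
    · simp at hl
    obtain _ | ⟨Z₃, m'⟩ := l'
    · simp at hl
      exact absurd (h.eq_nil h'.isZero) (by simp)
    obtain ⟨Y₁, f, g, w, hS, hs, hm⟩ := h.exists_of_cons
    obtain ⟨Z₁, f', g', w', hS', hs', hm'⟩ := h'.exists_of_cons
    have hn : m.length = n := by simpa using hl
    have := hS.mono_f
    have := hS'.mono_f
    have := hS.epi_g
    have := hS'.epi_g
    dsimp only at *
    -- If `Y₁` maps to zero in `Z₃`, the maximal subobjects `Y₁` and `Z₁` coincide. Otherwise both
    -- series are compared through their intersection, `kernel (f ≫ g')`.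
    by_cases hz : f ≫ g' = 0
    · obtain ⟨t, ht⟩ := CokernelCofork.IsColimit.desc' hS.gIsCokernel g' hz
      dsimp at t ht
      have ht0 : t ≠ 0 := by
        rintro rfl
        rw [comp_zero] at ht
        exact Simple.not_isZero Z₃ (IsZero.of_epi_eq_zero g' ht.symm)
      have := isIso_of_hom_simple ht0
      have e : Z₁ ≅ Y₁ := hS'.fIsKernel.conePointUniqueUpToIso
        (IsLimit.ofIsoLimit (isKernelCompMono hS.fIsKernel t ht.symm) (Fork.ext (Iso.refl _)))
      rw [List.map_cons, List.map_cons, List.sum_cons, List.sum_cons, hφ (asIso t),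
        ih hm (hm'.of_iso e) hn φ hφ]
    · have : Epi (f ≫ g') := epi_of_nonzero_to_simple hz
      have hz' : f' ≫ g ≠ 0 := by
        intro h0
        obtain ⟨t, ht⟩ := CokernelCofork.IsColimit.desc' hS'.gIsCokernel g h0
        dsimp at t ht
        have ht0 : t ≠ 0 := by
          rintro rfl
          rw [comp_zero] at ht
          exact Simple.not_isZero Y₃ (IsZero.of_epi_eq_zero g ht.symm)
        have := isIso_of_hom_simple ht0
        exact hz (by rw [← cancel_mono t, Category.assoc, ht, w, zero_comp])
      have : Epi (f' ≫ g) := epi_of_nonzero_to_simple hz'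
      obtain ⟨q, hq⟩ := hT (kernel (f ≫ g'))
      have h1 : HasCompositionFactors Y₁ (Z₃ :: q) :=
        .cons (S := ShortComplex.mk _ (f ≫ g') (kernel.condition _)) (shortExact_kernel _) hs' hq
      -- The intersection is also the kernel of `Z₁ ⟶ Y₃`, so the factors `q` extend to series of
      -- both `Y₁` and `Z₁`.
      let j : kernel (f ≫ g') ⟶ Z₁ := hS'.exact.lift (kernel.ι (f ≫ g') ≫ f) (by simp)
      have hj : j ≫ f' = kernel.ι (f ≫ g') ≫ f := hS'.exact.lift_f _ _
      have : Mono (j ≫ f') := by rw [hj]; infer_instance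
      have : Mono j := mono_of_mono j f'
      have jw : j ≫ f' ≫ g = 0 := by rw [reassoc_of% hj, w, comp_zero]
      have hjk : (ShortComplex.mk j (f' ≫ g) jw).ShortExact :=
        { exact := ShortComplex.exact_of_f_is_kernel _ (KernelFork.IsLimit.ofι _ _
            (fun {W} x hx => kernel.lift (f ≫ g') (hS.exact.lift (x ≫ f') (by simpa using hx)) (by
              have := hS.exact.lift_f (x ≫ f') (by simpa using hx)
              dsimp at this
              rw [reassoc_of% this, w', comp_zero]))
            (fun {W} x hx => by
              rw [← cancel_mono f', Category.assoc, hj, kernel.lift_ι_assoc]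
              exact hS.exact.lift_f _ _)
            (fun {W} x hx y hy => by
              rw [← cancel_mono j, hy, ← cancel_mono f', Category.assoc, hj, kernel.lift_ι_assoc]
              exact (hS.exact.lift_f _ _).symm)) }
      have h2 : HasCompositionFactors Z₁ (Y₃ :: q) := .cons hjk hs hq
      have e1 := ih hm h1 hn
      -- Constant weight 1 compares lengths, which brings the series of `Z₁` within reach of the
      -- induction hypothesis.
      have e2 : q.length + 1 = n := by
        have := e1 (fun _ => 1) (fun _ _ _ => rfl)
        simp only [List.map_const', List.sum_replicate, List.length_cons, nsmul_eq_mul,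
          mul_one] at this
        rw [← hn]
        exact_mod_cast this.symm
      have e3 := ih h2 hm' (by simpa using e2) φ hφ
      rw [List.map_cons, List.map_cons, List.sum_cons, List.sum_cons, e1 φ hφ, ← e3]
      simp only [List.map_cons, List.sum_cons]
      rw [← add_assoc, ← add_assoc, add_comm (φ Y₃)]

variable (T) in
/-- All objects of `T` have finite length. -/
def IsFiniteLength : Prop := ∀ a : T, ∃ l, HasCompositionFactors a l

section Weight

variable (hT : IsFiniteLength T)

/-- The sum of the values of `φ` on the composition factors of an object. -/
def weight (φ : T → ℕ∞) (a : T) : ℕ∞ := ((hT a).choose.map φ).sum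

variable {φ ψ : T → ℕ∞} (hφ : IsoInvariant φ)

include hφ in
theorem weight_eq {a : T} {l : List T} (h : HasCompositionFactors a l) :
    weight hT φ a = (l.map φ).sum :=
  HasCompositionFactors.sum_eq hT _ (hT a).choose_spec h rfl φ hφ

include hφ in
theorem weight_shortExact {S : ShortComplex T} (hS : S.ShortExact) :
    weight hT φ S.X₂ = weight hT φ S.X₁ + weight hT φ S.X₃ := by
  obtain ⟨l₁, h₁⟩ := hT S.X₁
  obtain ⟨l₃, h₃⟩ := hT S.X₃
  rw [weight_eq hT hφ h₁, weight_eq hT hφ h₃, weight_eq hT hφ (h₃.append hS (Iso.refl _) h₁),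
    List.map_append, List.sum_append, add_comm]

include hT in
theorem length_eq {a : T} {l : List T} (h : HasCompositionFactors a l) :
    length a = l.length := by
  refine le_antisymm (iInf₂_le l h) (le_iInf₂ fun l' h' => ?_)
  have := HasCompositionFactors.sum_eq hT _ h h' rfl (fun _ => 1) (fun _ _ _ => rfl)
  simp only [List.map_const', List.sum_replicate, nsmul_eq_mul, mul_one] at this
  exact this.le

include hT in
theorem length_shortExact {S : ShortComplex T} (hS : S.ShortExact) :
    length S.X₂ = length S.X₁ + length S.X₃ := by
  obtain ⟨l₁, h₁⟩ := hT S.X₁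
  obtain ⟨l₃, h₃⟩ := hT S.X₃
  rw [length_eq hT h₁, length_eq hT h₃, length_eq hT (h₃.append hS (Iso.refl _) h₁),
    List.length_append, add_comm, Nat.cast_add]

theorem length_isoInvariant : IsoInvariant (length (T := T)) := fun a b e => by
  apply le_antisymm
  · exact le_iInf₂ fun l h => iInf₂_le l (h.of_iso e.symm)
  · exact le_iInf₂ fun l h => iInf₂_le l (h.of_iso e)

include hT in
theorem length_ne_top (a : T) : length a ≠ ⊤ := by
  obtain ⟨l, h⟩ := hT a
  rw [length_eq hT h]
  exact ENat.natCast_ne_top _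

include hT in
theorem isZero_of_length_eq_zero {a : T} (h : length a = 0) : IsZero a := by
  obtain ⟨l, hl⟩ := hT a
  rw [length_eq hT hl, Nat.cast_eq_zero, List.length_eq_zero_iff] at h
  subst h
  exact hl.isZero

include hφ in
theorem weight_of_isZero {a : T} (ha : IsZero a) : weight hT φ a = 0 := by
  rw [weight_eq hT hφ (.nil ha)]; rfl

end Weight

/-- The split short exact sequence `∐ l ⟶ ∐ (q :: l) ⟶ q`. -/
theorem exists_splitting_sigma_cons (q : T) (l : List T) :
    ∃ (i : ∐ l.get ⟶ ∐ (q :: l).get) (p : ∐ (q :: l).get ⟶ q) (w : i ≫ p = 0),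
      Nonempty (ShortComplex.mk i p w).Splitting := by
  let i : ∐ l.get ⟶ ∐ (q :: l).get := Sigma.desc fun j => Sigma.ι (q :: l).get j.succ
  let p : ∐ (q :: l).get ⟶ q := Sigma.desc (Fin.cases (𝟙 q) fun _ => 0)
  let r : ∐ (q :: l).get ⟶ ∐ l.get := Sigma.desc (Fin.cases 0 fun j => Sigma.ι l.get j)
  let s : q ⟶ ∐ (q :: l).get := Sigma.ι (q :: l).get (0 : Fin (l.length + 1))
  have hp0 : s ≫ p = 𝟙 q := Sigma.ι_desc _ _
  have hpj (j : Fin l.length) : Sigma.ι (q :: l).get j.succ ≫ p = 0 := Sigma.ι_desc _ _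
  have hr0 : s ≫ r = 0 := Sigma.ι_desc _ _
  have hrj (j : Fin l.length) : Sigma.ι (q :: l).get j.succ ≫ r = Sigma.ι l.get j :=
    Sigma.ι_desc _ _
  have hij (j : Fin l.length) : Sigma.ι l.get j ≫ i = Sigma.ι (q :: l).get j.succ :=
    Sigma.ι_desc _ _
  have w : i ≫ p = 0 := Sigma.hom_ext _ _ fun j => by rw [reassoc_of% (hij j), hpj, comp_zero]
  refine ⟨i, p, w, ⟨⟨r, s, ?_, hp0, ?_⟩⟩⟩
  · exact Sigma.hom_ext _ _ fun j => by
      dsimp only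
      rw [reassoc_of% (hij j), hrj, Category.comp_id]
  · refine Sigma.hom_ext _ _ (Fin.cases ?_ fun j => ?_)
    · change s ≫ (r ≫ i + p ≫ s) = s ≫ 𝟙 _
      rw [Preadditive.comp_add, reassoc_of% hr0, reassoc_of% hp0]
      simp
    · change Sigma.ι (q :: l).get j.succ ≫ (r ≫ i + p ≫ s) = Sigma.ι (q :: l).get j.succ ≫ 𝟙 _
      rw [Preadditive.comp_add, reassoc_of% (hrj j), reassoc_of% (hpj j), hij]
      simp

theorem isZero_sigma_nil : IsZero (∐ ([] : List T).get) := by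
  rw [IsZero.iff_id_eq_zero]
  exact Sigma.hom_ext _ _ fun j => j.elim0

/-- A function which is additive on split exact sequences. -/
theorem sum_eq_of_splitting {ψ : T → ℕ∞} (h0 : ∀ a : T, IsZero a → ψ a = 0)
    (hadd : ∀ S : ShortComplex T, Nonempty S.Splitting → ψ S.X₂ = ψ S.X₁ + ψ S.X₃) (l : List T) :
    ψ (∐ l.get) = (l.map ψ).sum := by
  induction l with
  | nil => simpa using h0 _ isZero_sigma_nil
  | cons q l ih =>
    obtain ⟨i, p, w, h⟩ := exists_splitting_sigma_cons q l
    rw [List.map_cons, List.sum_cons, ← ih, hadd _ h, add_comm]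

theorem hasCompositionFactors_sigma {l : List T} (hl : ∀ q ∈ l, Simple q) :
    HasCompositionFactors (∐ l.get) l := by
  induction l with
  | nil => exact .nil isZero_sigma_nil
  | cons q l ih =>
    obtain ⟨i, p, w, ⟨h⟩⟩ := exists_splitting_sigma_cons q l
    exact .cons (S := ShortComplex.mk i p w) h.shortExact (hl q (by simp))
      (ih fun r hr => hl r (by simp [hr]))

theorem exists_shortExact_of_not_simple {a : T} (ha : ¬ IsZero a) (hs : ¬ Simple a) :
    ∃ S : ShortComplex T, S.ShortExact ∧ S.X₂ = a ∧ ¬ IsZero S.X₁ ∧ ¬ IsZero S.X₃ := by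
  by_contra! h
  refine hs ⟨fun {Y} f _ => ⟨fun hf hf0 => ?_, fun hf => ?_⟩⟩
  · subst hf0
    exact ha (IsZero.of_epi_eq_zero (0 : Y ⟶ a) rfl)
  · have := h _ (shortExact_cokernel f) rfl (fun hY => hf (hY.eq_of_src _ _))
    have : Epi f := Preadditive.epi_of_cokernel_zero (this.eq_of_tgt _ _)
    exact isIso_of_mono_of_epi f

/-- Objects of a finite category have finite length. -/
theorem IsProgenerator.isFiniteLength {k : Type u} [Field k] [Linear k T] {P : T}
    (hP : IsProgenerator k P) : IsFiniteLength T := by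
  have hfin := hP.finite
  -- The dimension of `Hom(P, -)` is additive on short exact sequences and positive on nonzero
  -- objects; it serves as the induction measure.
  have hdim {S : ShortComplex T} (hS : S.ShortExact) : Module.finrank k (P ⟶ S.X₂) =
      Module.finrank k (P ⟶ S.X₁) + Module.finrank k (P ⟶ S.X₃) := by
    have := hS.mono_f
    let α : (P ⟶ S.X₁) →ₗ[k] (P ⟶ S.X₂) := Linear.rightComp k P S.f
    let β : (P ⟶ S.X₂) →ₗ[k] (P ⟶ S.X₃) := Linear.rightComp k P S.g
    have hα : Function.Injective α := fun x y h => (cancel_mono S.f).1 h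
    have hβ : Function.Surjective β := fun x => hP.projective.lift hS.gIsCokernel x
    have hr : LinearMap.ker β = LinearMap.range α := by
      ext x
      refine ⟨fun hx => hP.projective.exact hS.gIsCokernel x hx, ?_⟩
      rintro ⟨y, rfl⟩
      change (y ≫ S.f) ≫ S.g = 0
      simp
    rw [← LinearMap.finrank_range_add_finrank_ker β, hr, LinearMap.finrank_range_of_inj hα,
      LinearMap.range_eq_top.2 hβ, finrank_top, add_comm]
  have hpos {a : T} (ha : ¬ IsZero a) : 0 < Module.finrank k (P ⟶ a) := by
    rw [Module.finrank_pos_iff, nontrivial_iff_exists_ne (0 : P ⟶ a)]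
    by_contra! h
    obtain ⟨_, A', f, π, w, _, hA', ⟨hπ⟩⟩ := hP.presented a
    have := epi_of_isCokernel hπ
    have (X : T) (hX : IsFree P X) : ∀ g : X ⟶ a, g = 0 := by
      induction hX with
      | zero hX => exact fun _ => hX.eq_of_src _ _
      | self => exact h
      | biprod _ _ h h' => exact fun g => by ext <;> simp [h, h']
    exact ha (IsZero.of_epi_eq_zero π (this _ hA' _))
  suffices ∀ (n : ℕ) (a : T), Module.finrank k (P ⟶ a) < n → ∃ l, HasCompositionFactors a l from
    fun a => this _ a (Nat.lt_succ_self _)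
  intro n
  induction n with
  | zero => simp
  | succ n ih =>
    intro a ha
    by_cases h0 : IsZero a
    · exact ⟨[], .nil h0⟩
    by_cases hs : Simple a
    · exact ⟨[a], .cons (S := ShortComplex.mk (kernel.ι (𝟙 a)) (𝟙 a) (kernel.condition _))
        (shortExact_kernel _) hs (.nil ((isZero_kernel_of_mono _)))⟩
    · obtain ⟨S, hS, rfl, h1, h3⟩ := exists_shortExact_of_not_simple h0 hs
      have := hdim hS
      have := hpos h1
      have := hpos h3
      obtain ⟨l₁, hl₁⟩ := ih S.X₁ (by omega)
      obtain ⟨l₃, hl₃⟩ := ih S.X₃ (by omega)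
      exact ⟨_, hl₃.append hS (Iso.refl _) hl₁⟩

end JordanHolder

/-! ### Contravariant adjunctions and when they are equivalences -/

/-- A pair of contravariant functors `D`, `D'` which are adjoint on the right:
`Hom(a, D x) ≃ Hom(x, D' a)`. Functoriality follows from naturality. -/
structure DualityPair (T : Type w) [Category.{v} T] where
  D : T → T
  D' : T → T
  map {x y : T} : (x ⟶ y) → (D y ⟶ D x)
  map' {x y : T} : (x ⟶ y) → (D' y ⟶ D' x)
  e (a x : T) : (a ⟶ D x) ≃ (x ⟶ D' a)
  e_comp {a' a x : T} (g : a' ⟶ a) (f : a ⟶ D x) : e a' x (g ≫ f) = e a x f ≫ map' g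
  e_map {a x' x : T} (h : x' ⟶ x) (f : a ⟶ D x) : e a x' (f ≫ map h) = h ≫ e a x f

namespace DualityPair

variable {T : Type w} [Category.{v} T] (A : DualityPair T)

/-- The pair with the functors interchanged. -/
def symm : DualityPair T where
  D := A.D'
  D' := A.D
  map := A.map'
  map' := A.map
  e x a := (A.e a x).symm
  e_comp h f := by rw [Equiv.symm_apply_eq, A.e_map, Equiv.apply_symm_apply]
  e_map g f := by rw [Equiv.symm_apply_eq, A.e_comp, Equiv.apply_symm_apply]

/-- The unit `x ⟶ D' D x`. -/
def unit (x : T) : x ⟶ A.D' (A.D x) := A.e _ _ (𝟙 _)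

theorem e_eq {a x : T} (f : a ⟶ A.D x) : A.e a x f = A.unit x ≫ A.map' f := by
  rw [unit, ← A.e_comp, Category.comp_id]

theorem e_map_id {x y : T} (h : x ⟶ y) : A.e _ _ (A.map h) = h ≫ A.unit y := by
  rw [unit, ← A.e_map, Category.id_comp]

theorem map_id (x : T) : A.map (𝟙 x) = 𝟙 _ := (A.e _ _).injective (by
  rw [e_map_id, Category.id_comp]; rfl)

theorem map_comp {x y z : T} (f : x ⟶ y) (g : y ⟶ z) : A.map (f ≫ g) = A.map g ≫ A.map f :=
  (A.e _ _).injective (by rw [e_map_id, e_map, e_map_id, Category.assoc])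

theorem unit_naturality {x y : T} (f : x ⟶ y) :
    f ≫ A.unit y = A.unit x ≫ A.map' (A.map f) := by
  rw [← e_map_id, e_eq]

/-- The unit `a ⟶ D D' a`. -/
def counit (a : T) : a ⟶ A.D (A.D' a) := (A.e _ _).symm (𝟙 _)

theorem counit_naturality {x y : T} (f : x ⟶ y) :
    f ≫ A.counit y = A.counit x ≫ A.map (A.map' f) :=
  A.symm.unit_naturality f

theorem counit_map_unit (x : T) : A.counit (A.D x) ≫ A.map (A.unit x) = 𝟙 _ := by
  apply (A.e _ _).injective
  rw [A.e_map, counit, Equiv.apply_symm_apply, Category.comp_id, unit]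

theorem map'_comp {x y z : T} (f : x ⟶ y) (g : y ⟶ z) : A.map' (f ≫ g) = A.map' g ≫ A.map' f :=
  A.symm.map_comp f g

theorem map_injective {x y : T} [Mono (A.unit y)] {f g : x ⟶ y} (h : A.map f = A.map g) :
    f = g := by
  rw [← cancel_mono (A.unit y), ← e_map_id, ← e_map_id, h]

/-- The functor `D`, as a functor to the opposite category. -/
def functor : T ⥤ Tᵒᵖ where
  obj x := .op (A.D x)
  map f := (A.map f).op
  map_id x := by rw [A.map_id]; rfl
  map_comp f g := by rw [A.map_comp]; rfl

theorem isEquivalence (h : ∀ x, IsIso (A.unit x)) (h' : ∀ x, IsIso (A.counit x)) :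
    A.functor.IsEquivalence where
  faithful := ⟨fun {_ y _ _} hfg => have := h y; A.map_injective (congrArg Quiver.Hom.unop hfg)⟩
  full := ⟨fun {x y} f => have := h y
    ⟨A.e (A.D y) x f.unop ≫ inv (A.unit y), Quiver.Hom.unop_inj
      ((A.e _ _).injective ((A.e_map_id _).trans
        (by rw [Category.assoc, IsIso.inv_hom_id, Category.comp_id]; rfl)))⟩⟩
  essSurj := ⟨fun a => ⟨A.D' a.unop, ⟨(asIso (A.counit a.unop)).op⟩⟩⟩

/-- The dual of a projective object `P` is a retract of every object containing it. -/
theorem exists_retraction (hT : ∀ z : T, ∃ (Z : T) (ι : z ⟶ Z), Mono ι ∧ IsIso (A.unit Z))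
    {P X : T} [Projective P] [IsIso (A.unit P)] [Mono (A.counit X)] (j : A.D P ⟶ X) [Mono j] :
    ∃ r : X ⟶ A.D P, j ≫ r = 𝟙 _ := by
  -- `g` is `D' j` under `D' D P ≅ P`. A section of it, which exists once `g` is epi because `P` is
  -- projective, is turned by `D` into the retraction.
  let g : A.D' X ⟶ P := A.map' j ≫ inv (A.unit P)
  -- Maps out of `P` are tested after embedding their target in some `Z` with invertible unit, where
  -- they are recovered from their images under `D`; then the counit at `X` and `j` are cancelled as
  -- monomorphisms.
  have : Epi g := ⟨fun {z} h₁ h₂ h => by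
    obtain ⟨Z, ι, _, _⟩ := hT z
    have key (f : P ⟶ z) : g ≫ f ≫ ι = A.map' (A.map (f ≫ ι) ≫ j) ≫ inv (A.unit Z) := by
      rw [IsIso.eq_comp_inv, Category.assoc, A.unit_naturality, map'_comp]
      simp [g]
    have h1 : A.map' (A.map (h₁ ≫ ι) ≫ j) = A.map' (A.map (h₂ ≫ ι) ≫ j) := by
      rw [← cancel_mono (inv (A.unit Z)), ← key, ← key, reassoc_of% h]
    have h2 : A.map (h₁ ≫ ι) ≫ j = A.map (h₂ ≫ ι) ≫ j := by
      rw [← cancel_mono (A.counit X), counit_naturality, counit_naturality, h1]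
    rw [cancel_mono] at h2
    exact (cancel_mono ι).1 (A.map_injective h2)⟩
  let s := Projective.factorThru (𝟙 P) g
  have hs : s ≫ A.map' j = A.unit P := by
    have : s ≫ g = 𝟙 P := by simp [s]
    rw [← cancel_mono (inv (A.unit P)), Category.assoc, IsIso.hom_inv_id]
    exact this
  refine ⟨A.counit X ≫ A.map s, ?_⟩
  rw [reassoc_of% counit_naturality, ← map_comp, hs, counit_map_unit]

section Abelian

variable [Abelian T]

/-- Pushing out `i` along `f` embeds `D P` in the pushout, hence in an object with invertible units,
and there `exists_retraction` splits it off. -/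
theorem injective_dual
    (hT : ∀ z : T, ∃ (Z : T) (ι : z ⟶ Z), Mono ι ∧ IsIso (A.unit Z) ∧ IsIso (A.counit Z))
    (P : T) [Projective P] [IsIso (A.unit P)] {a b : T} (i : a ⟶ b) [Mono i] (f : a ⟶ A.D P) :
    ∃ f' : b ⟶ A.D P, i ≫ f' = f := by
  obtain ⟨X, ι, _, _, _⟩ := hT (pushout i f)
  obtain ⟨r, hr⟩ := A.exists_retraction
    (fun z => (hT z).imp fun _ => Exists.imp fun _ h => ⟨h.1, h.2.1⟩) (pushout.inr i f ≫ ι)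
  exact ⟨pushout.inl i f ≫ ι ≫ r, by rw [pushout.condition_assoc]; simpa using f ≫= hr⟩

/-- `D` turns epimorphisms into monomorphisms by adjointness, and `D'` turns monomorphisms into
epimorphisms because `D` of the given projectives is injective. Naturality then makes the unit mono
by comparison with an overobject `X`, and epi by comparison with a projective cover `P`. -/
theorem isIso_unit
    (hT : ∀ z : T, ∃ (Z : T) (ι : z ⟶ Z), Mono ι ∧ IsIso (A.unit Z) ∧ IsIso (A.counit Z))
    (hP : ∀ z : T, ∃ (P : T) (π : P ⟶ z), Epi π ∧ Projective P ∧ IsIso (A.unit P)) (x : T) :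
    IsIso (A.unit x) := by
  have epi {a b : T} (i : a ⟶ b) [Mono i] : Epi (A.map' i) := by
    obtain ⟨Q, π, _, _, _⟩ := hP (A.D' a)
    obtain ⟨f, hf⟩ := A.injective_dual hT Q i ((A.e _ _).symm π)
    have : A.e _ _ f ≫ A.map' i = π := by rw [← A.e_comp, hf, Equiv.apply_symm_apply]
    exact epi_of_epi_fac this
  have mono {a b : T} (p : a ⟶ b) [Epi p] : Mono (A.map p) := ⟨fun {z} f g h =>
    (A.e _ _).injective ((cancel_epi p).1 (by rw [← A.e_map, ← A.e_map, h]))⟩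
  obtain ⟨X, ι, _, _, _⟩ := hT x
  obtain ⟨P, π, _, _, _⟩ := hP x
  have : Mono (A.unit x ≫ A.map' (A.map ι)) := by rw [← unit_naturality]; infer_instance
  have : Mono (A.unit x) := mono_of_mono _ (A.map' (A.map ι))
  have := mono π
  have := epi (A.map π)
  have : Epi (π ≫ A.unit x) := by rw [unit_naturality]; infer_instance
  have : Epi (A.unit x) := epi_of_epi π _
  exact isIso_of_mono_of_epi _

theorem isEquivalence_of_abelian
    (hT : ∀ z : T, ∃ (Z : T) (ι : z ⟶ Z), Mono ι ∧ IsIso (A.unit Z) ∧ IsIso (A.counit Z))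
    (hP : ∀ z : T, ∃ (P : T) (π : P ⟶ z), Epi π ∧ Projective P ∧ IsIso (A.unit P) ∧
      IsIso (A.counit P)) : A.functor.IsEquivalence :=
  A.isEquivalence
    (A.isIso_unit hT fun z => (hP z).imp fun _ => Exists.imp fun _ h => ⟨h.1, h.2.1, h.2.2.1⟩)
    (A.symm.isIso_unit
      (fun z => (hT z).imp fun _ => Exists.imp fun _ h => ⟨h.1, h.2.2, h.2.1⟩)
      fun z => (hP z).imp fun _ => Exists.imp fun _ h => ⟨h.1, h.2.1, h.2.2.2⟩)

end Abelian

end DualityPair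

/-! ### Duality data in a monoidal category -/

section Monoidal

variable {T : Type w} [Category.{v} T] [MonoidalCategory T]

theorem existsUnique_evaluation_right (x y : T) [ExactPairing x y] (a : T) (φ : a ⊗ x ⟶ 𝟙_ T) :
    ∃! f : a ⟶ y, f ▷ x ≫ ε_ x y = φ := by
  have h (f : a ⟶ y) : (tensorRightHomEquiv a x y (𝟙_ T)).symm (f ≫ (λ_ y).inv) =
      f ▷ x ≫ ε_ x y := by
    change (f ≫ (λ_ y).inv) ▷ x ≫ (α_ _ _ _).hom ≫ _ ◁ ε_ x y ≫ (ρ_ _).hom = _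
    rw [comp_whiskerRight_assoc, leftUnitor_inv_whiskerRight_assoc]
    simp [← unitors_equal]
  refine ⟨tensorRightHomEquiv a x y (𝟙_ T) φ ≫ (λ_ y).hom, ?_, fun f hf => ?_⟩
  · dsimp only
    rw [← h]
    simp
  · rw [← hf, ← h]
    simp

theorem existsUnique_evaluation_left (x y : T) [ExactPairing x y] (a : T) (φ : y ⊗ a ⟶ 𝟙_ T) :
    ∃! f : a ⟶ x, y ◁ f ≫ ε_ x y = φ := by
  have h (f : a ⟶ x) : (tensorLeftHomEquiv a x y (𝟙_ T)).symm (f ≫ (ρ_ x).inv) =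
      y ◁ f ≫ ε_ x y := by
    change y ◁ (f ≫ (ρ_ x).inv) ≫ (α_ _ _ _).inv ≫ ε_ x y ▷ _ ≫ (λ_ _).hom = _
    rw [MonoidalCategory.whiskerLeft_comp_assoc, whiskerLeft_rightUnitor_inv_assoc]
    simp [unitors_equal]
  refine ⟨tensorLeftHomEquiv a x y (𝟙_ T) φ ≫ (ρ_ x).hom, ?_, fun f hf => ?_⟩
  · dsimp only
    rw [← h]
    simp
  · rw [← hf, ← h]
    simp

/-- The data of objects representing `a ↦ Hom(a ⊗ x, 𝟙)` and `x ↦ Hom(a ⊗ x, 𝟙)`. -/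
structure DualityData (T : Type w) [Category.{v} T] [MonoidalCategory T] where
  D : T → T
  D' : T → T
  ev (x : T) : D x ⊗ x ⟶ 𝟙_ T
  ev' (a : T) : a ⊗ D' a ⟶ 𝟙_ T
  existsUnique (x a : T) (φ : a ⊗ x ⟶ 𝟙_ T) : ∃! f : a ⟶ D x, f ▷ x ≫ ev x = φ
  existsUnique' (a x : T) (φ : a ⊗ x ⟶ 𝟙_ T) : ∃! g : x ⟶ D' a, a ◁ g ≫ ev' a = φ

namespace DualityData

variable (A : DualityData T)

/-- The bijection `Hom(a ⊗ x, 𝟙) ≃ Hom(a, D x)`. -/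
def equiv (a x : T) : (a ⊗ x ⟶ 𝟙_ T) ≃ (a ⟶ A.D x) where
  toFun φ := (A.existsUnique x a φ).choose
  invFun f := f ▷ x ≫ A.ev x
  left_inv φ := (A.existsUnique x a φ).choose_spec.1
  right_inv _ := (A.existsUnique x a _).unique (A.existsUnique x a _).choose_spec.1 rfl

/-- The bijection `Hom(a ⊗ x, 𝟙) ≃ Hom(x, D' a)`. -/
def equiv' (a x : T) : (a ⊗ x ⟶ 𝟙_ T) ≃ (x ⟶ A.D' a) where
  toFun φ := (A.existsUnique' a x φ).choose
  invFun f := a ◁ f ≫ A.ev' a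
  left_inv φ := (A.existsUnique' a x φ).choose_spec.1
  right_inv _ := (A.existsUnique' a x _).unique (A.existsUnique' a x _).choose_spec.1 rfl

theorem equiv_symm_apply (a x : T) (f : a ⟶ A.D x) : (A.equiv a x).symm f = f ▷ x ≫ A.ev x := rfl

theorem equiv'_symm_apply (a x : T) (f : x ⟶ A.D' a) :
    (A.equiv' a x).symm f = a ◁ f ≫ A.ev' a := rfl

theorem equiv_naturality_left {a a' : T} (g : a' ⟶ a) (x : T) (f : a ⊗ x ⟶ 𝟙_ T) :
    A.equiv a' x (g ▷ x ≫ f) = g ≫ A.equiv a x f := by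
  rw [← Equiv.eq_symm_apply, equiv_symm_apply, comp_whiskerRight, Category.assoc,
    ← equiv_symm_apply, Equiv.symm_apply_apply]

theorem equiv'_naturality_right (a : T) {x x' : T} (h : x' ⟶ x) (f : a ⊗ x ⟶ 𝟙_ T) :
    A.equiv' a x' (a ◁ h ≫ f) = h ≫ A.equiv' a x f := by
  rw [← Equiv.eq_symm_apply, equiv'_symm_apply, MonoidalCategory.whiskerLeft_comp,
    Category.assoc, ← equiv'_symm_apply, Equiv.symm_apply_apply]

/-- The functoriality of `D`. -/
def map {x y : T} (f : x ⟶ y) : A.D y ⟶ A.D x := A.equiv _ _ (A.D y ◁ f ≫ A.ev y)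

/-- The functoriality of `D'`. -/
def map' {x y : T} (f : x ⟶ y) : A.D' y ⟶ A.D' x := A.equiv' _ _ (f ▷ A.D' y ≫ A.ev' y)

theorem map_ev {x y : T} (f : x ⟶ y) : A.map f ▷ x ≫ A.ev x = A.D y ◁ f ≫ A.ev y :=
  (A.equiv _ _).symm_apply_apply _

theorem map'_ev {x y : T} (f : x ⟶ y) : x ◁ A.map' f ≫ A.ev' x = f ▷ A.D' y ≫ A.ev' y :=
  (A.equiv' _ _).symm_apply_apply _

theorem equiv_naturality_right (a : T) {x x' : T} (h : x' ⟶ x) (f : a ⊗ x ⟶ 𝟙_ T) :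
    A.equiv a x' (a ◁ h ≫ f) = A.equiv a x f ≫ A.map h := by
  rw [← Equiv.eq_symm_apply, equiv_symm_apply, comp_whiskerRight, Category.assoc, map_ev,
    ← whisker_exchange_assoc, ← equiv_symm_apply, Equiv.symm_apply_apply]

theorem equiv'_naturality_left {a a' : T} (g : a' ⟶ a) (x : T) (f : a ⊗ x ⟶ 𝟙_ T) :
    A.equiv' a' x (g ▷ x ≫ f) = A.equiv' a x f ≫ A.map' g := by
  rw [← Equiv.eq_symm_apply, equiv'_symm_apply, MonoidalCategory.whiskerLeft_comp,
    Category.assoc, map'_ev, whisker_exchange_assoc, ← equiv'_symm_apply, Equiv.symm_apply_apply]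

/-- The duality pair underlying duality data. -/
def dualityPair : DualityPair T where
  D := A.D
  D' := A.D'
  map := A.map
  map' := A.map'
  e a x := (A.equiv a x).symm.trans (A.equiv' a x)
  e_comp {a' a x} g f := by
    rw [Equiv.trans_apply, Equiv.trans_apply, equiv_symm_apply, comp_whiskerRight, Category.assoc,
      ← equiv_symm_apply, equiv'_naturality_left]
  e_map {a x' x} h f := by
    rw [Equiv.trans_apply, Equiv.trans_apply, ← equiv'_naturality_right]
    congr 1
    rw [Equiv.symm_apply_eq, equiv_naturality_right, Equiv.apply_symm_apply]

/-- The unit `x ⟶ D' D x`. -/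
def unit (x : T) : x ⟶ A.D' (A.D x) := A.equiv' _ _ (A.ev x)

/-- The unit `a ⟶ D D' a`. -/
def counit (a : T) : a ⟶ A.D (A.D' a) := A.equiv _ _ (A.ev' a)

theorem unit_ev (x : T) : A.D x ◁ A.unit x ≫ A.ev' (A.D x) = A.ev x :=
  (A.equiv' _ _).symm_apply_apply _

theorem counit_ev (a : T) : A.counit a ▷ A.D' a ≫ A.ev (A.D' a) = A.ev' a :=
  (A.equiv _ _).symm_apply_apply _

theorem dualityPair_unit (x : T) : A.dualityPair.unit x = A.unit x := by
  change A.equiv' _ _ (𝟙 (A.D x) ▷ x ≫ A.ev x) = _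
  rw [id_whiskerRight, Category.id_comp, unit]

theorem dualityPair_counit (a : T) : A.dualityPair.counit a = A.counit a := by
  change A.equiv _ _ (a ◁ 𝟙 (A.D' a) ≫ A.ev' a) = _
  rw [MonoidalCategory.whiskerLeft_id, Category.id_comp, counit]

/-- A right dual `y` of `x` represents the same functor as `D x`. Under this identification `θ`, the
inverse of the unit is the map `u` that the pairing of `x` and `y` assigns to `ev'`. -/
theorem isIso_unit (x y : T) [ExactPairing x y] : IsIso (A.unit x) := by
  obtain ⟨θ, hθ, -⟩ := A.existsUnique x y (ε_ x y)
  obtain ⟨θ', hθ', -⟩ := existsUnique_evaluation_right x y (A.D x) (A.ev x)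
  have h1 : θ' ≫ θ = 𝟙 _ := (A.existsUnique x _ (A.ev x)).unique
    (by rw [comp_whiskerRight, Category.assoc, hθ, hθ']) (by simp)
  obtain ⟨u, hu, -⟩ := existsUnique_evaluation_left x y _ (θ ▷ _ ≫ A.ev' (A.D x))
  refine ⟨u, (existsUnique_evaluation_left x y _ (ε_ x y)).unique ?_ (by simp),
    (A.existsUnique' (A.D x) _ (A.ev' (A.D x))).unique ?_ (by simp)⟩
  · rw [MonoidalCategory.whiskerLeft_comp, Category.assoc, hu, whisker_exchange_assoc, unit_ev, hθ]
  · rw [MonoidalCategory.whiskerLeft_comp, Category.assoc, unit_ev, ← hθ',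
      whisker_exchange_assoc, hu, ← comp_whiskerRight_assoc, h1]
    simp

theorem isIso_counit (x y : T) [ExactPairing x y] : IsIso (A.counit y) := by
  obtain ⟨θ, hθ, -⟩ := A.existsUnique' y x (ε_ x y)
  obtain ⟨θ', hθ', -⟩ := existsUnique_evaluation_left x y (A.D' y) (A.ev' y)
  have h1 : θ' ≫ θ = 𝟙 _ := (A.existsUnique' y _ (A.ev' y)).unique
    (by rw [MonoidalCategory.whiskerLeft_comp, Category.assoc, hθ, hθ']) (by simp)
  obtain ⟨u, hu, -⟩ := existsUnique_evaluation_right x y _ (_ ◁ θ ≫ A.ev (A.D' y))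
  refine ⟨u, (existsUnique_evaluation_right x y _ (ε_ x y)).unique ?_ (by simp),
    (A.existsUnique (A.D' y) _ (A.ev (A.D' y))).unique ?_ (by simp)⟩
  · rw [comp_whiskerRight, Category.assoc, hu, ← whisker_exchange_assoc, counit_ev, hθ]
  · rw [comp_whiskerRight, Category.assoc, counit_ev, ← hθ',
      ← whisker_exchange_assoc, hu, ← MonoidalCategory.whiskerLeft_comp_assoc, h1]
    simp

theorem isIso_dualityPair_unit (x y : T) [ExactPairing x y] : IsIso (A.dualityPair.unit x) := by
  rw [dualityPair_unit]
  exact A.isIso_unit x y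

theorem isIso_dualityPair_counit (x y : T) [ExactPairing x y] :
    IsIso (A.dualityPair.counit y) := by
  rw [dualityPair_counit]
  exact A.isIso_counit x y

include A in
-- A right dual makes the unit invertible and a left dual the counit, so enough objects with both
-- duals suffice for `isEquivalence_of_abelian`.
theorem isRCategory [Abelian T]
    (hint : ∀ x y : T, ((tensorRight x).op ⋙ yoneda.obj y).IsRepresentable)
    (hT : ∀ z : T, ∃ (Z : T) (ι : z ⟶ Z), Mono ι ∧ Nonempty (HasLeftDual Z) ∧
      Nonempty (HasRightDual Z))
    (hP : ∀ z : T, ∃ (P : T) (π : P ⟶ z), Epi π ∧ Projective P ∧ Nonempty (HasLeftDual P) ∧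
      Nonempty (HasRightDual P)) : IsRCategory T where
  enriched := hint
  dual_equivalence := by
    refine ⟨A.dualityPair.functor, A.equiv, fun g x f => A.equiv_naturality_left g x f,
      fun a _ _ h f => A.equiv_naturality_right a h f,
      A.dualityPair.isEquivalence_of_abelian (fun z => ?_) fun z => ?_⟩
    · obtain ⟨Z, ι, hι, ⟨_⟩, ⟨_⟩⟩ := hT z
      exact ⟨Z, ι, hι, A.isIso_dualityPair_unit Z Zᘁ, A.isIso_dualityPair_counit (ᘁZ) Z⟩
    · obtain ⟨P, π, hπ, hP, ⟨_⟩, ⟨_⟩⟩ := hP z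
      exact ⟨P, π, hπ, hP, A.isIso_dualityPair_unit P Pᘁ, A.isIso_dualityPair_counit (ᘁP) P⟩

end DualityData

end Monoidal

/-! ### Mates, and duals of cokernels -/

section Duals

open Functor.LaxMonoidal Functor.OplaxMonoidal in
/-- The image of an exact pairing under a monoidal functor. -/
@[reducible]
def mapExactPairing {A D : Type*} [Category* A] [MonoidalCategory A] [Category* D]
    [MonoidalCategory D] (F : A ⥤ D) [F.Monoidal] (X Y : A) [ExactPairing X Y] :
    ExactPairing (F.obj X) (F.obj Y) where
  coevaluation' := ε F ≫ F.map (η_ X Y) ≫ δ F X Y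
  evaluation' := μ F Y X ≫ F.map (ε_ X Y) ≫ η F
  coevaluation_evaluation' := by
    have h := F.congr_map (ExactPairing.coevaluation_evaluation X Y)
    simp only [Functor.map_comp, Functor.Monoidal.map_whiskerLeft,
      Functor.Monoidal.map_whiskerRight, Functor.Monoidal.map_associator_inv, Category.assoc,
      Functor.Monoidal.μ_δ_assoc] at h
    have h' := (F.obj Y ◁ ε F ≫ μ F _ _) ≫= h =≫ (δ F _ _ ≫ η F ▷ F.obj Y)
    simp only [Category.assoc, Functor.Monoidal.μ_δ_assoc, MonoidalCategory.whiskerLeft_comp,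
      comp_whiskerRight] at h' ⊢
    exact h'.trans (by simp)
  evaluation_coevaluation' := by
    have h := F.congr_map (ExactPairing.evaluation_coevaluation X Y)
    simp only [Functor.map_comp, Functor.Monoidal.map_whiskerLeft,
      Functor.Monoidal.map_whiskerRight, Functor.Monoidal.map_associator, Category.assoc,
      Functor.Monoidal.μ_δ_assoc] at h
    have h' := (ε F ▷ F.obj X ≫ μ F _ _) ≫= h =≫ (δ F _ _ ≫ F.obj X ◁ η F)
    simp only [Category.assoc, Functor.Monoidal.μ_δ_assoc, MonoidalCategory.whiskerLeft_comp,
      comp_whiskerRight] at h' ⊢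
    exact h'.trans (by simp)

variable {A D : Type*} [Category* A] [MonoidalCategory A] [Category* D] [MonoidalCategory D]

/-- Exact pairings in a product of monoidal categories. -/
@[reducible]
def prodExactPairing (X X' : A) (Y Y' : D) [ExactPairing X X'] [ExactPairing Y Y'] :
    ExactPairing (X, Y) (X', Y') where
  coevaluation' := η_ X X' ×ₘ η_ Y Y'
  evaluation' := ε_ X X' ×ₘ ε_ Y Y'
  coevaluation_evaluation' := Prod.ext (ExactPairing.coevaluation_evaluation X X')
    (ExactPairing.coevaluation_evaluation Y Y')
  evaluation_coevaluation' := Prod.ext (ExactPairing.evaluation_coevaluation X X')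
    (ExactPairing.evaluation_coevaluation Y Y')

/-- Maps `t ⟶ X` correspond to maps `X' ⊗ t ⟶ 𝟙`, and equality after composing with `f` becomes
equality after precomposing with the epimorphism `g ▷ t`. -/
theorem mono_of_evaluation {X X' Y Y' : A} [ExactPairing X X'] [ExactPairing Y Y'] (f : X ⟶ Y)
    (g : Y' ⟶ X') (h : g ▷ X ≫ ε_ X X' = Y' ◁ f ≫ ε_ Y Y') (hg : ∀ t : A, Epi (g ▷ t)) :
    Mono f := ⟨fun {t} a b hab => by
  refine (existsUnique_evaluation_left X X' t (X' ◁ b ≫ ε_ X X')).unique ?_ rfl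
  have := hg t
  rw [← cancel_epi (g ▷ t), ← whisker_exchange_assoc, ← whisker_exchange_assoc, h,
    ← MonoidalCategory.whiskerLeft_comp_assoc, hab, MonoidalCategory.whiskerLeft_comp_assoc]⟩

/-- Maps `X' ⟶ t` correspond to maps `𝟙 ⟶ X ⊗ t`, and `f ▷ t` can be cancelled there. -/
theorem epi_of_coevaluation {X X' Y Y' : A} [ExactPairing X X'] [ExactPairing Y Y'] (f : X ⟶ Y)
    (g : Y' ⟶ X') (h : η_ X X' ≫ f ▷ X' = η_ Y Y' ≫ Y ◁ g) (hf : ∀ t : A, Mono (f ▷ t)) :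
    Epi g := ⟨fun {t} a b hab => by
  have key (c : X' ⟶ t) : tensorLeftHomEquiv (𝟙_ A) X X' t ((ρ_ X').hom ≫ c) =
      η_ X X' ≫ X ◁ c := by
    change (λ_ _).inv ≫ η_ _ _ ▷ _ ≫ (α_ _ _ _).hom ≫ _ ◁ ((ρ_ X').hom ≫ c) = _
    simp [unitors_inv_equal]
  have h1 : η_ X X' ≫ X ◁ a = η_ X X' ≫ X ◁ b := by
    have := hf t
    rw [← cancel_mono (f ▷ t), Category.assoc, Category.assoc, whisker_exchange,
      whisker_exchange, reassoc_of% h, reassoc_of% h, ← MonoidalCategory.whiskerLeft_comp, hab,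
      MonoidalCategory.whiskerLeft_comp]
  rw [← key, ← key] at h1
  exact (cancel_epi (ρ_ X').hom).1 ((tensorLeftHomEquiv (𝟙_ A) X X' t).injective h1)⟩

/-- Every morphism between objects with right duals has a mate. -/
theorem exists_mate {X X' Y Y' : A} [ExactPairing X X'] [ExactPairing Y Y'] (f : X ⟶ Y) :
    ∃ g : Y' ⟶ X', g ▷ X ≫ ε_ X X' = Y' ◁ f ≫ ε_ Y Y' ∧
      η_ X X' ≫ f ▷ X' = η_ Y Y' ≫ Y ◁ g := by
  let i : HasRightDual X := ⟨X'⟩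
  let j : HasRightDual Y := ⟨Y'⟩
  exact ⟨fᘁ, rightAdjointMate_comp_evaluation f, (coevaluation_comp_rightAdjointMate f).symm⟩

end Duals

section Cokernel

variable {T : Type w} [Category.{v} T] [Abelian T] [MonoidalCategory T] [MonoidalPreadditive T]

theorem exists_desc_evaluation {X Y Z K W : T} {f : X ⟶ Y} {π : Y ⟶ Z} {w : f ≫ π = 0}
    (h : IsColimit (CokernelCofork.ofπ π w)) [PreservesFiniteColimits (tensorLeft K)]
    (g : K ⊗ Y ⟶ W) (hg : K ◁ f ≫ g = 0) : ∃ l : K ⊗ Z ⟶ W, K ◁ π ≫ l = g := by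
  obtain ⟨h'⟩ := preservesCokernels (tensorLeft K) w h
  exact exists_desc_of_isCokernel h' g hg

/-- If the tensor product is exact, the cokernel of a morphism between objects with right duals
has a right dual. -/
theorem nonempty_hasRightDual_of_isCokernel
    (hr : ∀ a : T, PreservesFiniteColimits (tensorLeft a))
    (hl : ∀ a : T, PreservesFiniteLimits (tensorLeft a)) {X₁ Y₁ X₀ Y₀ t : T}
    [ExactPairing X₁ Y₁] [ExactPairing X₀ Y₀] {u : X₁ ⟶ X₀} {p : X₀ ⟶ t} {w : u ≫ p = 0}
    (h : IsColimit (CokernelCofork.ofπ p w)) : Nonempty (HasRightDual t) := by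
  -- The right dual of `t` will be the kernel of the mate `u' : Y₀ ⟶ Y₁`. The evaluation of `X₀`
  -- descends along `p` by right exactness, and the coevaluation factors through the kernel by left
  -- exactness of `t ⊗ -`.
  obtain ⟨u', hu, hu'⟩ := exists_mate (X' := Y₁) (Y' := Y₀) u
  have := epi_of_isCokernel h
  obtain ⟨ev, hev⟩ := exists_desc_evaluation h (K := kernel u') (kernel.ι u' ▷ X₀ ≫ ε_ X₀ Y₀)
    (by rw [whisker_exchange_assoc, ← hu, ← comp_whiskerRight_assoc, kernel.condition]; simp)
  have hm (a : T) : Mono (a ◁ kernel.ι u') := inferInstanceAs (Mono ((tensorLeft a).map _))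
  have he (a : T) : Epi (a ◁ p) := inferInstanceAs (Epi ((tensorLeft a).map _))
  obtain ⟨coev, hcoev⟩ : ∃ c : 𝟙_ T ⟶ t ⊗ kernel u',
      c ≫ t ◁ kernel.ι u' = η_ X₀ Y₀ ≫ p ▷ Y₀ := by
    have hk := KernelFork.mapIsLimit _ (kernelIsKernel u') (tensorLeft t)
    obtain ⟨l, hl⟩ := KernelFork.IsLimit.lift' hk (η_ X₀ Y₀ ≫ p ▷ Y₀) (by
      change (η_ X₀ Y₀ ≫ p ▷ Y₀) ≫ t ◁ u' = 0
      rw [Category.assoc, ← whisker_exchange, ← reassoc_of% hu', ← comp_whiskerRight, w]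
      simp)
    exact ⟨l, hl⟩
  exact ⟨{
    rightDual := kernel u'
    exact :=
    { coevaluation' := coev
      evaluation' := ev
      coevaluation_evaluation' := by
        rw [← cancel_mono (𝟙_ T ◁ kernel.ι u')]
        simp only [Category.assoc]
        rw [← whisker_exchange, ← associator_inv_naturality_right_assoc,
          ← MonoidalCategory.whiskerLeft_comp_assoc, hcoev,
          MonoidalCategory.whiskerLeft_comp_assoc, associator_inv_naturality_middle_assoc,
          ← comp_whiskerRight, hev, comp_whiskerRight, ← associator_inv_naturality_left_assoc,
          whisker_exchange_assoc, ExactPairing.coevaluation_evaluation X₀ Y₀]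
        simp
      evaluation_coevaluation' := by
        rw [← cancel_epi (𝟙_ T ◁ p), whisker_exchange_assoc, associator_naturality_right_assoc,
          ← MonoidalCategory.whiskerLeft_comp, hev, MonoidalCategory.whiskerLeft_comp,
          ← associator_naturality_middle_assoc, ← comp_whiskerRight_assoc, hcoev,
          comp_whiskerRight_assoc, associator_naturality_left_assoc, ← whisker_exchange,
          reassoc_of% (ExactPairing.evaluation_coevaluation X₀ Y₀)]
        simp } }⟩

omit [Abelian T] [MonoidalPreadditive T] in
-- Essential surjectivity of `D` gives `t ≅ D x`. As `x` has a right dual, `D x` is that dual, and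
-- `x` is then a left dual of `t`.
theorem HasRightDual.hasLeftDual_of_isRCategory (hT : IsRCategory T)
    (h : ∀ t : T, Nonempty (HasRightDual t)) (t : T) : Nonempty (HasLeftDual t) := by
  obtain ⟨D, e, he, he', hD⟩ := hT.dual_equivalence
  let x := D.objPreimage (.op t)
  obtain ⟨_⟩ := h x
  let v : (D.obj x).unop ⊗ x ⟶ 𝟙_ T := (e _ x).symm (𝟙 _)
  have hv {a : T} (f : a ⟶ (D.obj x).unop) : (e a x).symm f = f ▷ x ≫ v := by
    rw [Equiv.symm_apply_eq, he, Equiv.apply_symm_apply, Category.comp_id]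
  obtain ⟨θ, hθ, -⟩ := existsUnique_evaluation_right x xᘁ _ v
  let i : t ≅ xᘁ := (D.objObjPreimageIso (.op t)).unop ≪≫
    { hom := θ
      inv := e _ x (ε_ x xᘁ)
      hom_inv_id := by rw [← he, hθ, Equiv.apply_symm_apply]
      inv_hom_id := (existsUnique_evaluation_right x xᘁ _ (ε_ x xᘁ)).unique
        (by rw [comp_whiskerRight, Category.assoc, hθ, ← hv, Equiv.symm_apply_apply]) (by simp) }
  exact ⟨{ leftDual := x, exact := exactPairingCongrRight i }⟩

end Cokernel

/-! ### Additive functions and exactness -/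

section AdditiveFunctions

/-- A function which is additive on short exact sequences. -/
structure IsAdditiveOnExact {A : Type*} [Category* A] [Preadditive A] (ψ : A → ℕ∞) : Prop where
  zero : ∀ ⦃a : A⦄, IsZero a → ψ a = 0
  add : ∀ S : ShortComplex A, S.ShortExact → ψ S.X₂ = ψ S.X₁ + ψ S.X₃

variable {A T : Type w} [Category.{v} A] [Category.{v} T] [Abelian A] [Abelian T]

theorem IsAdditiveOnExact.comp {ψ : T → ℕ∞} (hψ : IsAdditiveOnExact ψ) (G : A ⥤ T) [G.Additive]
    [PreservesFiniteLimits G] [PreservesFiniteColimits G] :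
    IsAdditiveOnExact fun a => ψ (G.obj a) where
  zero _ ha := hψ.zero (G.map_isZero ha)
  add S hS := hψ.add (S.map G) (hS.map_of_exact G)

/-- Additive functions are determined by their values on the simple objects. -/
theorem IsAdditiveOnExact.ext (hA : IsFiniteLength A) {ψ ψ' : A → ℕ∞} (h : IsAdditiveOnExact ψ)
    (h' : IsAdditiveOnExact ψ') (hs : ∀ q : A, Simple q → ψ q = ψ' q) (a : A) : ψ a = ψ' a := by
  obtain ⟨l, hl⟩ := hA a
  induction hl with
  | nil ha => rw [h.zero ha, h'.zero ha]
  | cons hS hq _ ih => rw [h.add _ hS, h'.add _ hS, ih, hs _ hq]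

theorem isAdditiveOnExact_length (hT : IsFiniteLength T) :
    IsAdditiveOnExact (length : T → ℕ∞) where
  zero _ ha := by rw [length_eq hT (.nil ha)]; rfl
  add S hS := length_shortExact hT hS

theorem isAdditiveOnExact_weight (hT : IsFiniteLength T) {φ : T → ℕ∞} (hφ : IsoInvariant φ) :
    IsAdditiveOnExact (weight hT φ) where
  zero _ ha := weight_of_isZero hT hφ ha
  add _ hS := weight_shortExact hT hφ hS

theorem weight_mono (hT : IsFiniteLength T) {φ φ' : T → ℕ∞} (h : ∀ q, φ q ≤ φ' q) (a : T) :
    weight hT φ a ≤ weight hT φ' a :=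
  List.sum_le_sum fun q _ => h q

theorem weight_add (hT : IsFiniteLength T) (φ φ' : T → ℕ∞) (a : T) :
    weight hT (fun q => φ q + φ' q) a = weight hT φ a + weight hT φ' a :=
  List.sum_map_add

theorem weight_zero (hT : IsFiniteLength T) (a : T) : weight hT (fun _ => 0) a = 0 := by
  simp [weight]

/-- Subadditive functions are bounded by their weight. -/
theorem le_weight_of_subadditive (hT : IsFiniteLength T) {ψ : T → ℕ∞} (hψ : IsoInvariant ψ)
    (h0 : ∀ a : T, IsZero a → ψ a = 0)
    (hadd : ∀ S : ShortComplex T, S.ShortExact → ψ S.X₂ ≤ ψ S.X₁ + ψ S.X₃) (a : T) :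
    ψ a ≤ weight hT ψ a := by
  obtain ⟨l, hl⟩ := hT a
  rw [weight_eq hT hψ hl]
  induction hl with
  | nil ha => simpa using (h0 _ ha).le
  | cons hS _ _ ih =>
    rw [List.map_cons, List.sum_cons, add_comm]
    exact (hadd _ hS).trans (by gcongr)

/-- For a right exact functor the only defect of exactness is the kernel of `G.map S.f`, and length
measures it. -/
theorem length_map_add_length_kernel (hT : IsFiniteLength T) (G : A ⥤ T) [G.Additive]
    [PreservesFiniteColimits G] {S : ShortComplex A} (hS : S.ShortExact) :
    length (G.obj S.X₂) + length (kernel (G.map S.f)) =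
      length (G.obj S.X₁) + length (G.obj S.X₃) := by
  have h1 := length_shortExact hT (shortExact_kernel (Abelian.factorThruImage (G.map S.f)))
  have hG := (Functor.preservesFiniteColimits_iff_forall_exact_map_and_epi G).1 ‹_› S hS
  have : Epi (G.map S.g) := hG.2
  have hx := ((S.map G).exact_iff_exact_image_ι).1 hG.1
  have h2 := length_shortExact hT (S := ShortComplex.mk (Abelian.image.ι (G.map S.f)) (G.map S.g)
    (Abelian.image_ι_comp_eq_zero (S.map G).zero)) ⟨hx⟩
  have e : length (kernel (Abelian.factorThruImage (G.map S.f))) =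
      length (kernel (G.map S.f)) := length_isoInvariant
    ((kernelCompMono (Abelian.factorThruImage (G.map S.f)) (Abelian.image.ι (G.map S.f))).symm ≪≫
      kernelIsoOfEq (Abelian.image.fac _))
  dsimp only at h1 h2
  rw [h1, h2, e]
  ring

theorem preservesFiniteLimits_of_mono_map (G : A ⥤ T) [G.Additive] [PreservesFiniteColimits G]
    (h : ∀ S : ShortComplex A, S.ShortExact → Mono (G.map S.f)) : PreservesFiniteLimits G :=
  (Functor.preservesFiniteLimits_iff_forall_exact_map_and_mono G).2 fun S hS =>
    ⟨((Functor.preservesFiniteColimits_iff_forall_exact_map_and_epi G).1 ‹_› S hS).1, h S hS⟩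

/-- A squeeze: `length (G X₂) ≤ length (G X₁) + length (G X₃) ≤ ψ X₁ + ψ X₃ = ψ X₂`. Equality of the
ends forces equality at `X₃` and the vanishing of the defect. -/
theorem eq_and_mono_of_length_eq (hT : IsFiniteLength T) (G : A ⥤ T)
    [G.Additive] [PreservesFiniteColimits G] {ψ : A → ℕ∞} (hψ : IsAdditiveOnExact ψ)
    (hle : ∀ a, length (G.obj a) ≤ ψ a) {S : ShortComplex A} (hS : S.ShortExact)
    (h : length (G.obj S.X₂) = ψ S.X₂) : length (G.obj S.X₃) = ψ S.X₃ ∧ Mono (G.map S.f) := by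
  have h1 := length_map_add_length_kernel hT G hS
  have h2 := hψ.add S hS
  rw [← h] at h2
  have l1 := hle S.X₁
  have l3 := hle S.X₃
  have ht := length_ne_top hT (G.obj S.X₂)
  have n1 : ψ S.X₁ ≠ ⊤ := fun h' => ht (by rw [h2, h', top_add])
  have n3 : ψ S.X₃ ≠ ⊤ := fun h' => ht (by rw [h2, h', add_top])
  have t1 := length_ne_top hT (G.obj S.X₁)
  have t3 := length_ne_top hT (G.obj S.X₃)
  have tk := length_ne_top hT (kernel (G.map S.f))
  -- All quantities are finite, which permits cancellation in `ℕ`.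
  have hk : length (kernel (G.map S.f)) = 0 ∧ length (G.obj S.X₃) = ψ S.X₃ := by
    generalize length (kernel (G.map S.f)) = x at *
    generalize length (G.obj S.X₁) = x1 at *
    generalize length (G.obj S.X₂) = x2 at *
    generalize length (G.obj S.X₃) = x3 at *
    generalize ψ S.X₁ = y1 at *
    generalize ψ S.X₃ = y3 at *
    lift x to ℕ using tk
    lift x1 to ℕ using t1
    lift x2 to ℕ using ht
    lift x3 to ℕ using t3
    lift y1 to ℕ using n1
    lift y3 to ℕ using n3
    norm_cast at *
    omega
  exact ⟨hk.2, Preadditive.mono_of_isZero_kernel _ (isZero_of_length_eq_zero hT hk.1)⟩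

end AdditiveFunctions

section LeftExact

variable {T : Type w} [Category.{v} T] [MonoidalCategory T]

theorem preservesFiniteLimits_tensorLeft (a : T) (h : Nonempty (HasRightDual a)) :
    PreservesFiniteLimits (tensorLeft a) := by
  obtain ⟨_⟩ := h
  have : PreservesLimitsOfSize.{0, 0} (tensorLeft a) :=
    (tensorLeftAdjunction a aᘁ).rightAdjoint_preservesLimits
  exact PreservesLimitsOfSize.preservesFiniteLimits.{0, 0} _

theorem preservesFiniteLimits_tensorRight (a : T) (h : Nonempty (HasLeftDual a)) :
    PreservesFiniteLimits (tensorRight a) := by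
  obtain ⟨_⟩ := h
  have : PreservesLimitsOfSize.{0, 0} (tensorRight a) :=
    (tensorRightAdjunction (ᘁa) a).rightAdjoint_preservesLimits
  exact PreservesLimitsOfSize.preservesFiniteLimits.{0, 0} _

theorem tensorIsLeftExact_of_isRigid (h : IsRigid T) : TensorIsLeftExact T := fun a =>
  ⟨preservesFiniteLimits_tensorLeft a (h a).2, preservesFiniteLimits_tensorRight a (h a).1⟩

end LeftExact

/-! ### Lengths of tensor products and of semisimplifications -/

section LengthTensor

variable {T : Type w} [Category.{v} T] [Abelian T] [MonoidalCategory T] [MonoidalPreadditive T]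
  (hT : IsFiniteLength T)

/-- The sum of the lengths of the tensor products of the composition factors. -/
def factorLength (a b : T) : ℕ∞ := weight hT (fun q => weight hT (fun r => length (q ⊗ r)) b) a

omit [MonoidalPreadditive T] in
theorem isoInvariant_length_tensorLeft (q : T) : IsoInvariant fun r => length (q ⊗ r) :=
  fun _ _ e => length_isoInvariant (whiskerLeftIso q e)

omit [MonoidalPreadditive T] in
theorem isoInvariant_length_tensorRight (r : T) : IsoInvariant fun q => length (q ⊗ r) :=
  fun _ _ e => length_isoInvariant (whiskerRightIso e r)

omit [MonoidalPreadditive T] in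
theorem isoInvariant_weight_length (b : T) :
    IsoInvariant fun q : T => weight hT (fun r => length (q ⊗ r)) b := fun q q' e => by
  have : (fun r => length (q ⊗ r)) = fun r => length (q' ⊗ r) :=
    funext fun r => isoInvariant_length_tensorRight r e
  simp only [this]

omit [MonoidalPreadditive T] in
theorem isAdditiveOnExact_factorLength_left (b : T) :
    IsAdditiveOnExact fun a => factorLength hT a b :=
  isAdditiveOnExact_weight hT (isoInvariant_weight_length hT b)

omit [MonoidalPreadditive T] in
theorem isAdditiveOnExact_factorLength_right (a : T) :
    IsAdditiveOnExact fun b => factorLength hT a b where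
  zero b hb := by
    simp only [factorLength]
    rw [← weight_zero hT a]
    congr 1
    exact funext fun q => weight_of_isZero hT (isoInvariant_length_tensorLeft q) hb
  add S hS := by
    simp only [factorLength]
    rw [← weight_add]
    congr 1
    exact funext fun q => weight_shortExact hT (isoInvariant_length_tensorLeft q) hS

/-- Additive functors preserve split sequences, so on direct sums of composition factors the count
is exact without any exactness of the tensor product. -/
theorem length_tensor_sigma {a b : T} {la lb : List T} (ha : HasCompositionFactors a la)
    (hb : HasCompositionFactors b lb) :
    length ((∐ la.get) ⊗ (∐ lb.get)) = factorLength hT a b := by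
  have h0 := (isAdditiveOnExact_length hT)
  have h1 (r : T) := sum_eq_of_splitting (ψ := fun q => length (q ⊗ r))
    (fun a ha => h0.zero ((tensorRight r).map_isZero ha))
    (fun S hS => h0.add (S.map (tensorRight r)) (hS.some.map (tensorRight r)).shortExact) la
  have h2 (q : T) := sum_eq_of_splitting (ψ := fun r => length (q ⊗ r))
    (fun a ha => h0.zero ((tensorLeft q).map_isZero ha))
    (fun S hS => h0.add (S.map (tensorLeft q)) (hS.some.map (tensorLeft q)).shortExact) lb
  rw [h1, factorLength, weight_eq hT (isoInvariant_weight_length hT b) ha]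
  congr 2
  funext q
  rw [weight_eq hT (isoInvariant_length_tensorLeft q) hb, h2]

theorem lengthEquality_iff (a b : T) :
    LengthEquality a b ↔ length (a ⊗ b) = factorLength hT a b := by
  constructor
  · intro h
    obtain ⟨la, ha⟩ := hT a
    obtain ⟨lb, hb⟩ := hT b
    rw [h _ _ ⟨la, ha, ⟨Iso.refl _⟩⟩ ⟨lb, hb, ⟨Iso.refl _⟩⟩, length_tensor_sigma hT ha hb]
  · rintro h sa sb ⟨la, ha, ⟨ea⟩⟩ ⟨lb, hb, ⟨eb⟩⟩
    rw [h, ← length_tensor_sigma hT ha hb]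
    exact length_isoInvariant (ea ⊗ᵢ eb).symm

include hT in
theorem lengthEquality_of_isSemisimpleObject {a b : T} (ha : IsSemisimpleObject a)
    (hb : IsSemisimpleObject b) : LengthEquality a b := by
  obtain ⟨la, ha, ⟨ea⟩⟩ := ha
  obtain ⟨lb, hb, ⟨eb⟩⟩ := hb
  rw [lengthEquality_iff hT, ← length_tensor_sigma hT
    ((hasCompositionFactors_sigma ha).of_iso ea.symm)
    ((hasCompositionFactors_sigma hb).of_iso eb.symm)]
  exact length_isoInvariant (ea ⊗ᵢ eb)

variable [∀ a : T, PreservesFiniteColimits (tensorLeft a)]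
  [∀ a : T, PreservesFiniteColimits (tensorRight a)]

/-- Right exactness makes the length subadditive in each variable; the two bounds are applied in
turn. -/
theorem length_tensor_le_factorLength (a b : T) : length (a ⊗ b) ≤ factorLength hT a b := by
  have h0 := (isAdditiveOnExact_length hT)
  have h1 := le_weight_of_subadditive hT (isoInvariant_length_tensorRight b)
    (fun a ha => h0.zero ((tensorRight b).map_isZero ha))
    (fun S hS => le_self_add.trans (length_map_add_length_kernel hT (tensorRight b) hS).le) a
  have h2 (q : T) := le_weight_of_subadditive hT (isoInvariant_length_tensorLeft q)
    (fun a ha => h0.zero ((tensorLeft q).map_isZero ha))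
    (fun S hS => le_self_add.trans (length_map_add_length_kernel hT (tensorLeft q) hS).le) b
  exact h1.trans (weight_mono hT h2 a)

/-- Passing to quotients is what later reduces the equality to objects `x ⊠ y`, which cover
everything. -/
theorem length_eq_of_epi_left {a a' b : T} (p : a ⟶ a') [Epi p]
    (h : length (a ⊗ b) = factorLength hT a b) : length (a' ⊗ b) = factorLength hT a' b :=
  (eq_and_mono_of_length_eq hT (tensorRight b) (isAdditiveOnExact_factorLength_left hT b)
    (fun a => length_tensor_le_factorLength hT a b) (shortExact_kernel p) h).1

theorem length_eq_of_epi_right {a b b' : T} (p : b ⟶ b') [Epi p]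
    (h : length (a ⊗ b) = factorLength hT a b) : length (a ⊗ b') = factorLength hT a b' :=
  (eq_and_mono_of_length_eq hT (tensorLeft a) (isAdditiveOnExact_factorLength_right hT a)
    (fun b => length_tensor_le_factorLength hT a b) (shortExact_kernel p) h).1

theorem tensorIsLeftExact_of_length_eq
    (h : ∀ a b : T, length (a ⊗ b) = factorLength hT a b) : TensorIsLeftExact T := fun a =>
  ⟨preservesFiniteLimits_of_mono_map _ fun _ hS =>
    (eq_and_mono_of_length_eq hT (tensorLeft a) (isAdditiveOnExact_factorLength_right hT a)
      (fun b => length_tensor_le_factorLength hT a b) hS (h _ _)).2,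
    preservesFiniteLimits_of_mono_map _ fun _ hS =>
    (eq_and_mono_of_length_eq hT (tensorRight a) (isAdditiveOnExact_factorLength_left hT a)
      (fun b => length_tensor_le_factorLength hT b a) hS (h _ _)).2⟩

/-- Both sides are additive in each variable, and they agree on simple objects, whose only
composition factor is the object itself. -/
theorem length_eq_of_tensorIsLeftExact (h : TensorIsLeftExact T) (a b : T) :
    length (a ⊗ b) = factorLength hT a b := by
  have := fun a : T => (h a).1
  have := fun a : T => (h a).2
  have h0 := isAdditiveOnExact_length hT
  refine IsAdditiveOnExact.ext hT (h0.comp (tensorRight b))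
    (isAdditiveOnExact_factorLength_left hT b) (fun q hq => ?_) a
  refine IsAdditiveOnExact.ext hT (h0.comp (tensorLeft q))
    (isAdditiveOnExact_factorLength_right hT q) (fun r hr => ?_) b
  have hc (q : T) (hq : Simple q) : HasCompositionFactors q [q] :=
    .cons (S := ShortComplex.mk (kernel.ι (𝟙 q)) (𝟙 q) (kernel.condition _))
      (shortExact_kernel _) hq (.nil ((isZero_kernel_of_mono _)))
  have h1 : weight hT (fun r => length (q ⊗ r)) r = length (q ⊗ r) := by
    rw [weight_eq hT (isoInvariant_length_tensorLeft q) (hc r hr)]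
    simp
  rw [factorLength, weight_eq hT (isoInvariant_weight_length hT r) (hc q hq), List.map_singleton,
    List.sum_singleton, h1]
  rfl

end LengthTensor

/-! ### The four equivalent conditions -/

section Cover

variable {T : Type w} [Category.{v} T] [Abelian T] [MonoidalCategory T] [MonoidalPreadditive T]

/-- Covering `t` and then the kernel of the cover presents `t` as the cokernel of a map between
objects with right duals. -/
theorem isRigid_of_tensorIsLeftExact {ι : Type*} (F : ι → T)
    [∀ a : T, PreservesFiniteColimits (tensorLeft a)]
    (hr : ∀ p, Nonempty (HasRightDual (F p))) (hq : ∀ t : T, ∃ (p : ι) (π : F p ⟶ t), Epi π)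
    (hR : IsRCategory T) (h : TensorIsLeftExact T) :
    IsRigid T := by
  have hd (t : T) : Nonempty (HasRightDual t) := by
    obtain ⟨p, π, _⟩ := hq t
    obtain ⟨p', π', _⟩ := hq (kernel π)
    obtain ⟨_⟩ := hr p
    obtain ⟨_⟩ := hr p'
    obtain ⟨hc⟩ := nonempty_isCokernel (π' ≫ kernel.ι π) π (by simp) (fun g hg => by
      rw [Category.assoc, ← comp_zero (f := π'), cancel_epi] at hg
      exact exists_desc_of_isCokernel (shortExact_kernel π).gIsCokernel g hg)
    exact nonempty_hasRightDual_of_isCokernel (X₁ := F p') (X₀ := F p)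
      (Y₁ := (F p')ᘁ) (Y₀ := (F p)ᘁ) (fun _ => inferInstance) (fun a => (h a).1) hc
  exact fun t => ⟨HasRightDual.hasLeftDual_of_isRCategory hR hd t, hd t⟩

end Cover

section Criterion

variable {M N T : Type w} [Category.{v} M] [Category.{v} N] [Category.{v} T] [Abelian M]
  [Abelian N] [Abelian T] [MonoidalCategory T] [MonoidalPreadditive T]
  [∀ a : T, PreservesFiniteColimits (tensorLeft a)]
  [∀ a : T, PreservesFiniteColimits (tensorRight a)]
  (hM : IsFiniteLength M) (hN : IsFiniteLength N) (hT : IsFiniteLength T) (F : M × N ⥤ T)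
  [∀ x : M, (Prod.sectR x N ⋙ F).Additive] [∀ y : N, (Prod.sectL M y ⋙ F).Additive]
  [∀ x : M, PreservesFiniteColimits (Prod.sectR x N ⋙ F)]
  [∀ y : N, PreservesFiniteColimits (Prod.sectL M y ⋙ F)]
  [∀ x : M, PreservesFiniteLimits (Prod.sectR x N ⋙ F)]
  [∀ y : N, PreservesFiniteLimits (Prod.sectL M y ⋙ F)]
  (hl : ∀ p : M × N, Nonempty (HasLeftDual (F.obj p)))
  (hr : ∀ p : M × N, Nonempty (HasRightDual (F.obj p)))

include hM hN hT hl hr in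
-- Tensoring with an object `F p` is exact because it has both duals, and `F` is exact in each
-- variable. So both sides are additive in each of the four arguments and are compared on simple
-- ones.
theorem length_eq_of_simple
    (h : ∀ (a' b' : M) (a'' b'' : N), Simple a' → Simple b' → Simple a'' → Simple b'' →
      LengthEquality (F.obj (a', a'')) (F.obj (b', b''))) (p q : M × N) :
    length (F.obj p ⊗ F.obj q) = factorLength hT (F.obj p) (F.obj q) := by
  have := fun p : M × N => preservesFiniteLimits_tensorLeft _ (hr p)
  have := fun p : M × N => preservesFiniteLimits_tensorRight _ (hl p)
  have h0 := isAdditiveOnExact_length hT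
  obtain ⟨a', a''⟩ := p
  obtain ⟨b', b''⟩ := q
  refine IsAdditiveOnExact.ext hM ((h0.comp (tensorRight (F.obj (b', b'')))).comp
    (Prod.sectL M a'' ⋙ F)) ((isAdditiveOnExact_factorLength_left hT (F.obj (b', b''))).comp
    (Prod.sectL M a'' ⋙ F)) (fun a' ha' => ?_) a'
  refine IsAdditiveOnExact.ext hN ((h0.comp (tensorRight (F.obj (b', b'')))).comp
    (Prod.sectR a' N ⋙ F)) ((isAdditiveOnExact_factorLength_left hT (F.obj (b', b''))).comp
    (Prod.sectR a' N ⋙ F)) (fun a'' ha'' => ?_) a''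
  refine IsAdditiveOnExact.ext hM ((h0.comp (tensorLeft (F.obj (a', a'')))).comp
    (Prod.sectL M b'' ⋙ F)) ((isAdditiveOnExact_factorLength_right hT (F.obj (a', a''))).comp
    (Prod.sectL M b'' ⋙ F)) (fun b' hb' => ?_) b'
  refine IsAdditiveOnExact.ext hN ((h0.comp (tensorLeft (F.obj (a', a'')))).comp
    (Prod.sectR b' N ⋙ F)) ((isAdditiveOnExact_factorLength_right hT (F.obj (a', a''))).comp
    (Prod.sectR b' N ⋙ F)) (fun b'' hb'' => ?_) b''
  exact (lengthEquality_iff hT _ _).1 (h a' b' a'' b'' ha' hb' ha'' hb'')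

variable (hq : ∀ t : T, ∃ (p : M × N) (π : F.obj p ⟶ t), Epi π)

include hM hN hT hl hr hq in
theorem tfae_isRigid (hR : IsRCategory T) :
    List.TFAE
      [ IsRigid T,
        TensorIsLeftExact T,
        ∀ a b : T, LengthEquality a b,
        ∀ (a' b' : M) (a'' b'' : N), Simple a' → Simple b' → Simple a'' → Simple b'' →
          LengthEquality (F.obj (a', a'')) (F.obj (b', b'')) ] := by
  tfae_have 1 → 2 := tensorIsLeftExact_of_isRigid
  tfae_have 2 → 1 := isRigid_of_tensorIsLeftExact F.obj hr hq hR
  tfae_have 2 → 3 := fun h a b =>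
    (lengthEquality_iff hT a b).2 (length_eq_of_tensorIsLeftExact hT h a b)
  tfae_have 3 → 4 := fun h _ _ _ _ _ _ _ _ => h _ _
  tfae_have 4 → 2 := fun h => tensorIsLeftExact_of_length_eq hT fun a b => by
    obtain ⟨p, π, _⟩ := hq a
    obtain ⟨p', π', _⟩ := hq b
    exact length_eq_of_epi_left hT π (length_eq_of_epi_right hT π'
      (length_eq_of_simple hM hN hT F hl hr h p p'))
  tfae_finish

end Criterion

/-! ### Adjoints, exactness and linearity -/

section Exactness

theorem additive_of_preservesFiniteColimits {C D : Type*} [Category* C] [Category* D]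
    [Preadditive C] [Preadditive D] [HasZeroObject C] [HasBinaryBiproducts C] [HasZeroObject D]
    (G : C ⥤ D) [PreservesFiniteColimits G] : G.Additive := by
  have := Functor.preservesZeroMorphisms_of_preserves_initial_object (F := G)
  have := preservesBinaryBiproducts_of_preservesBinaryCoproducts G
  exact Functor.additive_of_preservesBinaryBiproducts G

theorem isLeftAdjoint_of_existsUnique {C D : Type*} [Category* C] [Category* D] (G : C ⥤ D)
    (h : ∀ Z : D, ∃ (R : C) (v : G.obj R ⟶ Z), ∀ (X : C) (φ : G.obj X ⟶ Z),
      ∃! f : X ⟶ R, G.map f ≫ v = φ) : G.IsLeftAdjoint := by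
  choose R v h using h
  choose l hl hl' using h
  exact (Adjunction.adjunctionOfEquivRight (G_obj := R) (fun X Z =>
    { toFun φ := l Z X φ
      invFun f := G.map f ≫ v Z
      left_inv φ := hl Z X φ
      right_inv f := (hl' Z X _ f rfl).symm }) (fun X' X Z f g => by
        refine (hl' Z X' _ _ ?_).symm
        change G.map (f ≫ l Z X g) ≫ v Z = G.map f ≫ g
        rw [G.map_comp, Category.assoc, hl])).isLeftAdjoint

theorem adjunction_linear {k : Type*} [Semiring k] {C D : Type*} [Category* C] [Category* D]
    [Preadditive C] [Preadditive D] [Linear k C] [Linear k D] {F : C ⥤ D} {G : D ⥤ C}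
    (adj : F ⊣ G) [F.Linear k] : G.Linear k where
  map_smul {X Y} f r := by
    apply (adj.homEquiv _ _).symm.injective
    rw [adj.homEquiv_counit, adj.homEquiv_counit, F.map_smul, Linear.smul_comp,
      adj.counit_naturality, adj.counit_naturality, Linear.comp_smul]

variable {C D : Type*} [Category* C] [Category* D] [Abelian C] [Abelian D]

theorem preservesFiniteColimits_of_epi_map (G : C ⥤ D) [G.Additive] [PreservesFiniteLimits G]
    (h : ∀ S : ShortComplex C, S.ShortExact → Epi (G.map S.g)) : PreservesFiniteColimits G :=
  (Functor.preservesFiniteColimits_iff_forall_exact_map_and_epi G).2 fun S hS =>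
    ⟨((Functor.preservesFiniteLimits_iff_forall_exact_map_and_mono G).1 ‹_› S hS).1, h S hS⟩

/-- A right adjoint is right exact if the left adjoint preserves projective objects. -/
theorem preservesFiniteColimits_rightAdjoint [EnoughProjectives C] {F : C ⥤ D} {G : D ⥤ C}
    (adj : F ⊣ G) [F.Additive] (h : ∀ P : C, Projective P → Projective (F.obj P)) :
    PreservesFiniteColimits G := by
  have := adj.right_adjoint_additive
  have : PreservesLimitsOfSize.{0, 0} G := adj.rightAdjoint_preservesLimits
  have : PreservesFiniteLimits G := PreservesLimitsOfSize.preservesFiniteLimits.{0, 0} _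
  refine preservesFiniteColimits_of_epi_map G fun S hS => ?_
  have := hS.epi_g
  have := h (Projective.over (G.obj S.X₃)) inferInstance
  -- A projective mapping onto `G X₃` transposes to a map from a projective object to `X₃`, which
  -- lifts through `S.g`; the transpose of the lift factors the epimorphism through `G.map S.g`.
  let l := adj.homEquiv _ _
    (Projective.factorThru ((adj.homEquiv _ _).symm (Projective.π (G.obj S.X₃))) S.g)
  refine epi_of_epi_fac (f := l) (h := Projective.π (G.obj S.X₃)) ?_
  rw [← adj.homEquiv_naturality_right, Projective.factorThru_comp, Equiv.apply_symm_apply]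

end Exactness

section Progenerator

variable {k : Type u} [Field k] {C : Type w} [Category.{v} C]

theorem IsProgenerator.finite_hom [Preadditive C] [Linear k C] [HasBinaryBiproducts C] {P : C}
    (hP : IsProgenerator k P) (X Y : C) : Module.Finite k (X ⟶ Y) := by
  have free {A : C} (hA : IsFree P A) : Module.Finite k (A ⟶ Y) := by
    induction hA with
    | zero hA =>
      have : Subsingleton (_ ⟶ Y) := ⟨fun f g => hA.eq_of_src f g⟩
      infer_instance
    | self => exact hP.finite Y
    | @biprod A A' _ _ h h' =>
      let φ : (A ⊞ A' ⟶ Y) →ₗ[k] (A ⟶ Y) × (A' ⟶ Y) :=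
        (Linear.leftComp k Y biprod.inl).prod (Linear.leftComp k Y biprod.inr)
      exact Module.Finite.of_injective φ fun f g h => biprod.hom_ext' _ _
        (congrArg Prod.fst h) (congrArg Prod.snd h)
  obtain ⟨A, hA, a, _⟩ := hP.exists_epi X
  have := free hA
  exact Module.Finite.of_injective (Linear.leftComp k Y a) fun f g h => (cancel_epi a).1 h

theorem IsCokernelProjective.projective [Abelian C] {P : C} (hP : IsCokernelProjective P) :
    Projective P where
  factors f e _ := hP.lift (shortExact_kernel e).gIsCokernel f

theorem IsProgenerator.enoughProjectives [Abelian C] [Linear k C] {P : C}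
    (hP : IsProgenerator k P) : EnoughProjectives C where
  presentation X := by
    obtain ⟨A, hA, a, ha⟩ := hP.exists_epi X
    exact ⟨{ p := A, projective := (hP.projective.of_isFree hA).projective, f := a, epi := ha }⟩

end Progenerator

section Monoidal

variable {T : Type w} [Category.{v} T] [Preadditive T] [MonoidalCategory T]

theorem monoidalPreadditive_of_additive (h : ∀ a : T, (tensorLeft a).Additive)
    (h' : ∀ a : T, (tensorRight a).Additive) : MonoidalPreadditive T where
  whiskerLeft_zero {a _ _} := (tensorLeft a).map_zero _ _
  zero_whiskerRight {a _ _} := (tensorRight a).map_zero _ _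
  whiskerLeft_add {a _ _} _ _ := (tensorLeft a).map_add
  add_whiskerRight {a _ _} _ _ := (tensorRight a).map_add

variable {k : Type u} [Field k] [Linear k T] [MonoidalPreadditive T]
  {M N : Type w} [Category.{v} M] [Category.{v} N] [Preadditive M] [Linear k M]
  [MonoidalCategory M] [MonoidalCategory N] [MonoidalPreadditive M] [MonoidalLinear k M]

/-- On `F p` a scalar is the image of the scalar on the first component, so whiskering respects
scalars on such objects because `F` is monoidal. Tensor products of epimorphisms are epi, which
extends this to quotients. -/
theorem monoidalLinear_of_epi (F : M × N ⥤ T) [F.Monoidal]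
    (hF : ∀ y : N, (Prod.sectL M y ⋙ F).Linear k)
    [∀ a : T, PreservesFiniteColimits (tensorLeft a)]
    [∀ a : T, PreservesFiniteColimits (tensorRight a)]
    (hq : ∀ t : T, ∃ (p : M × N) (π : F.obj p ⟶ t), Epi π) : MonoidalLinear k T := by
  have hF' (p : M × N) (r : k) : F.map ((r • 𝟙 p.1) ×ₘ 𝟙 p.2) = r • 𝟙 (F.obj p) := by
    have := hF p.2
    have h := (Prod.sectL M p.2 ⋙ F).map_smul (r : k) (𝟙 p.1)
    rw [CategoryTheory.Functor.map_id] at h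
    exact h
  have hbox (p q : M × N) (r : k) : F.obj p ◁ (r • 𝟙 (F.obj q)) = r • 𝟙 (F.obj p ⊗ F.obj q) := by
    have h : F.map (p ◁ ((r • 𝟙 q.1) ×ₘ 𝟙 q.2)) = r • 𝟙 (F.obj (p ⊗ q)) := by
      rw [← hF' (p ⊗ q) r]
      congr 1
      ext
      · exact (MonoidalLinear.whiskerLeft_smul _ _ _).trans
          (congrArg (r • ·) (MonoidalCategory.whiskerLeft_id _ _))
      · exact MonoidalCategory.whiskerLeft_id _ _
    rw [Functor.Monoidal.map_whiskerLeft, hF'] at h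
    have h' := Functor.LaxMonoidal.μ F p q ≫= h =≫ Functor.OplaxMonoidal.δ F p q
    simpa using h'
  have hbox' (p q : M × N) (r : k) : (r • 𝟙 (F.obj p)) ▷ F.obj q = r • 𝟙 (F.obj p ⊗ F.obj q) := by
    have h : F.map (((r • 𝟙 p.1) ×ₘ 𝟙 p.2) ▷ q) = r • 𝟙 (F.obj (p ⊗ q)) := by
      rw [← hF' (p ⊗ q) r]
      congr 1
      ext
      · exact (MonoidalLinear.smul_whiskerRight _ _ _).trans
          (congrArg (r • ·) (MonoidalCategory.id_whiskerRight _ _))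
      · exact MonoidalCategory.id_whiskerRight _ _
    rw [Functor.Monoidal.map_whiskerRight, hF'] at h
    have h' := Functor.LaxMonoidal.μ F p q ≫= h =≫ Functor.OplaxMonoidal.δ F p q
    simpa using h'
  have key {p q : M × N} {a b : T} (π : F.obj p ⟶ a) [Epi π] (τ : F.obj q ⟶ b) [Epi τ] :
      Epi (π ⊗ₘ τ) := by
    have : Epi (π ▷ F.obj q) := inferInstanceAs (Epi ((tensorRight _).map π))
    have : Epi (a ◁ τ) := inferInstanceAs (Epi ((tensorLeft a).map τ))
    rw [MonoidalCategory.tensorHom_def]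
    infer_instance
  have hid (a b : T) (r : k) : a ◁ (r • 𝟙 b) = r • 𝟙 (a ⊗ b) := by
    obtain ⟨p, π, _⟩ := hq a
    obtain ⟨q, τ, _⟩ := hq b
    have := key π τ
    rw [← cancel_epi (π ⊗ₘ τ), tensorHom_def', Category.assoc, ← whisker_exchange,
      ← MonoidalCategory.whiskerLeft_comp_assoc, Linear.comp_smul, Category.comp_id,
      ← Category.id_comp τ, ← Linear.smul_comp, MonoidalCategory.whiskerLeft_comp_assoc, hbox]
    simp
  have hid' (a b : T) (r : k) : (r • 𝟙 a) ▷ b = r • 𝟙 (a ⊗ b) := by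
    obtain ⟨p, π, _⟩ := hq a
    obtain ⟨q, τ, _⟩ := hq b
    have := key π τ
    rw [← cancel_epi (π ⊗ₘ τ), MonoidalCategory.tensorHom_def, Category.assoc, whisker_exchange,
      ← comp_whiskerRight_assoc, Linear.comp_smul, Category.comp_id,
      ← Category.id_comp π, ← Linear.smul_comp, comp_whiskerRight_assoc, hbox']
    simp
  exact
    { whiskerLeft_smul a b c r f := by
        rw [← Category.comp_id f, ← Linear.comp_smul, MonoidalCategory.whiskerLeft_comp, hid]
        simp
      smul_whiskerRight r b c f a := by
        rw [← Category.comp_id f, ← Linear.comp_smul, comp_whiskerRight, hid']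
        simp }

end Monoidal

open scoped ZeroObject

section ObjectProperty

variable {T : Type*} [Category* T] [Preadditive T] (Q : ObjectProperty T)
  [Q.IsClosedUnderIsomorphisms]

theorem isClosedUnderFiniteCoproducts_of_biprod [HasZeroObject T] [HasBinaryBiproducts T]
    (zero : ∀ {Z : T}, IsZero Z → Q Z) (hbiprod : ∀ {X Y : T}, Q X → Q Y → Q (X ⊞ Y)) :
    Q.IsClosedUnderFiniteCoproducts := by
  have : Q.ContainsZero := ⟨⟨0, isZero_zero T, zero (isZero_zero T)⟩⟩
  have : Q.IsClosedUnderBinaryCoproducts := ⟨fun X ⟨p⟩ => Q.prop_of_iso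
    (biprod.isoCoprod _ _ ≪≫ (p.isColimit.coconePointsIsoOfNatIso
      (colimit.isColimit _) (diagramIsoPair p.diag)).symm)
    (hbiprod (p.prop_diag_obj _) (p.prop_diag_obj _))⟩
  have := hasFiniteCoproducts_of_has_binary_and_initial (C := T)
  exact .mk'

theorem isClosedUnderCoequalizers_of_cokernels [HasCoequalizers T]
    (cokernel : ∀ {X Y Z : T} (f : X ⟶ Y) (π : Y ⟶ Z) (w : f ≫ π = 0),
      IsColimit (CokernelCofork.ofπ π w) → Q X → Q Y → Q Z) :
    Q.IsClosedUnderColimitsOfShape WalkingParallelPair := ⟨fun _ ⟨p⟩ => Q.prop_of_iso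
  (p.isColimit.coconePointsIsoOfNatIso (colimit.isColimit _)
    (diagramIsoParallelPair p.diag)).symm
  (cokernel _ _ (Preadditive.cokernelCoforkOfCofork (coequalizer.cofork _ _)).condition
    (Preadditive.isColimitCokernelCoforkOfCofork (colimit.isColimit _))
    (p.prop_diag_obj _) (p.prop_diag_obj _))⟩

end ObjectProperty

section InternalHom

open scoped MonoidalLeftAction
open ModuleHom

variable {k : Type u} [Field k] {C N : Type w} [Category.{v} C] [Category.{v} N]
  [Abelian C] [Linear k C] [MonoidalCategory C] [Abelian N] [Linear k N] [MonoidalLeftAction C N]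

/-- Preservation of projectives makes the right adjoint `[n, -]` right exact, so it has a right
adjoint too. Only the value of the latter at `𝟙` is recorded; rigidity yields the others. -/
theorem exists_rightAdjoint_actOn {PC : C} (hPC : IsProgenerator k PC) {PN : N}
    (hPN : IsProgenerator k PN) (n : N) [(actOn C n).Linear k]
    [PreservesFiniteColimits (actOn C n)]
    (hproj : ∀ c : C, Projective c → Projective (c ⊙ₗ n)) :
    ∃ (E : N ⥤ C) (_ : actOn C n ⊣ E), (PreservesFiniteColimits E) ∧
      ∃ (n₁ : N) (e : E.obj n₁ ⟶ 𝟙_ C), ∀ (y : N) (φ : E.obj y ⟶ 𝟙_ C),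
        ∃! f : y ⟶ n₁, E.map f ≫ e = φ := by
  have : (actOn C n).Additive := additive_of_preservesFiniteColimits _
  have := hPC.enoughProjectives
  have : (actOn C n).IsLeftAdjoint := isLeftAdjoint_of_existsUnique _ fun Z => by
    have := hPN.finite_hom ((actOn C n).obj PC) Z
    exact hPC.exists_universal (actOn C n) (preservesCokernels _) Z
  let adj := Adjunction.ofIsLeftAdjoint (actOn C n)
  have hE := preservesFiniteColimits_rightAdjoint adj hproj
  have := adj.right_adjoint_additive
  have : Functor.Linear k (actOn C n).rightAdjoint := adjunction_linear adj
  have := hPC.finite_hom ((actOn C n).rightAdjoint.obj PN) (𝟙_ C)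
  exact ⟨_, adj, hE, hPN.exists_universal _ (preservesCokernels _) _⟩

end InternalHom

/-! ### A progenerator of the tensor product -/

namespace BalancedFunctor

open scoped MonoidalLeftAction MonoidalRightAction
open ModuleHom

section Adjunction

variable {k : Type u} [Field k] {C M N T : Type w} [Category.{v} C] [Category.{v} M]
  [Category.{v} N] [Category.{v} T] [Abelian C] [Linear k C] [MonoidalCategory C]
  [HasFiniteColimits M] [Abelian N] [Linear k N] {ρ : MonoidalRightAction C M}
  {σ : MonoidalLeftAction C N} [HasFiniteColimits T] {B : BalancedFunctor ρ σ T}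

/-- The pair `(n₁, e)` represents only `Hom([n, -], 𝟙)`; duals in `C` upgrade it to the adjunction
that `exists_mono_map` needs. -/
theorem IsTensorProduct.exists_adjunction (hB : B.IsTensorProduct)
    (hC : ∀ c : C, Nonempty (HasRightDual c)) {PC : C} (hPC : IsProgenerator k PC) {PN : N}
    (hPN : IsProgenerator k PN) (h₁ : ∀ c : C, PreservesFiniteColimits (actRight ρ c))
    (h₂ : ∀ x : M, PreservesFiniteColimits (actLeft ρ x)) (n : N) [(actOn C n).Linear k]
    [PreservesFiniteColimits (actOn C n)]
    (hproj : ∀ c : C, Projective c → Projective (c ⊙ₗ n)) :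
    ∃ (G : T ⥤ M) (_ : B.boxL n ⊣ G) (_ : PreservesFiniteColimits G) (n₁ : N),
      ∀ t : T, ∃ η : t ⟶ B.box (G.obj t) n₁, Mono (G.map η) := by
  obtain ⟨E, adj, _, n₁, e, he⟩ := exists_rightAdjoint_actOn hPC hPN n hproj
  let H := InternalHom.ofAdjunction adj
  have (c : C) (y : N) : IsIso (strength H c y) := by
    obtain ⟨_⟩ := hC c
    exact isIso_strength H c cᘁ y
  obtain ⟨F⟩ := hB.nonempty_homFunctor H h₁ h₂
  refine ⟨F.functor, boxAdjunction hB F, F.preservesFiniteColimits, n₁, fun t =>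
    exists_mono_map hB F e (fun c y f g h => ?_) (fun y => ?_) t⟩
  · obtain ⟨_⟩ := hC c
    exact costrength_ext H e (fun y f g h => (he y _).unique h rfl) (c' := cᘁ) h
  · obtain ⟨_⟩ := hC (E.obj y)
    exact costrength_surjective H e (fun y φ => (he y φ).exists) (c' := (E.obj y)ᘁ) _

end Adjunction

section Progenerator

variable {k : Type u} [Field k] {C M N T : Type w} [Category.{v} C] [Category.{v} M]
  [Category.{v} N] [Category.{v} T] [MonoidalCategory C]
  [Abelian M] [Linear k M] [Abelian N] [Linear k N] {ρ : MonoidalRightAction C M}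
  {σ : MonoidalLeftAction C N} [HasFiniteColimits T] [Preadditive T] [Linear k T]
  [HasZeroObject T] [HasBinaryBiproducts T] {B : BalancedFunctor ρ σ T}

omit [Linear k T] in
-- The objects presented by `PM ⊠ PN` are closed under finite colimits. They include every `x ⊠ y`:
-- first present `y` by `PN`, then `x` by `PM`.
theorem isFinitelyPresented_of_isTensorProduct (hB : B.IsTensorProduct) {PM : M} {PN : N}
    (hPM : IsProgenerator k PM) (hPN : IsProgenerator k PN)
    (hP : IsCokernelProjective (B.box PM PN)) (t : T) :
    IsFinitelyPresented (B.box PM PN) t := by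
  have (x : M) : PreservesFiniteColimits (Prod.sectR x N ⋙ B.functor) := B.rightExact_right x
  have (x : M) : (Prod.sectR x N ⋙ B.functor).Additive := additive_of_preservesFiniteColimits _
  have (y : N) : (B.boxL y).Additive := additive_of_preservesFiniteColimits _
  let Q : ObjectProperty T := fun t => IsFinitelyPresented (B.box PM PN) t
  have zero {Z : T} (hZ : IsZero Z) : Q Z := IsFinitelyPresented.of_isFree (.zero hZ) Z hZ
  have cokernel {X Y Z : T} (f : X ⟶ Y) (π : Y ⟶ Z) (w : f ≫ π = 0)
      (h : IsColimit (CokernelCofork.ofπ π w)) (hX : Q X) (hY : Q Y) : Q Z :=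
    IsFinitelyPresented.cokernel hP h hX hY
  have : Q.IsClosedUnderIsomorphisms := ⟨fun e h => h.of_iso e⟩
  have := isClosedUnderFiniteCoproducts_of_biprod Q zero fun h h' => h.biprod h'
  have := isClosedUnderCoequalizers_of_cokernels Q cokernel
  have hself : Q (B.box PM PN) := IsFinitelyPresented.of_isFree .self 0 (isZero_zero T)
  refine hB.induction Q (fun ⟨x, y⟩ => ?_) t
  have h1 : Q ((Prod.sectR PM N ⋙ B.functor).obj y) :=
    (hPN.presented y).induction _ (preservesCokernels _) Q (fun e h => h.of_iso e) zero
      (fun h h' => h.biprod h') cokernel hself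
  exact (hPM.presented x).induction (B.boxL y) (preservesCokernels _) Q (fun e h => h.of_iso e)
    zero (fun h h' => h.biprod h') cokernel h1

/-- `Hom(PM ⊠ PN, -)` is `Hom(PM, G -)`, a composite of functors preserving cokernels. -/
theorem isProgenerator_box (hB : B.IsTensorProduct) {PM : M} {PN : N}
    (hPM : IsProgenerator k PM) (hPN : IsProgenerator k PN) {G : T ⥤ M} [PreservesFiniteColimits G]
    (adj : B.boxL PN ⊣ G) [(B.boxL PN).Linear k] : IsProgenerator k (B.box PM PN) := by
  have : (B.boxL PN).Additive := additive_of_preservesFiniteColimits _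
  have := adj.right_adjoint_additive
  have := adjunction_linear (k := k) adj
  let e (t : T) : (B.box PM PN ⟶ t) ≃ (PM ⟶ G.obj t) := adj.homEquiv PM t
  have e_nat {t t' : T} (f : B.box PM PN ⟶ t) (g : t ⟶ t') : e t' (f ≫ g) = e t f ≫ G.map g :=
    adj.homEquiv_naturality_right f g
  have e_zero (t : T) : e t 0 = 0 := by
    have := e_nat (0 : B.box PM PN ⟶ t) (0 : t ⟶ t)
    simpa using this
  have hP : IsCokernelProjective (B.box PM PN) :=
    { lift {X Y Z f π w} h g := by
        obtain ⟨h'⟩ := preservesCokernels G w h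
        obtain ⟨l, hl⟩ := hPM.projective.lift h' (e Z g)
        refine ⟨(e Y).symm l, (e Z).injective ?_⟩
        rw [e_nat, Equiv.apply_symm_apply, hl]
      exact {X Y Z f π w} h g hg := by
        obtain ⟨h'⟩ := preservesCokernels G w h
        obtain ⟨l, hl⟩ := hPM.projective.exact h' (e Y g) (by rw [← e_nat, hg, e_zero])
        refine ⟨(e X).symm l, (e Y).injective ?_⟩
        rw [e_nat, Equiv.apply_symm_apply, hl] }
  refine ⟨hP, isFinitelyPresented_of_isTensorProduct hB hPM hPN hP, fun t => ?_⟩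
  have := hPM.finite (G.obj t)
  let φ : (PM ⟶ G.obj t) →ₗ[k] ((B.boxL PN).obj PM ⟶ t) :=
    { toFun f := (B.boxL PN).map f ≫ adj.counit.app t
      map_add' f g := by rw [Functor.map_add, Preadditive.add_comp]
      map_smul' r f := by rw [Functor.map_smul, Linear.smul_comp]; rfl }
  exact Module.Finite.of_surjective φ fun g =>
    ⟨e t g, (adj.homEquiv_counit PM t (e t g)).symm.trans ((e t).symm_apply_apply g)⟩

omit [Abelian N] [HasFiniteColimits T] in
-- Additivity of `- ⊠ y` absorbs direct sums into the first variable, so free covers remain of the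
-- form `x ⊠ y` and hence have duals.
theorem exists_box_of_isFree {PM : M} {y : N} {A : T} (hA : IsFree (B.box PM y) A) :
    ∃ x : M, Nonempty (B.box x y ≅ A) := by
  have : (B.boxL y).Additive := additive_of_preservesFiniteColimits _
  induction hA with
  | zero hA => exact ⟨0, ⟨((B.boxL y).map_isZero (isZero_zero M)).iso hA⟩⟩
  | self => exact ⟨PM, ⟨Iso.refl _⟩⟩
  | biprod _ _ h h' =>
    obtain ⟨x, ⟨i⟩⟩ := h
    obtain ⟨x', ⟨i'⟩⟩ := h'
    have := preservesBinaryBiproducts_of_preservesBiproducts (B.boxL y)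
    exact ⟨x ⊞ x', ⟨(B.boxL y).mapBiprod x x' ≪≫ biprod.mapIso i i'⟩⟩

end Progenerator

end BalancedFunctor

/-! ### Exactness of the functor `⊠` in each variable -/

theorem mono_map_of_mate {A T : Type*} [Category* A] [MonoidalCategory A] [Category* T]
    [MonoidalCategory T] (F : A ⥤ T) [F.Monoidal] {X X' Y Y' : A} [ExactPairing X X']
    [ExactPairing Y Y'] (f : X ⟶ Y) (g : Y' ⟶ X')
    (h : g ▷ X ≫ ε_ X X' = Y' ◁ f ≫ ε_ Y Y') (hg : ∀ t : T, Epi (F.map g ▷ t)) :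
    Mono (F.map f) := by
  let := mapExactPairing F X X'
  let := mapExactPairing F Y Y'
  refine mono_of_evaluation (F.map f) (F.map g) ?_ hg
  change F.map g ▷ F.obj X ≫ Functor.LaxMonoidal.μ F X' X ≫ F.map (ε_ X X') ≫
      Functor.OplaxMonoidal.η F = F.obj Y' ◁ F.map f ≫ Functor.LaxMonoidal.μ F Y' Y ≫
      F.map (ε_ Y Y') ≫ Functor.OplaxMonoidal.η F
  rw [Functor.LaxMonoidal.μ_natural_left_assoc, ← F.map_comp_assoc, h, F.map_comp_assoc,
    Functor.LaxMonoidal.μ_natural_right_assoc]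

section Rigid

variable {M N T : Type w} [Category.{v} M] [Category.{v} N] [Category.{v} T]
  [MonoidalCategory M] [MonoidalCategory N] [MonoidalCategory T] (hM : IsRigid M) (hN : IsRigid N)
  (F : M × N ⥤ T) [F.Monoidal]

include hM hN

theorem IsRigid.hasRightDual_map (p : M × N) : Nonempty (HasRightDual (F.obj p)) := by
  obtain ⟨x, y⟩ := p
  obtain ⟨_⟩ := (hM x).2
  obtain ⟨_⟩ := (hN y).2
  let := prodExactPairing x xᘁ y yᘁ
  exact ⟨{ rightDual := F.obj (xᘁ, yᘁ), exact := mapExactPairing F (x, y) (xᘁ, yᘁ) }⟩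

theorem IsRigid.hasLeftDual_map (p : M × N) : Nonempty (HasLeftDual (F.obj p)) := by
  obtain ⟨x, y⟩ := p
  obtain ⟨_⟩ := (hM x).1
  obtain ⟨_⟩ := (hN y).1
  let := prodExactPairing (ᘁx) x (ᘁy) y
  exact ⟨{ leftDual := F.obj (ᘁx, ᘁy), exact := mapExactPairing F (ᘁx, ᘁy) (x, y) }⟩

variable [∀ t : T, PreservesFiniteColimits (tensorRight t)]

/-- In a rigid category the mate of a monomorphism is an epimorphism. Right exactness keeps it epi
after applying `F`, and passing back to mates in `T` gives a monomorphism. -/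
theorem IsRigid.mono_map_sectR (x : M) [∀ x : M, PreservesFiniteColimits (Prod.sectR x N ⋙ F)]
    {y y' : N} (f : y ⟶ y') [Mono f] : Mono ((Prod.sectR x N ⋙ F).map f) := by
  obtain ⟨_⟩ := (hM x).2
  obtain ⟨_⟩ := (hN y).2
  obtain ⟨_⟩ := (hN y').2
  obtain ⟨g, hg, hg'⟩ := exists_mate (X' := yᘁ) (Y' := y'ᘁ) f
  have : Epi g := epi_of_coevaluation f g hg' fun t => by
    have := preservesFiniteLimits_tensorRight t (hN t).1
    exact inferInstanceAs (Mono ((tensorRight t).map f))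
  have : Epi (F.map (𝟙 xᘁ ×ₘ g)) := inferInstanceAs (Epi ((Prod.sectR xᘁ N ⋙ F).map g))
  let := prodExactPairing x xᘁ y yᘁ
  let := prodExactPairing x xᘁ y' y'ᘁ
  refine mono_map_of_mate F (𝟙 x ×ₘ f) (𝟙 xᘁ ×ₘ g) ?_
    fun t => inferInstanceAs (Epi ((tensorRight t).map _))
  refine Prod.ext ?_ hg
  change 𝟙 _ ▷ x ≫ ε_ x xᘁ = _ ◁ 𝟙 x ≫ ε_ x xᘁ
  simp

theorem IsRigid.mono_map_sectL (y : N) [∀ y : N, PreservesFiniteColimits (Prod.sectL M y ⋙ F)]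
    {x x' : M} (f : x ⟶ x') [Mono f] : Mono ((Prod.sectL M y ⋙ F).map f) := by
  obtain ⟨_⟩ := (hN y).2
  obtain ⟨_⟩ := (hM x).2
  obtain ⟨_⟩ := (hM x').2
  obtain ⟨g, hg, hg'⟩ := exists_mate (X' := xᘁ) (Y' := x'ᘁ) f
  have : Epi g := epi_of_coevaluation f g hg' fun t => by
    have := preservesFiniteLimits_tensorRight t (hM t).1
    exact inferInstanceAs (Mono ((tensorRight t).map f))
  have : Epi (F.map (g ×ₘ 𝟙 yᘁ)) := inferInstanceAs (Epi ((Prod.sectL M yᘁ ⋙ F).map g))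
  let := prodExactPairing x xᘁ y yᘁ
  let := prodExactPairing x' x'ᘁ y yᘁ
  refine mono_map_of_mate F (f ×ₘ 𝟙 y) (g ×ₘ 𝟙 yᘁ) ?_
    fun t => inferInstanceAs (Epi ((tensorRight t).map _))
  refine Prod.ext hg ?_
  change 𝟙 _ ▷ y ≫ ε_ y yᘁ = _ ◁ 𝟙 y ≫ ε_ y yᘁ
  simp

end Rigid

/-- The consequences of the existence of rigid projective covers and of embeddings into rigid
objects. -/
theorem isRCategory_and_tfae (k : Type u) [Field k] {M N T : Type w} [Category.{v} M]
    [Category.{v} N] [Category.{v} T] [Abelian M] [Abelian N] [Abelian T] [Linear k M]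
    [Linear k N] [Linear k T] [MonoidalCategory M] [MonoidalCategory N] [MonoidalCategory T]
    [IsFiniteMonoidal k M] [IsFiniteMonoidal k N] [IsFiniteMonoidal k T] (hM : IsRigid M)
    (hN : IsRigid N) (F : M × N ⥤ T) [F.Monoidal]
    [∀ x : M, PreservesFiniteColimits (Prod.sectR x N ⋙ F)]
    [∀ y : N, PreservesFiniteColimits (Prod.sectL M y ⋙ F)]
    (hη : ∀ t : T, ∃ (p : M × N) (η : t ⟶ F.obj p), Mono η)
    (hπ : ∀ t : T, ∃ (p : M × N) (π : F.obj p ⟶ t), Epi π ∧ Projective (F.obj p)) :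
    IsRCategory T ∧
    List.TFAE
      [ IsRigid T,
        TensorIsLeftExact T,
        ∀ a b : T, LengthEquality a b,
        ∀ (a' b' : M) (a'' b'' : N), Simple a' → Simple b' → Simple a'' → Simple b'' →
          LengthEquality (F.obj (a', a'')) (F.obj (b', b'')) ] ∧
    ((∀ (x : M) (y : N), Simple x → Simple y → IsSemisimpleObject (F.obj (x, y))) →
      IsRigid T) := by
  have (a : T) := IsFiniteMonoidal.rightExact_tensorLeft (k := k) a
  have (a : T) := IsFiniteMonoidal.rightExact_tensorRight (k := k) a
  obtain ⟨PM, hPM, -⟩ := (IsFiniteMonoidal.isFinite (k := k) (C := M)).exists_isProgenerator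
  obtain ⟨PN, hPN, -⟩ := (IsFiniteMonoidal.isFinite (k := k) (C := N)).exists_isProgenerator
  obtain ⟨PT, hPT, -⟩ := (IsFiniteMonoidal.isFinite (k := k) (C := T)).exists_isProgenerator
  have (x : M) : (Prod.sectR x N ⋙ F).Additive := additive_of_preservesFiniteColimits _
  have (y : N) : (Prod.sectL M y ⋙ F).Additive := additive_of_preservesFiniteColimits _
  have (x : M) : PreservesFiniteLimits (Prod.sectR x N ⋙ F) :=
    preservesFiniteLimits_of_mono_map _ fun S hS => by
      have := hS.mono_f
      exact hM.mono_map_sectR hN F x S.f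
  have (y : N) : PreservesFiniteLimits (Prod.sectL M y ⋙ F) :=
    preservesFiniteLimits_of_mono_map _ fun S hS => by
      have := hS.mono_f
      exact hM.mono_map_sectL hN F y S.f
  have hl := hM.hasLeftDual_map hN F
  have hr := hM.hasRightDual_map hN F
  -- Right exact linear functors on a finite category with finite-dimensional morphism spaces have
  -- right adjoints; this yields the internal homs on both sides.
  have universal_right (x y : T) := by
    have := hPT.finite_hom ((tensorRight x).obj PT) y
    exact hPT.exists_universal (tensorRight x) (preservesCokernels _) y
  have universal_left (x y : T) := by
    have := hPT.finite_hom ((tensorLeft x).obj PT) y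
    exact hPT.exists_universal (tensorLeft x) (preservesCokernels _) y
  have hR : IsRCategory T := by
    choose D ev hD using fun x => universal_right x (𝟙_ T)
    choose D' ev' hD' using fun x => universal_left x (𝟙_ T)
    refine DualityData.isRCategory
      { D := D, D' := D', ev := ev, ev' := ev', existsUnique := hD, existsUnique' := hD' }
      (fun x y => ?_) (fun z => ?_) (fun z => ?_)
    · have := isLeftAdjoint_of_existsUnique (tensorRight x) (universal_right x)
      exact ((Adjunction.ofIsLeftAdjoint (tensorRight x)).representableBy y).isRepresentable
    · obtain ⟨p, η, h⟩ := hη z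
      exact ⟨_, η, h, hl p, hr p⟩
    · obtain ⟨p, π, h, h'⟩ := hπ z
      exact ⟨_, π, h, h', hl p, hr p⟩
  have htfae := tfae_isRigid hPM.isFiniteLength hPN.isFiniteLength hPT.isFiniteLength F hl hr
    (fun t => by
      obtain ⟨p, π, h, -⟩ := hπ t
      exact ⟨p, π, h⟩) hR
  exact ⟨hR, htfae, fun h => (htfae.out 0 3).2 fun _ _ _ _ h1 h2 h3 h4 =>
    lengthEquality_of_isSemisimpleObject hPT.isFiniteLength (h _ _ h1 h3) (h _ _ h2 h4)⟩

theorem IsCokernelProjective.of_iso {C : Type*} [Category* C] [Preadditive C] {P Q : C}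
    (hP : IsCokernelProjective P) (e : P ≅ Q) : IsCokernelProjective Q where
  lift h g := by
    obtain ⟨l, hl⟩ := hP.lift h (e.hom ≫ g)
    exact ⟨e.inv ≫ l, by rw [Category.assoc, hl, e.inv_hom_id_assoc]⟩
  exact h g hg := by
    obtain ⟨l, hl⟩ := hP.exact h (e.hom ≫ g) (by rw [Category.assoc, hg, comp_zero])
    exact ⟨e.inv ≫ l, by rw [Category.assoc, hl, e.inv_hom_id_assoc]⟩

/-- Tensoring with `z` is left adjoint to tensoring with its right dual, which preserves
epimorphisms. -/
theorem projective_tensor {N : Type*} [Category* N] [MonoidalCategory N] (n z : N) [Projective n]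
    (hz : Nonempty (HasRightDual z))
    [∀ z : N, PreservesFiniteColimits (tensorRight z)] : Projective (n ⊗ z) := by
  obtain ⟨_⟩ := hz
  exact (tensorRightAdjunction z zᘁ).map_projective n inferInstance

/-! ### Application to monoidal modules -/

section Actions

open ModuleHom

variable {k : Type u} [Field k] {C M : Type w} [Category.{v} C] [Category.{v} M]
  [Preadditive C] [Linear k C] [MonoidalCategory C] [BraidedCategory C]
  [Preadditive M] [Linear k M] [MonoidalCategory M] [IsFiniteMonoidal k M]

theorem MonoidalRightModule.preservesFiniteColimits_actRight (R : MonoidalRightModule k C M)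
    (c : C) : PreservesFiniteColimits (BalancedFunctor.actRight R.action c) :=
  IsFiniteMonoidal.rightExact_tensorRight (k := k) ((R.φ ⋙ Center.forget M).obj c)

theorem MonoidalRightModule.preservesFiniteColimits_actLeft (R : MonoidalRightModule k C M)
    (x : M) : PreservesFiniteColimits (BalancedFunctor.actLeft R.action x) := by
  have := R.rightExact
  have := IsFiniteMonoidal.rightExact_tensorLeft (k := k) x
  exact inferInstanceAs
    (PreservesFiniteColimits ((R.φ ⋙ Center.forget M) ⋙ tensorLeft x))

theorem MonoidalLeftModule.preservesFiniteColimits_actOn (L : MonoidalLeftModule k C M) (n : M) :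
    letI := L.action
    PreservesFiniteColimits (actOn C n) := by
  have := L.rightExact
  have := IsFiniteMonoidal.rightExact_tensorLeft (k := k) n
  exact inferInstanceAs
    (PreservesFiniteColimits ((mopFunctor C ⋙ L.φ ⋙ Center.forget M) ⋙ tensorLeft n))

theorem MonoidalLeftModule.linear_actOn (L : MonoidalLeftModule k C M) (n : M) :
    letI := L.action
    (actOn C n).Linear k := by
  have := L.linear
  exact inferInstanceAs
    (((mopFunctor C ⋙ L.φ ⋙ Center.forget M) ⋙ tensorLeft n).Linear k)

theorem MonoidalLeftModule.projective_actOn (L : MonoidalLeftModule k C M) (hM : IsRigid M)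
    (n : M) [Projective n] (c : C) :
    letI := L.action
    Projective ((actOn C n).obj c) := by
  have (a : M) := IsFiniteMonoidal.rightExact_tensorRight (k := k) a
  exact projective_tensor n _ (hM _).2

end Actions

/-- Everything is built from `- ⊠ PN`: projectivity of `PN` makes `[PN, -]` right exact, and its
being a generator lets objects `x ⊠ PN` cover `T`. -/
theorem isFiniteMonoidal_tensorProduct {k : Type u} [Field k]
    {C : Type w} [Category.{v} C] [Abelian C] [Linear k C] [MonoidalCategory C]
    [BraidedCategory C] [IsFiniteMonoidal k C] (hC : IsRigid C)
    {M : Type w} [Category.{v} M] [Abelian M] [Linear k M] [MonoidalCategory M]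
    [IsFiniteMonoidal k M] (R : MonoidalRightModule k C M)
    {N : Type w} [Category.{v} N] [Abelian N] [Linear k N] [MonoidalCategory N]
    [IsFiniteMonoidal k N] (hN : IsRigid N) (L : MonoidalLeftModule k C N)
    {T : Type w} [Category.{v} T] [HasFiniteColimits T] [Preadditive T] [Linear k T]
    {B : BalancedFunctor R.action L.action T} (hB : B.IsTensorProduct)
    (hB_left : ∀ y : N, (Prod.sectL M y ⋙ B.functor).Linear k)
    [MonoidalCategory T] [B.functor.Monoidal]
    (hT_left : ∀ a : T, PreservesFiniteColimits (tensorLeft a))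
    (hT_right : ∀ a : T, PreservesFiniteColimits (tensorRight a)) :
    IsFiniteMonoidal k T ∧
      (∀ t : T, ∃ (p : M × N) (η : t ⟶ B.functor.obj p), Mono η) ∧
      ∀ t : T, ∃ (p : M × N) (π : B.functor.obj p ⟶ t), Epi π ∧
        IsCokernelProjective (B.functor.obj p) := by
  obtain ⟨PC, hPC, -⟩ := (IsFiniteMonoidal.isFinite (k := k) (C := C)).exists_isProgenerator
  obtain ⟨PM, hPM, -⟩ := (IsFiniteMonoidal.isFinite (k := k) (C := M)).exists_isProgenerator
  obtain ⟨PN, hPN, _, -⟩ := (IsFiniteMonoidal.isFinite (k := k) (C := N)).exists_isProgenerator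
  let := L.action
  have := L.linear_actOn PN
  have := L.preservesFiniteColimits_actOn PN
  obtain ⟨G, adj, _, n₁, hη⟩ := hB.exists_adjunction (fun c => (hC c).2) hPC hPN
    R.preservesFiniteColimits_actRight R.preservesFiniteColimits_actLeft PN
    fun c _ => L.projective_actOn hN PN c
  have := HasFiniteBiproducts.of_hasFiniteCoproducts (C := T)
  have := hasBinaryBiproducts_of_finite_biproducts T
  have : HasZeroObject T := inferInstance
  have : (B.boxL PN).Linear k := hB_left PN
  have hP := BalancedFunctor.isProgenerator_box hB hPM hPN adj
  have hbox (t : T) : ∃ (x : M) (π : B.box x PN ⟶ t), Epi π ∧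
      IsCokernelProjective (B.box x PN) := by
    obtain ⟨A, hA, a, _⟩ := hP.exists_epi t
    obtain ⟨x, ⟨e⟩⟩ := BalancedFunctor.exists_box_of_isFree hA
    exact ⟨x, e.hom ≫ a, inferInstance, (hP.projective.of_isFree hA).of_iso e.symm⟩
  have hπ (t : T) : ∃ (p : M × N) (π : B.functor.obj p ⟶ t), Epi π ∧
      IsCokernelProjective (B.functor.obj p) := by
    obtain ⟨x, π, h⟩ := hbox t
    exact ⟨(x, PN), π, h⟩
  have : MonoidalPreadditive T := monoidalPreadditive_of_additive
    (fun a => additive_of_preservesFiniteColimits _)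
    (fun a => additive_of_preservesFiniteColimits _)
  have : MonoidalLinear k T := monoidalLinear_of_epi B.functor hB_left fun t => by
    obtain ⟨p, π, h, -⟩ := hπ t
    exact ⟨p, π, h⟩
  refine ⟨⟨hP.isFiniteCategory, hT_left, hT_right⟩, fun t => ?_, hπ⟩
  obtain ⟨η, hη⟩ := hη t
  refine ⟨_, η, ⟨fun {s} f g hfg => ?_⟩⟩
  obtain ⟨x, π, _, -⟩ := hbox s
  let π' : (B.boxL PN).obj x ⟶ s := π
  -- Maps `x ⊠ PN ⟶ t` are maps `x ⟶ G t`, on which the monomorphism `G η` can be cancelled; the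
  -- cover `π` then transfers this to `s`.
  have key : π' ≫ f = π' ≫ g := (adj.homEquiv x t).injective (by
    rw [← cancel_mono (G.map η), ← adj.homEquiv_naturality_right, ← adj.homEquiv_naturality_right,
      Category.assoc, Category.assoc, hfg])
  exact (cancel_epi π).1 key

end

end RigidityCriterion

open RigidityCriterion in
theorem proposition2p35 (k : Type u) [Field k]
    -- a braided multi-tensor category `C`
    (C : Type w) [Category.{v} C] [Preadditive C] [Linear k C] [MonoidalCategory C]
    [BraidedCategory C] [IsFiniteMonoidal k C] (hC : IsRigid C)
    -- a rigid monoidal right `C`-module `M`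
    (M : Type w) [Category.{v} M] [Preadditive M] [Linear k M] [MonoidalCategory M]
    [IsFiniteMonoidal k M] (hM : IsRigid M) (R : MonoidalRightModule k C M)
    -- a rigid monoidal left `C`-module `N`
    (N : Type w) [Category.{v} N] [Preadditive N] [Linear k N] [MonoidalCategory N]
    [IsFiniteMonoidal k N] (hN : IsRigid N) (L : MonoidalLeftModule k C N)
    -- the tensor product `T` of `M` and `N` over `C`, with its `k`-linear structure
    (T : Type w) [Category.{v} T] [HasFiniteColimits T] [Preadditive T] [Linear k T]
    (B : BalancedFunctor R.action L.action T) (hB : B.IsTensorProduct)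
    (hB_left : ∀ y : N, (Prod.sectL M y ⋙ B.functor).Linear k)
    (hB_right : ∀ x : M, (Prod.sectR x N ⋙ B.functor).Linear k)
    -- its monoidal structure
    [MonoidalCategory T] [B.functor.Monoidal]
    (hT_left : ∀ a : T, PreservesFiniteColimits (tensorLeft a))
    (hT_right : ∀ a : T, PreservesFiniteColimits (tensorRight a)) :
    IsFiniteMonoidal k T ∧
    IsRCategory T ∧
    List.TFAE
      [ IsRigid T,
        TensorIsLeftExact T,
        ∀ a b : T, LengthEquality a b,
        ∀ (a' b' : M) (a'' b'' : N), Simple a' → Simple b' → Simple a'' → Simple b'' →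
          LengthEquality (B.functor.obj (a', a'')) (B.functor.obj (b', b'')) ] ∧
    ((∀ (x : M) (y : N), Simple x → Simple y → IsSemisimpleObject (B.functor.obj (x, y))) →
      IsRigid T) := by
  obtain ⟨_, rfl⟩ := (IsFiniteMonoidal.isFinite (k := k) (C := C)).exists_abelian
  obtain ⟨_, rfl⟩ := (IsFiniteMonoidal.isFinite (k := k) (C := M)).exists_abelian
  obtain ⟨_, rfl⟩ := (IsFiniteMonoidal.isFinite (k := k) (C := N)).exists_abelian
  obtain ⟨hT, hη, hπ⟩ :=
    isFiniteMonoidal_tensorProduct hC R hN L hB hB_left hT_left hT_right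
  refine ⟨hT, ?_⟩
  -- Only now, with finiteness proved, is `T` available as an abelian category.
  obtain ⟨_, rfl⟩ := hT.isFinite.exists_abelian
  have := B.rightExact_left
  have := B.rightExact_right
  exact isRCategory_and_tfae k hM hN B.functor hη fun t => by
    obtain ⟨p, π, h, h'⟩ := hπ t
    exact ⟨p, π, h, h'.projective⟩
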